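/- Let $n\ge 1$, $s\in(0,1]$, $\lambda>0$ and $1<p<1+\frac{4s}{n}$. Let $V:[0,\infty)\to[0,\infty)$ be a trapping potential: $V$ is continuous on $[0,\infty)$, $C^1$ on $(0,\infty)$ with $V'(r)>0$ for $r>0$, $V(r)\to\infty$ as $r\to\infty$, and $V(r)\le C(1+r)^N$ for all $r\ge 0$, for some constants $C$ and $N>1$; write $V(x)=V(|x|)$ for $x\in\mathbb R^n$. All functions are real valued, and $\langle\cdot,\cdot\rangle$, $\|\cdot\|$ are the inner product and norm of $L^2(\mathbb R^n)$. Let $X_s=H^s(\mathbb R^n)\cap L^2(V\,dx)$ be the energy space and let $\phi$ be a normalized ground state, i.e. a minimizer of $$E[u]=\tfrac12\Big(\||\nabla|^s u\|^2+\int_{\mathbb R^n} V|u|^2\,dx\Big)-\tfrac1{p+1}\int_{\mathbb R^n}|u|^{p+1}\,dx$$ over all $u\in X_s$ with $\int|u|^2\,dx=\lambda$. Put $$\omega=-\frac1\lambda\Big(\||\nabla|^s\phi\|^2+\int_{\mathbb R^n} V\phi^2\,dx-\int_{\mathbb R^n}|\phi|^{p+1}\,dx\Big),$$ and let $$\mathcal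 L_+=(-\Delta)^s+V+\omega-p|\phi|^{p-1},\qquad \mathcal L_-=(-\Delta)^s+V+\omega-|\phi|^{p-1}$$ be the self-adjoint operators in $L^2(\mathbb R^n)$ associated with the corresponding quadratic forms $Q_\pm$ on $X_s$ (so $u\in D(\mathcal L_\pm)$ and $\mathcal L_\pm u=f\in L^2$ mean that $u\in X_s$ and $Q_\pm(u,v)=\langle f,v\rangle$ for all $v\in X_s$). Then: 1. $\mathcal L_+$ has exactly one negative eigenvalue, and this eigenvalue is simple. 2. $\mathcal L_+\ge 0$ on $\{\phi\}^\perp$, i.e. $Q_+(h,h)\ge 0$ for all $h\in X_s$ with $\langle\phi,h\rangle=0$. 3. $\phi\perp \mathrm{Ker}\,\mathcal L_+$. 4. $\mathcal L_-\ge 0$, i.e. $Q_-(h,h)\ge 0$ for all $h\in X_s$, and $\phi\in D(\mathcal L_-)$ with $\mathcal L_-\phi=0$. 5. There is $\delta>0$ such that $\mathcal L_-\ge\delta$ on $\{\phi\}^\perp$, i.e. $Q_-(h,h)\ge\delta\|h\|^2$ for all $h\in X_s$ with $\langle\phi,h\rangle=0$. 6. $\mathrm{Ker}\,\mathcal L_-=\mathrm{span}[\phi]$.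 -/

import Mathlib

open MeasureTheory
open scoped FourierTransform InnerProductSpace

namespace TrappedNLS

noncomputable section

/-- `ℝⁿ` with its Euclidean norm. -/
abbrev Rn (n : ℕ) : Type := EuclideanSpace ℝ (Fin n)

/-- The real Hilbert space `L²(ℝⁿ; ℝ)`. -/
abbrev L2 (n : ℕ) : Type := Lp ℝ 2 (volume : Measure (Rn n))

/-- A trapping radial profile `V : [0, ∞) → [0, ∞)` (only its values on `[0, ∞)` matter; the
potential on `ℝⁿ` is `x ↦ V ‖x‖`): nonnegative, continuous on `[0, ∞)`, continuously differentiable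
with positive derivative on `(0, ∞)`, tending to infinity, with at most polynomial growth. -/
structure IsTrapping (V : ℝ → ℝ) : Prop where
  nonneg : ∀ r, 0 ≤ r → 0 ≤ V r
  continuousOn : ContinuousOn V (Set.Ici 0)
  contDiffOn : ContDiffOn ℝ 1 V (Set.Ioi 0)
  deriv_pos : ∀ r, 0 < r → 0 < deriv V r
  tendsto : Filter.Tendsto V Filter.atTop Filter.atTop
  growth : ∃ N C : ℝ, 1 < N ∧ ∀ r, 0 ≤ r → V r ≤ C * (1 + r) ^ N

variable {n : ℕ}

/-- The `L²` Fourier transform of a real function, in the normalization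
`û(ξ) = ∫ exp(-2πi x·ξ) u(x) dx`, which is unitary on `L²`. -/
def fourierL2 (u : L2 n) : Lp ℂ 2 (volume : Measure (Rn n)) :=
  𝓕 (Complex.ofRealCLM.compLp u)

/-- The Fourier multiplier of `(-Δ)ˢ`. In the normalization of `fourierL2` the operator `-Δ` has
symbol `(2π|ξ|)²`. -/
def fracSymbol (s : ℝ) (ξ : Rn n) : ℝ := (2 * Real.pi * ‖ξ‖) ^ (2 * s)

/-- `⟨|∇|ˢ u, |∇|ˢ v⟩`, computed on the Fourier side by Plancherel (for real `u`, `v` the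
integral of the complex product is real). -/
def kineticForm (s : ℝ) (u v : L2 n) : ℝ :=
  ∫ ξ : Rn n, fracSymbol s ξ * (inner ℂ (fourierL2 u ξ) (fourierL2 v ξ)).re

/-- `∫ V(|x|) u(x) v(x) dx`. -/
def potentialForm (V : ℝ → ℝ) (u v : L2 n) : ℝ :=
  ∫ x : Rn n, V ‖x‖ * (u x * v x)

/-- Membership in the energy space `X_s = Hˢ(ℝⁿ) ∩ L²(V dx)`: `u ∈ L²` with
`‖|∇|ˢ u‖²_{L²} + ∫ V u² < ∞`. -/
def MemEnergySpace (s : ℝ) (V : ℝ → ℝ) (u : L2 n) : Prop :=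
  Integrable (fun ξ : Rn n => fracSymbol s ξ * ‖fourierL2 u ξ‖ ^ 2) ∧
    Integrable (fun x : Rn n => V ‖x‖ * u x ^ 2)

/-- The energy
`E[u] = (1/2) (‖|∇|ˢ u‖² + ∫ V |u|²) - (1/(p+1)) ∫ |u|^{p+1}`, used on the energy space. For
`1 < p < 1 + 4s/n` the last integral converges there by Sobolev embedding. -/
def energy (s p : ℝ) (V : ℝ → ℝ) (u : L2 n) : ℝ :=
  (1 / 2) * (kineticForm s u u + potentialForm V u u) -
    (1 / (p + 1)) * ∫ x : Rn n, |u x| ^ (p + 1)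

/-- `φ` is a normalized ground state of mass `lam`: a minimizer of the energy over all
`u` in the energy space with `∫ u² = lam`. -/
structure IsNormalizedWave (s p : ℝ) (V : ℝ → ℝ) (lam : ℝ) (φ : L2 n) : Prop where
  mem : MemEnergySpace s V φ
  mass : ∫ x : Rn n, φ x ^ 2 = lam
  minimal : ∀ u : L2 n, MemEnergySpace s V u → ∫ x : Rn n, u x ^ 2 = lam →
    energy s p V φ ≤ energy s p V u

/-- The Lagrange multiplier
`ω = -(‖|∇|ˢ φ‖² + ∫ V φ² - ∫ |φ|^{p+1}) / ∫ φ²`; it is the only `ω` for which the equation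
`(-Δ)ˢ φ + V φ + ω φ - |φ|^{p-1} φ = 0` can hold, as one sees by testing it with `φ`. -/
def multiplier (s p : ℝ) (V : ℝ → ℝ) (φ : L2 n) : ℝ :=
  -(kineticForm s φ φ + potentialForm V φ φ - ∫ x : Rn n, |φ x| ^ (p + 1)) /
    ∫ x : Rn n, φ x ^ 2

/-- The quadratic form, polarized, of `(-Δ)ˢ + V + ω - c |φ|^{p-1}` on the energy space, with
`ω` the Lagrange multiplier of `φ`. -/
def linForm (s p : ℝ) (V : ℝ → ℝ) (φ : L2 n) (c : ℝ) (u v : L2 n) : ℝ :=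
  kineticForm s u v + potentialForm V u v + multiplier s p V φ * ⟪u, v⟫_ℝ -
    c * ∫ x : Rn n, |φ x| ^ (p - 1) * (u x * v x)

/-- The quadratic form of `L₊ = (-Δ)ˢ + V + ω - p |φ|^{p-1}`. -/
def formPlus (s p : ℝ) (V : ℝ → ℝ) (φ u v : L2 n) : ℝ := linForm s p V φ p u v

/-- The quadratic form of `L₋ = (-Δ)ˢ + V + ω - |φ|^{p-1}`. -/
def formMinus (s p : ℝ) (V : ℝ → ℝ) (φ u v : L2 n) : ℝ := linForm s p V φ 1 u v

/-- The graph of the self-adjoint operator `A` in `L²` associated with a form `q` on the energy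
space: `u ∈ D(A)` and `A u = f` mean that `u` is in the energy space and `q(u, v) = ⟨f, v⟩` for
all `v` in it. -/
def OperatorGraph (s : ℝ) (V : ℝ → ℝ) (q : L2 n → L2 n → ℝ) (u f : L2 n) : Prop :=
  MemEnergySpace s V u ∧ ∀ v : L2 n, MemEnergySpace s V v → q u v = ⟪f, v⟫_ℝ

/-- `u ∈ D(L₊)` and `L₊ u = f`. -/
def LPlus (s p : ℝ) (V : ℝ → ℝ) (φ u f : L2 n) : Prop :=
  OperatorGraph s V (formPlus s p V φ) u f

/-- `u ∈ D(L₋)` and `L₋ u = f`. -/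
def LMinus (s p : ℝ) (V : ℝ → ℝ) (φ u f : L2 n) : Prop :=
  OperatorGraph s V (formMinus s p V φ) u f

end

end TrappedNLS

open TrappedNLS

/-!
The proof rests on three facts about the energy space: its embedding into `L²` is compact, the
kinetic energy does not increase under `u ↦ |u|`, and forms of Schrödinger type on it are
irreducible.

*Analysis of the energy space.* Plancherel's theorem turns the norm of `u (· + h) - u` into a
weighted norm of the Fourier transform (`shiftEnergy_eq_fourier`). Hence translations are Hölder
continuous in `L²` (`shiftEnergy_le`), and for `s < 1` the kinetic energy is an average of the
squares of these norms against the kernel `|h|^{-n-2s}` (`exists_kinEnergy_eq`). The second fact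
gives `kinEnergy_abs_le`, the case `s = 1` being the limit `s → 1`. The first, combined with
averages over small balls, gives a subcritical Sobolev inequality (`exists_sobolev_bound`) and,
since `V` tends to infinity, compactness of the energy balls (`isCompact_energy_le`). The Sobolev
inequality makes `|φ|^{p-1}` infinitesimally form bounded (`nonlinForm_self_le`), so the forms of
`L₊` and `L₋` are bounded below and attain their minima over the unit spheres of closed subspaces
(`exists_isMin_schrodForm`). An eigenvector at the bottom of the spectrum is then a null
vector of a nonnegative shifted form (`schrodForm_eq_zero_of_null`), which makes a general theory of
unbounded operators unnecessary.

*Second variation.* Along the great circles `cos t φ + sin t h` of the sphere of mass `lam`, with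
`h` orthogonal to `φ`, the energy has a minimum at `t = 0`. The first derivative gives `L₋ φ = 0`
(`formMinus_eq_zero`), the second gives `L₊ ≥ 0` on the complement of `φ`
(`formPlus_nonneg_of_orthogonal`). As `⟨L₊ φ, φ⟩ < 0`, linear algebra on two-dimensional spaces
then yields the statements about the negative eigenvalue and the kernel of `L₊`.

*Perron-Frobenius.* Two nonzero nonnegative functions with disjoint supports, the first of which is
a null vector of a nonnegative form, do not exist (`eq_zero_of_disjoint_null`). For `s < 1` this is
nonlocality: by the Gagliardo representation the kinetic form of two such functions is nonzero. For
`s = 1` the energy space is stable under restriction to the positivity set `A` of a nonnegative null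
vector `θ`, because the truncations `min f (k θ)` have bounded energy
(`memEnergySpace_restrictPos`). So the indicator of `A` is locally in `H¹`, and translation by `h`
changes it by `O(|h|²)` in measure; subdividing a translation into `N` steps shows that it does not
change at all. Irreducibility forces null vectors to have a constant sign
(`eq_abs_or_eq_neg_abs_of_null`), and no two of them are orthogonal. Since `|φ|` is a null vector of
`L₋`, the bottom of the spectrum of `L₋` is zero and its kernel is spanned by `φ`; compactness turns
this into a gap.
-/

namespace TrappedNLS

open Filter Topology
open scoped ENNReal NNReal

variable {n : ℕ}

/-! ### Translations and the Fourier side of the quadratic forms -/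

section Translation

variable {E : Type*} [NormedAddCommGroup E]

/-- The translate `x ↦ u (x + h)` of an `L²` function. -/
noncomputable def translate (h : Rn n) (u : Lp E 2 (volume : Measure (Rn n))) :
    Lp E 2 (volume : Measure (Rn n)) :=
  Lp.compMeasurePreserving (fun x => x + h) (measurePreserving_add_right volume h) u

theorem coeFn_translate (h : Rn n) (u : Lp E 2 (volume : Measure (Rn n))) :
    translate h u =ᵐ[volume] fun x => u (x + h) :=
  Lp.coeFn_compMeasurePreserving u (measurePreserving_add_right volume h)

theorem continuous_translate (h : Rn n) :
    Continuous (translate h : Lp E 2 (volume : Measure (Rn n)) → _) :=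
  (Lp.isometry_compMeasurePreserving (measurePreserving_add_right volume h)).continuous

/-- The character `exp (2πi ⟨h, ξ⟩)`, the Fourier multiplier of the translation by `h`. -/
noncomputable def phase (h ξ : Rn n) : ℂ := (𝐞 ⟪h, ξ⟫_ℝ : Circle)

theorem continuous_phase (h : Rn n) : Continuous (phase h) := by
  unfold phase
  exact continuous_subtype_val.comp (Real.continuous_fourierChar.comp (by fun_prop))

theorem norm_phase (h ξ : Rn n) : ‖phase h ξ‖ = 1 := Circle.norm_coe _

theorem phase_eq (h ξ : Rn n) :
    phase h ξ = Complex.exp (Complex.I * ((2 * Real.pi * ⟪h, ξ⟫_ℝ : ℝ) : ℂ)) := by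
  rw [phase, Real.fourierChar_apply]
  congr 1
  push_cast
  ring

theorem memLp_phase_mul (h : Rn n) (f : Lp ℂ 2 (volume : Measure (Rn n))) :
    MemLp (fun ξ => phase h ξ * f ξ) 2 volume := by
  refine (Lp.memLp f).of_le
    ((continuous_phase h).aestronglyMeasurable.mul (Lp.aestronglyMeasurable f)) ?_
  exact Eventually.of_forall fun ξ => by simp [norm_phase]

/-- Multiplication by `phase h` as a map of `L²`. -/
noncomputable def phaseMul (h : Rn n) (f : Lp ℂ 2 (volume : Measure (Rn n))) :
    Lp ℂ 2 (volume : Measure (Rn n)) :=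
  (memLp_phase_mul h f).toLp _

theorem coeFn_phaseMul (h : Rn n) (f : Lp ℂ 2 (volume : Measure (Rn n))) :
    phaseMul h f =ᵐ[volume] fun ξ => phase h ξ * f ξ :=
  (memLp_phase_mul h f).coeFn_toLp

theorem continuous_phaseMul (h : Rn n) : Continuous (phaseMul h) := by
  refine Isometry.continuous (Isometry.of_dist_eq fun f g => ?_)
  rw [dist_eq_norm, dist_eq_norm, Lp.norm_def, Lp.norm_def]
  congr 1
  refine eLpNorm_congr_norm_ae ?_
  filter_upwards [Lp.coeFn_sub (phaseMul h f) (phaseMul h g), Lp.coeFn_sub f g,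
    coeFn_phaseMul h f, coeFn_phaseMul h g] with ξ h1 h2 h3 h4
  rw [h1, h2, Pi.sub_apply, Pi.sub_apply, h3, h4, ← mul_sub, norm_mul, norm_phase, one_mul]

/-- The Fourier transform on `L²` turns translations into multiplication by characters. Mathlib has
this for integrable functions; it extends from Schwartz functions by density. -/
theorem fourier_translate (h : Rn n) (f : Lp ℂ 2 (volume : Measure (Rn n))) :
    𝓕 (translate h f) = phaseMul h (𝓕 f) := by
  have hF : Continuous (fun f : Lp ℂ 2 (volume : Measure (Rn n)) => 𝓕 f) :=
    (Lp.fourierTransformₗᵢ (Rn n) ℂ).continuous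
  refine DenseRange.induction_on
    (p := fun f : Lp ℂ 2 (volume : Measure (Rn n)) => 𝓕 (translate h f) = phaseMul h (𝓕 f))
    (SchwartzMap.denseRange_toLpCLM (p := 2) ENNReal.ofNat_ne_top) f
    (isClosed_eq (hF.comp (continuous_translate h)) ((continuous_phaseMul h).comp hF)) fun g => ?_
  simp only [SchwartzMap.toLpCLM_apply]
  have h1 : translate h (g.toLp 2 volume) = (g.compSubConstCLM ℂ (-h)).toLp 2 volume := by
    refine Lp.ext ?_
    have hg := g.coeFn_toLp 2 (volume : Measure (Rn n))
    have hg' := (measurePreserving_add_right (volume : Measure (Rn n)) h).quasiMeasurePreserving.ae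
      hg
    filter_upwards [coeFn_translate h (g.toLp 2 volume), hg',
      (g.compSubConstCLM ℂ (-h)).coeFn_toLp 2 (volume : Measure (Rn n))] with x h1 h2 h3
    rw [h1, h2, h3]
    simp
  rw [h1, SchwartzMap.toLp_fourier_eq, SchwartzMap.toLp_fourier_eq]
  refine Lp.ext ?_
  filter_upwards [(𝓕 (g.compSubConstCLM ℂ (-h))).coeFn_toLp 2 (volume : Measure (Rn n)),
    coeFn_phaseMul h ((𝓕 g).toLp 2 volume), (𝓕 g).coeFn_toLp 2 (volume : Measure (Rn n))]
    with ξ h1 h2 h3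
  rw [h1, h2, h3, SchwartzMap.fourier_coe, SchwartzMap.fourier_coe]
  have := congrFun (VectorFourier.fourierIntegral_comp_add_right (𝐞) (volume : Measure (Rn n))
    (innerₗ (Rn n)) g h) ξ
  rw [Circle.smul_def, smul_eq_mul] at this
  have h4 : ⇑(g.compSubConstCLM ℂ (-h)) = ⇑g ∘ fun v => v + h := by
    ext v
    simp
  rw [h4]
  exact this

end Translation

section Energies

/-- `‖|∇|ˢ u‖²` as an extended nonnegative number. -/
noncomputable def kinEnergy (s : ℝ) (u : L2 n) : ℝ≥0∞ :=
  ∫⁻ ξ, ENNReal.ofReal (fracSymbol s ξ) * ‖fourierL2 u ξ‖ₑ ^ 2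

/-- `∫ V(|x|) u(x)² dx` as an extended nonnegative number. -/
noncomputable def potEnergy (V : ℝ → ℝ) (u : L2 n) : ℝ≥0∞ :=
  ∫⁻ x : Rn n, ENNReal.ofReal (V ‖x‖) * ‖u x‖ₑ ^ 2

/-- `‖u(· + h) - u‖²` as an extended nonnegative number. -/
noncomputable def shiftEnergy (h : Rn n) (u : L2 n) : ℝ≥0∞ :=
  ∫⁻ x, ‖u (x + h) - u x‖ₑ ^ 2

theorem fourierL2_eq (u : L2 n) :
    fourierL2 u = Lp.fourierTransformₗᵢ (Rn n) ℂ (Complex.ofRealCLM.compLpL 2 volume u) := rfl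

/-- The Fourier transform of real `L²` functions as a real-linear map. -/
noncomputable def fourierLin : L2 n →L[ℝ] Lp ℂ 2 (volume : Measure (Rn n)) :=
  ((Lp.fourierTransformₗᵢ (Rn n) ℂ).toContinuousLinearEquiv.toContinuousLinearMap.restrictScalars
    ℝ).comp (Complex.ofRealCLM.compLpL 2 volume)

theorem fourierL2_add (u v : L2 n) : fourierL2 (u + v) = fourierL2 u + fourierL2 v :=
  fourierLin.map_add u v

theorem fourierL2_sub (u v : L2 n) : fourierL2 (u - v) = fourierL2 u - fourierL2 v :=
  fourierLin.map_sub u v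

theorem fourierL2_smul (c : ℝ) (u : L2 n) : fourierL2 (c • u) = c • fourierL2 u :=
  fourierLin.map_smul c u

theorem continuous_fourierL2 : Continuous (fourierL2 : L2 n → _) := fourierLin.continuous

theorem norm_fourierL2 (u : L2 n) : ‖fourierL2 u‖ = ‖u‖ := by
  rw [fourierL2_eq, LinearIsometryEquiv.norm_map, Lp.norm_def, Lp.norm_def]
  congr 1
  refine eLpNorm_congr_norm_ae ?_
  filter_upwards [ContinuousLinearMap.coeFn_compLpL (p := 2) (μ := volume) Complex.ofRealCLM u]
    with x hx
  rw [hx]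
  simp

theorem lintegral_enorm_sq_eq {E : Type*} [NormedAddCommGroup E]
    (u : Lp E 2 (volume : Measure (Rn n))) :
    ∫⁻ x, ‖u x‖ₑ ^ 2 = ENNReal.ofReal (‖u‖ ^ 2) := by
  rw [Lp.norm_def, ← ENNReal.toReal_pow,
    ENNReal.ofReal_toReal (ENNReal.pow_ne_top (Lp.eLpNorm_ne_top u)),
    eLpNorm_eq_lintegral_rpow_enorm_toReal (by simp) (by simp), ← ENNReal.rpow_natCast,
    ← ENNReal.rpow_mul]
  simp

theorem shiftEnergy_eq_fourier (h : Rn n) (u : L2 n) :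
    shiftEnergy h u = ∫⁻ ξ, ‖phase h ξ - 1‖ₑ ^ 2 * ‖fourierL2 u ξ‖ₑ ^ 2 := by
  have h1 : shiftEnergy h u = ∫⁻ x, ‖(translate h u - u) x‖ₑ ^ 2 := by
    refine lintegral_congr_ae ?_
    filter_upwards [Lp.coeFn_sub (translate h u) u, coeFn_translate h u] with x h1 h2
    rw [h1, Pi.sub_apply, h2]
  have h2 : Complex.ofRealCLM.compLp (translate h u) = translate h (Complex.ofRealCLM.compLp u) := by
    refine Lp.ext ?_
    have := (measurePreserving_add_right (volume : Measure (Rn n)) h).quasiMeasurePreserving.ae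
      (Complex.ofRealCLM.coeFn_compLp u)
    filter_upwards [Complex.ofRealCLM.coeFn_compLp (translate h u), coeFn_translate h u,
      coeFn_translate h (Complex.ofRealCLM.compLp u), this] with x h1 h2 h3 h4
    rw [h1, h2, h3, h4]
  have h3 : fourierL2 (translate h u) = phaseMul h (fourierL2 u) := by
    rw [fourierL2, h2, fourier_translate]
    rfl
  rw [h1, lintegral_enorm_sq_eq, ← norm_fourierL2, ← lintegral_enorm_sq_eq, fourierL2_sub, h3]
  refine lintegral_congr_ae ?_
  filter_upwards [Lp.coeFn_sub (phaseMul h (fourierL2 u)) (fourierL2 u),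
    coeFn_phaseMul h (fourierL2 u)] with ξ h1 h2
  rw [h1, Pi.sub_apply, h2, ← mul_pow, ← enorm_mul]
  congr 2
  ring

theorem fracSymbol_nonneg (s : ℝ) (ξ : Rn n) : 0 ≤ fracSymbol s ξ := by
  unfold fracSymbol; positivity

theorem continuous_fracSymbol {s : ℝ} (hs : 0 < s) : Continuous (fracSymbol s : Rn n → ℝ) := by
  unfold fracSymbol
  exact Continuous.rpow_const (by fun_prop) fun _ => Or.inr (by positivity)

theorem norm_phase_sub_one_le (h ξ : Rn n) : ‖phase h ξ - 1‖ ≤ ‖h‖ * (2 * Real.pi * ‖ξ‖) := by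
  rw [phase_eq]
  refine Real.norm_exp_I_mul_ofReal_sub_one_le.trans ?_
  rw [norm_mul, Real.norm_of_nonneg (by positivity : 0 ≤ 2 * Real.pi)]
  have := norm_inner_le_norm (𝕜 := ℝ) h ξ
  nlinarith [Real.pi_pos]

theorem norm_phase_sub_one_le_two (h ξ : Rn n) : ‖phase h ξ - 1‖ ≤ 2 := by
  refine (norm_sub_le _ _).trans ?_
  rw [norm_phase, norm_one]; norm_num

/-- `|e^{iθ} - 1|² ≤ 4 |θ|^{2s}` for `0 < s ≤ 1`, interpolating between the bounds `|θ|` and `2`. -/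
theorem norm_phase_sub_one_sq_le {s : ℝ} (hs0 : 0 < s) (hs1 : s ≤ 1) (h ξ : Rn n) :
    ‖phase h ξ - 1‖ ^ 2 ≤ 4 * ‖h‖ ^ (2 * s) * fracSymbol s ξ := by
  have hθ : 0 ≤ ‖h‖ * (2 * Real.pi * ‖ξ‖) := by positivity
  have e : 4 * ‖h‖ ^ (2 * s) * fracSymbol s ξ = 4 * (‖h‖ * (2 * Real.pi * ‖ξ‖)) ^ (2 * s) := by
    rw [fracSymbol, Real.mul_rpow (by positivity : (0 : ℝ) ≤ ‖h‖) (by positivity), mul_assoc]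
  rw [e]
  have h1 := norm_phase_sub_one_le h ξ
  have h2 := norm_phase_sub_one_le_two h ξ
  have h0 := norm_nonneg (phase h ξ - 1)
  generalize ‖h‖ * (2 * Real.pi * ‖ξ‖) = θ at *
  rcases le_total θ 1 with h3 | h3
  · have h4 : θ ^ (2 : ℝ) ≤ θ ^ (2 * s) :=
      Real.rpow_le_rpow_of_exponent_ge_of_imp hθ h3 (by linarith) (by intros; linarith)
    rw [Real.rpow_two] at h4
    nlinarith
  · have h4 : 1 ≤ θ ^ (2 * s) := Real.one_le_rpow h3 (by positivity)
    nlinarith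

/-- Translation is Hölder continuous of order `s` in `L²` on functions of finite kinetic energy. -/
theorem shiftEnergy_le {s : ℝ} (hs0 : 0 < s) (hs1 : s ≤ 1) (h : Rn n) (u : L2 n) :
    shiftEnergy h u ≤ ENNReal.ofReal (4 * ‖h‖ ^ (2 * s)) * kinEnergy s u := by
  rw [shiftEnergy_eq_fourier, kinEnergy, ← lintegral_const_mul' _ _ ENNReal.ofReal_ne_top]
  refine lintegral_mono fun ξ => ?_
  rw [← mul_assoc, ← ENNReal.ofReal_mul (by positivity)]
  gcongr
  rw [← ofReal_norm, ← ENNReal.ofReal_pow (norm_nonneg _)]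
  exact ENNReal.ofReal_le_ofReal (norm_phase_sub_one_sq_le hs0 hs1 h ξ)

section LowerSemicontinuity

variable {α E : Type*} [MeasurableSpace α] {μ : Measure α} [NormedAddCommGroup E]

/-- Weighted `L²` norms are lower semicontinuous on `L²`, by Fatou's lemma. -/
theorem lowerSemicontinuous_weighted {w : α → ℝ} (hw : Measurable w) :
    LowerSemicontinuous fun f : Lp E 2 μ => ∫⁻ x, ENNReal.ofReal (w x) * ‖f x‖ₑ ^ 2 ∂μ := by
  rw [lowerSemicontinuous_iff_isClosed_preimage]
  intro B
  refine IsSeqClosed.isClosed fun f g hf hfg => ?_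
  obtain ⟨ns, -, hns⟩ := (tendstoInMeasure_of_tendsto_Lp hfg).exists_seq_tendsto_ae
  have hfr : ∃ᶠ k in atTop, ∫⁻ x, ENNReal.ofReal (w x) * ‖f (ns k) x‖ₑ ^ 2 ∂μ ≤ B :=
    Frequently.of_forall fun k => hf (ns k)
  refine (lintegral_mono_ae ?_).trans ((lintegral_liminf_le'
    (f := fun k x => ENNReal.ofReal (w x) * ‖f (ns k) x‖ₑ ^ 2) fun k => ?_).trans
    (liminf_le_of_frequently_le' hfr))
  · filter_upwards [hns] with x hx
    refine le_of_eq (Tendsto.liminf_eq ?_).symm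
    exact ENNReal.Tendsto.const_mul ((ENNReal.continuous_pow 2).tendsto _ |>.comp hx.enorm)
      (Or.inr ENNReal.ofReal_ne_top)
  · exact hw.ennreal_ofReal.aemeasurable.mul ((Lp.aestronglyMeasurable _).enorm.pow_const 2)

end LowerSemicontinuity

end Energies

/-! ### The Gagliardo representation of the kinetic energy -/

section SingularIntegral

/-- The kernel `|h|^{-n-2s}` of the Gagliardo seminorm. -/
noncomputable def gagliardoKernel (s : ℝ) (h : Rn n) : ℝ := ‖h‖ ^ (-(n : ℝ) - 2 * s)

theorem measurable_gagliardoKernel (s : ℝ) : Measurable (gagliardoKernel s : Rn n → ℝ) := by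
  unfold gagliardoKernel; fun_prop

theorem gagliardoKernel_pos (s : ℝ) {h : Rn n} (hh : h ≠ 0) : 0 < gagliardoKernel s h :=
  Real.rpow_pos_of_pos (norm_pos_iff.2 hh) _

/-- The Fourier symbol of the Gagliardo seminorm. -/
noncomputable def gagliardoSymbol (s : ℝ) (ξ : Rn n) : ℝ≥0∞ :=
  ∫⁻ h, ENNReal.ofReal (gagliardoKernel s h) * ‖phase h ξ - 1‖ₑ ^ 2

theorem gagliardoSymbol_lt_top (hn : 1 ≤ n) {s : ℝ} (hs0 : 0 < s) (hs1 : s < 1) (ξ : Rn n) :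
    gagliardoSymbol s ξ < ∞ := by
  have : NeZero n := ⟨by omega⟩
  set b : ℝ := 2 * Real.pi * ‖ξ‖ with hb
  set F : ℝ → ℝ := fun r => r ^ (-(n : ℝ) - 2 * s) * min 4 ((r * b) ^ 2) with hF
  have hint : Integrable (fun h : Rn n => F ‖h‖) := by
    rw [integrable_fun_norm_addHaar volume, finrank_euclideanSpace_fin]
    have hmeas : Measurable fun y : ℝ => y ^ (n - 1) • F y := by
      simp only [hF]; fun_prop
    have key : ∀ y : ℝ, 0 < y → y ^ (n - 1) • F y = y ^ (-1 - 2 * s) * min 4 ((y * b) ^ 2) := by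
      intro y hy
      rw [hF, smul_eq_mul, ← mul_assoc, ← Real.rpow_natCast, ← Real.rpow_add hy,
        Nat.cast_sub hn]
      congr 2
      push_cast; ring
    rw [← Set.Ioc_union_Ioi_eq_Ioi zero_le_one]
    refine IntegrableOn.union ?_ ?_
    · have h1 : IntegrableOn (fun y : ℝ => b ^ 2 * y ^ (1 - 2 * s)) (Set.Ioc 0 1) :=
        ((intervalIntegrable_iff_integrableOn_Ioc_of_le zero_le_one).1
          (intervalIntegral.intervalIntegrable_rpow' (by linarith))).const_mul _
      refine h1.mono' hmeas.aestronglyMeasurable ?_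
      refine (ae_restrict_mem measurableSet_Ioc).mono fun y hy => ?_
      rw [key y hy.1, Real.norm_of_nonneg (by have := hy.1; positivity)]
      have e : y ^ (1 - 2 * s) = y ^ (-1 - 2 * s) * y ^ 2 := by
        rw [← Real.rpow_natCast, ← Real.rpow_add hy.1]; congr 1; push_cast; ring
      rw [e]
      have : 0 < y ^ (-1 - 2 * s) := Real.rpow_pos_of_pos hy.1 _
      nlinarith [min_le_right 4 ((y * b) ^ 2)]
    · have h1 : IntegrableOn (fun y : ℝ => 4 * y ^ (-1 - 2 * s)) (Set.Ioi 1) :=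
        (integrableOn_Ioi_rpow_of_lt (by linarith) one_pos).const_mul _
      refine h1.mono' hmeas.aestronglyMeasurable ?_
      refine (ae_restrict_mem measurableSet_Ioi).mono fun y hy => ?_
      have hy0 : 0 < y := lt_trans one_pos hy
      rw [key y hy0, Real.norm_of_nonneg (by positivity)]
      have : 0 < y ^ (-1 - 2 * s) := Real.rpow_pos_of_pos hy0 _
      nlinarith [min_le_left 4 ((y * b) ^ 2)]
  refine lt_of_le_of_lt (lintegral_mono fun h => ?_) hint.lintegral_lt_top
  rw [hF, ENNReal.ofReal_mul (by positivity)]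
  refine mul_le_mul' le_rfl ?_
  rw [← ofReal_norm, ← ENNReal.ofReal_pow (norm_nonneg _)]
  refine ENNReal.ofReal_le_ofReal (le_min ?_ ?_)
  · nlinarith [norm_phase_sub_one_le_two h ξ, norm_nonneg (phase h ξ - 1)]
  · exact pow_le_pow_left₀ (norm_nonneg _) (norm_phase_sub_one_le h ξ) 2

theorem gagliardoSymbol_ne_zero {s : ℝ} {ξ : Rn n} (hξ : ξ ≠ 0) :
    gagliardoSymbol s ξ ≠ 0 := by
  intro h0
  have hc : Continuous fun h : Rn n => phase h ξ := by
    simp only [phase_eq]; fun_prop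
  rw [gagliardoSymbol, lintegral_eq_zero_iff' (by
    refine ((measurable_gagliardoKernel s).ennreal_ofReal.mul ?_).aemeasurable
    exact (hc.sub continuous_const).measurable.enorm.pow_const 2)] at h0
  have hopen : IsOpen {h : Rn n | h ≠ 0 ∧ phase h ξ ≠ 1} :=
    isOpen_ne.inter (isOpen_ne_fun hc continuous_const)
  have hξ2 : ‖ξ‖ ^ 2 ≠ 0 := by positivity
  have hne : {h : Rn n | h ≠ 0 ∧ phase h ξ ≠ 1}.Nonempty := by
    refine ⟨(1 / (2 * ‖ξ‖ ^ 2)) • ξ, smul_ne_zero (by positivity) hξ, ?_⟩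
    rw [phase_eq, inner_smul_left, real_inner_self_eq_norm_sq]
    have : (2 * Real.pi * ((starRingEnd ℝ) (1 / (2 * ‖ξ‖ ^ 2)) * ‖ξ‖ ^ 2) : ℝ) = Real.pi := by
      simp only [conj_trivial]; field_simp
    rw [this, mul_comm, Complex.exp_pi_mul_I]
    norm_num
  refine (hopen.measure_pos volume hne).ne' ?_
  refine measure_mono_null ?_ h0
  rintro h ⟨h1, h2⟩
  simp [gagliardoKernel_pos s h1, sub_eq_zero, h2]

/-- The Gagliardo symbol is rotation invariant and homogeneous of degree `2s`, by a change of
variables. -/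
theorem gagliardoSymbol_smul_isometry {s : ℝ} (L : Rn n ≃ₗᵢ[ℝ] Rn n) {r : ℝ} (hr : 0 < r)
    (e : Rn n) :
    gagliardoSymbol s (r • L e) = ENNReal.ofReal (r ^ (2 * s)) * gagliardoSymbol s e := by
  have h1 : ∀ g : Rn n → ℝ≥0∞, Measurable g →
      ∫⁻ h, g (r⁻¹ • L h) = ENNReal.ofReal (r ^ (n : ℝ)) * ∫⁻ h, g h := by
    intro g hg
    have hL := L.measurePreserving.lintegral_comp (f := fun h => g (r⁻¹ • h))
      (hg.comp (measurable_const_smul _))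
    rw [hL]
    have hm := Measure.map_addHaar_smul (volume : Measure (Rn n)) (inv_ne_zero hr.ne')
    rw [← lintegral_map hg (measurable_const_smul r⁻¹), hm, lintegral_smul_measure]
    rw [finrank_euclideanSpace_fin, inv_pow, inv_inv, abs_of_pos (by positivity),
      Real.rpow_natCast, smul_eq_mul]
  have hc : Measurable fun h : Rn n => phase h (r • L e) := by
    have : Continuous fun h : Rn n => phase h (r • L e) := by
      simp only [phase_eq]; fun_prop
    exact this.measurable
  have h2 := h1 (fun h => ENNReal.ofReal (gagliardoKernel s h) * ‖phase h (r • L e) - 1‖ₑ ^ 2)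
    ((measurable_gagliardoKernel s).ennreal_ofReal.mul ((hc.sub_const 1).enorm.pow_const 2))
  have h3 : ∀ h : Rn n, phase (r⁻¹ • L h) (r • L e) = phase h e := by
    intro h
    rw [phase, phase, inner_smul_left, inner_smul_right, L.inner_map_map]
    congr 2
    simp only [conj_trivial]; field_simp
  have h4 : ∀ h : Rn n, gagliardoKernel s (r⁻¹ • L h) =
      r ^ ((n : ℝ) + 2 * s) * gagliardoKernel s h := by
    intro h
    rw [gagliardoKernel, gagliardoKernel, norm_smul, L.norm_map, norm_inv,
      Real.norm_of_nonneg hr.le, Real.mul_rpow (by positivity) (by positivity),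
      Real.inv_rpow hr.le, ← Real.rpow_neg hr.le]
    congr 2; ring
  simp only [h3, h4] at h2
  simp only [ENNReal.ofReal_mul (Real.rpow_nonneg hr.le _), mul_assoc] at h2
  rw [lintegral_const_mul' _ _ ENNReal.ofReal_ne_top, Real.rpow_add hr,
    ENNReal.ofReal_mul (by positivity), mul_assoc] at h2
  exact ((ENNReal.mul_right_inj (by
    rw [ENNReal.ofReal_ne_zero_iff]; exact Real.rpow_pos_of_pos hr _)
    ENNReal.ofReal_ne_top).1 h2).symm

/-- The Gagliardo symbol is a multiple of the symbol of `(-Δ)ˢ`; the constant is its value at a unit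
vector, suitably normalized. -/
theorem exists_gagliardoSymbol_eq (hn : 1 ≤ n) {s : ℝ} (hs0 : 0 < s) (hs1 : s < 1) :
    ∃ c : ℝ≥0∞, c ≠ 0 ∧ c ≠ ∞ ∧
      ∀ ξ : Rn n, gagliardoSymbol s ξ = c * ENNReal.ofReal (fracSymbol s ξ) := by
  have : NeZero n := ⟨by omega⟩
  set e : Rn n := EuclideanSpace.single 0 1 with he
  have hen : ‖e‖ = 1 := by simp [he]
  have he0 : e ≠ 0 := by rw [← norm_ne_zero_iff, hen]; exact one_ne_zero
  have hpi : 0 < (2 * Real.pi) ^ (2 * s) := by positivity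
  refine ⟨gagliardoSymbol s e / ENNReal.ofReal ((2 * Real.pi) ^ (2 * s)), ?_, ?_, fun ξ => ?_⟩
  · exact ENNReal.div_ne_zero.2 ⟨gagliardoSymbol_ne_zero he0, ENNReal.ofReal_ne_top⟩
  · exact ENNReal.div_ne_top (gagliardoSymbol_lt_top hn hs0 hs1 e).ne (by simpa using hpi)
  · rcases eq_or_ne ξ 0 with rfl | hξ
    · simp [gagliardoSymbol, phase, fracSymbol, Real.zero_rpow (by positivity : 2 * s ≠ 0)]
    · have hr : 0 < ‖ξ‖ := norm_pos_iff.2 hξ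
      have hL : Submodule.reflection (ℝ ∙ (e - ‖ξ‖⁻¹ • ξ))ᗮ e = ‖ξ‖⁻¹ • ξ :=
        Submodule.reflection_sub (by
          rw [hen, norm_smul, norm_inv, norm_norm, inv_mul_cancel₀ hr.ne'])
      have := gagliardoSymbol_smul_isometry (s := s)
        (Submodule.reflection (ℝ ∙ (e - ‖ξ‖⁻¹ • ξ))ᗮ) hr e
      rw [hL, smul_inv_smul₀ hr.ne'] at this
      rw [this, fracSymbol, Real.mul_rpow (x := 2 * Real.pi) (by positivity)
        (norm_nonneg _), ENNReal.ofReal_mul hpi.le, ← mul_assoc,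
        ENNReal.div_mul_cancel (by simpa using hpi) ENNReal.ofReal_ne_top, mul_comm]

/-- The Gagliardo representation of the fractional kinetic energy, for `0 < s < 1`. -/
theorem exists_kinEnergy_eq (hn : 1 ≤ n) {s : ℝ} (hs0 : 0 < s) (hs1 : s < 1) :
    ∃ c : ℝ≥0∞, c ≠ 0 ∧ c ≠ ∞ ∧ ∀ u : L2 n, c * kinEnergy s u =
      ∫⁻ h : Rn n, ENNReal.ofReal (gagliardoKernel s h) * shiftEnergy h u := by
  obtain ⟨c, hc0, hct, hc⟩ := exists_gagliardoSymbol_eq hn hs0 hs1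
  refine ⟨c, hc0, hct, fun u => ?_⟩
  have hph : Measurable fun z : Rn n × Rn n => phase z.1 z.2 := by
    have : Continuous fun z : Rn n × Rn n => phase z.1 z.2 := by
      simp only [phase_eq]; fun_prop
    exact this.measurable
  have hu : AEMeasurable (fun ξ => ‖fourierL2 u ξ‖ₑ ^ 2) :=
    (Lp.aestronglyMeasurable (fourierL2 u)).enorm.pow_const 2
  calc c * kinEnergy s u
      = ∫⁻ ξ, ∫⁻ h, ENNReal.ofReal (gagliardoKernel s h) *
          (‖phase h ξ - 1‖ₑ ^ 2 * ‖fourierL2 u ξ‖ₑ ^ 2) := by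
        rw [kinEnergy, ← lintegral_const_mul' _ _ hct]
        refine lintegral_congr fun ξ => ?_
        rw [← mul_assoc, ← hc, gagliardoSymbol, ← lintegral_mul_const' _ _ (by simp)]
        refine lintegral_congr fun h => ?_
        rw [mul_assoc]
    _ = ∫⁻ h, ∫⁻ ξ, ENNReal.ofReal (gagliardoKernel s h) *
          (‖phase h ξ - 1‖ₑ ^ 2 * ‖fourierL2 u ξ‖ₑ ^ 2) := by
        refine lintegral_lintegral_swap ?_
        have hk : Measurable fun z : Rn n × Rn n => ENNReal.ofReal (gagliardoKernel s z.2) :=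
          (measurable_gagliardoKernel s).ennreal_ofReal.comp measurable_snd
        have hp : Measurable fun z : Rn n × Rn n => ‖phase z.2 z.1 - 1‖ₑ ^ 2 :=
          ((hph.comp measurable_swap).sub_const 1).enorm.pow_const 2
        have hu' : AEMeasurable (fun z : Rn n × Rn n => ‖fourierL2 u z.1‖ₑ ^ 2)
          (volume.prod volume) := hu.comp_fst
        exact hk.aemeasurable.mul (hp.aemeasurable.mul hu')
    _ = _ := by
        refine lintegral_congr fun h => ?_
        rw [lintegral_const_mul' _ _ ENNReal.ofReal_ne_top, shiftEnergy_eq_fourier]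

end SingularIntegral

/-! ### Absolute values, the energy space and bilinearity -/

section AbsoluteValue

theorem fracSymbol_le_one_add {s : ℝ} (hs0 : 0 < s) (hs1 : s ≤ 1) (ξ : Rn n) :
    fracSymbol s ξ ≤ 1 + fracSymbol 1 ξ := by
  unfold fracSymbol
  have h0 : 0 ≤ 2 * Real.pi * ‖ξ‖ := by positivity
  generalize 2 * Real.pi * ‖ξ‖ = a at *
  rcases le_total a 1 with h | h
  · have := Real.rpow_le_one h0 h (by positivity : 0 ≤ 2 * s)
    have := Real.rpow_nonneg h0 (2 * 1)
    linarith
  · have := Real.rpow_le_rpow_of_exponent_le h (by linarith : 2 * s ≤ 2 * 1)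
    linarith

theorem tendsto_fracSymbol (ξ : Rn n) {σ : ℕ → ℝ} (hσ : Tendsto σ atTop (𝓝 1)) :
    Tendsto (fun k => fracSymbol (σ k) ξ) atTop (𝓝 (fracSymbol 1 ξ)) := by
  unfold fracSymbol
  exact ((Real.continuousAt_const_rpow' (by norm_num)).tendsto).comp (hσ.const_mul 2)

theorem aemeasurable_fourierL2_sq (u : L2 n) : AEMeasurable fun ξ => ‖fourierL2 u ξ‖ₑ ^ 2 :=
  (Lp.aestronglyMeasurable (fourierL2 u)).enorm.pow_const 2

theorem kinEnergy_one_le_liminf (u : L2 n) {σ : ℕ → ℝ} (hσ0 : ∀ k, 0 < σ k)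
    (hσ : Tendsto σ atTop (𝓝 1)) :
    kinEnergy 1 u ≤ liminf (fun k => kinEnergy (σ k) u) atTop := by
  refine le_trans (le_of_eq ?_) (lintegral_liminf_le' fun k =>
    (continuous_fracSymbol (hσ0 k)).measurable.ennreal_ofReal.aemeasurable.mul
      (aemeasurable_fourierL2_sq u))
  refine lintegral_congr fun ξ => (Tendsto.liminf_eq ?_).symm
  exact ENNReal.Tendsto.mul_const (ENNReal.tendsto_ofReal (tendsto_fracSymbol ξ hσ))
    (Or.inr (by simp))

theorem tendsto_kinEnergy_one {u : L2 n} (hu : kinEnergy 1 u ≠ ∞) {σ : ℕ → ℝ}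
    (hσ0 : ∀ k, 0 < σ k) (hσ1 : ∀ k, σ k ≤ 1) (hσ : Tendsto σ atTop (𝓝 1)) :
    Tendsto (fun k => kinEnergy (σ k) u) atTop (𝓝 (kinEnergy 1 u)) := by
  refine tendsto_lintegral_of_dominated_convergence'
    (fun ξ => ‖fourierL2 u ξ‖ₑ ^ 2 + ENNReal.ofReal (fracSymbol 1 ξ) * ‖fourierL2 u ξ‖ₑ ^ 2)
    (fun k => (continuous_fracSymbol (hσ0 k)).measurable.ennreal_ofReal.aemeasurable.mul
      (aemeasurable_fourierL2_sq u)) (fun k => Eventually.of_forall fun ξ => ?_) ?_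
    (Eventually.of_forall fun ξ => ?_)
  · refine (mul_le_mul_left (ENNReal.ofReal_le_ofReal
      (fracSymbol_le_one_add (hσ0 k) (hσ1 k) ξ)) _).trans (le_of_eq ?_)
    rw [ENNReal.ofReal_add zero_le_one (fracSymbol_nonneg _ _), add_mul, ENNReal.ofReal_one,
      one_mul]
  · rw [lintegral_add_left' (aemeasurable_fourierL2_sq u), lintegral_enorm_sq_eq]
    exact ENNReal.add_ne_top.2 ⟨ENNReal.ofReal_ne_top, hu⟩
  · exact ENNReal.Tendsto.mul_const (ENNReal.tendsto_ofReal (tendsto_fracSymbol ξ hσ))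
      (Or.inr (by simp))

theorem ae_shift {P : Rn n → Prop} (hP : ∀ᵐ x, P x) (h : Rn n) : ∀ᵐ x : Rn n, P (x + h) :=
  (measurePreserving_add_right (volume : Measure (Rn n)) h).quasiMeasurePreserving.ae hP

theorem shiftEnergy_abs_le (h : Rn n) (u : L2 n) : shiftEnergy h |u| ≤ shiftEnergy h u := by
  refine lintegral_mono_ae ?_
  filter_upwards [Lp.coeFn_abs u, ae_shift (Lp.coeFn_abs u) h] with x h1 h2
  rw [h1, h2]
  gcongr
  rw [← ofReal_norm, ← ofReal_norm]
  exact ENNReal.ofReal_le_ofReal (abs_abs_sub_abs_le _ _)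

/-- Taking absolute values does not increase the kinetic energy. The endpoint `s = 1` is the limit
of the fractional case. -/
theorem kinEnergy_abs_le (hn : 1 ≤ n) {s : ℝ} (hs0 : 0 < s) (hs1 : s ≤ 1) (u : L2 n) :
    kinEnergy s |u| ≤ kinEnergy s u := by
  have key : ∀ σ : ℝ, 0 < σ → σ < 1 → kinEnergy σ |u| ≤ kinEnergy σ u := by
    intro σ h0 h1
    obtain ⟨c, hc0, hct, hc⟩ := exists_kinEnergy_eq hn h0 h1
    rw [← ENNReal.mul_le_mul_iff_right hc0 hct, hc, hc]
    exact lintegral_mono fun h => mul_le_mul' le_rfl (shiftEnergy_abs_le h u)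
  rcases hs1.lt_or_eq with h | rfl
  · exact key s hs0 h
  · by_cases hu : kinEnergy 1 u = ∞
    · rw [hu]; exact le_top
    have hσ : Tendsto (fun k : ℕ => 1 - 1 / ((k : ℝ) + 2)) atTop (𝓝 1) := by
      have h1 : Tendsto (fun k : ℕ => (k : ℝ) + 2) atTop atTop :=
        tendsto_atTop_add_const_right _ _ tendsto_natCast_atTop_atTop
      simpa using (tendsto_const_nhds (x := (1 : ℝ))).sub (h1.inv_tendsto_atTop)
    have hσ1 : ∀ k : ℕ, 1 - 1 / ((k : ℝ) + 2) < 1 := fun k => by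
      have : 0 < 1 / ((k : ℝ) + 2) := by positivity
      linarith
    have hσ0 : ∀ k : ℕ, 0 < 1 - 1 / ((k : ℝ) + 2) := fun k => by
      rw [sub_pos, div_lt_one (by positivity)]
      have : (0 : ℝ) ≤ k := k.cast_nonneg
      linarith
    rw [← (tendsto_kinEnergy_one hu hσ0 (fun k => (hσ1 k).le) hσ).liminf_eq]
    exact (kinEnergy_one_le_liminf |u| hσ0 hσ).trans
      (liminf_le_liminf (Eventually.of_forall fun k => key _ (hσ0 k) (hσ1 k)))

theorem potEnergy_abs (V : ℝ → ℝ) (u : L2 n) : potEnergy V |u| = potEnergy V u := by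
  refine lintegral_congr_ae ?_
  filter_upwards [Lp.coeFn_abs u] with x h1
  rw [h1]; simp

end AbsoluteValue

section EnergySpace

variable {α E : Type*} [MeasurableSpace α] {μ : Measure α} [NormedAddCommGroup E]

theorem integrable_weighted_iff {w : α → ℝ} (hw : Measurable w) (hw0 : ∀ x, 0 ≤ w x)
    (f : Lp E 2 μ) :
    Integrable (fun x => w x * ‖f x‖ ^ 2) μ ↔
      ∫⁻ x, ENNReal.ofReal (w x) * ‖f x‖ₑ ^ 2 ∂μ < ∞ := by
  have hm : AEStronglyMeasurable (fun x => w x * ‖f x‖ ^ 2) μ :=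
    hw.aestronglyMeasurable.mul ((Lp.aestronglyMeasurable f).norm.pow 2)
  rw [Integrable, and_iff_right hm, hasFiniteIntegral_iff_ofReal
    (Eventually.of_forall fun x => mul_nonneg (hw0 x) (by positivity))]
  simp_rw [ENNReal.ofReal_mul (hw0 _), ENNReal.ofReal_pow (norm_nonneg _), ofReal_norm]

theorem integral_weighted_eq {w : α → ℝ} (hw : Measurable w) (hw0 : ∀ x, 0 ≤ w x)
    (f : Lp E 2 μ) :
    ∫ x, w x * ‖f x‖ ^ 2 ∂μ = (∫⁻ x, ENNReal.ofReal (w x) * ‖f x‖ₑ ^ 2 ∂μ).toReal := by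
  have hm : AEStronglyMeasurable (fun x => w x * ‖f x‖ ^ 2) μ :=
    hw.aestronglyMeasurable.mul ((Lp.aestronglyMeasurable f).norm.pow 2)
  rw [integral_eq_lintegral_of_nonneg_ae
    (Eventually.of_forall fun x => mul_nonneg (hw0 x) (by positivity)) hm]
  simp_rw [ENNReal.ofReal_mul (hw0 _), ENNReal.ofReal_pow (norm_nonneg _), ofReal_norm]

theorem continuous_potential {V : ℝ → ℝ} (hV : IsTrapping V) :
    Continuous fun x : Rn n => V ‖x‖ :=
  hV.continuousOn.comp_continuous continuous_norm fun x => norm_nonneg x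

theorem memEnergySpace_iff {s : ℝ} (hs : 0 < s) {V : ℝ → ℝ} (hV : IsTrapping V) {u : L2 n} :
    MemEnergySpace s V u ↔ kinEnergy s u + potEnergy V u < ∞ := by
  have h2 := integrable_weighted_iff (μ := volume) (continuous_potential (n := n) hV).measurable
    (fun x => hV.nonneg _ (norm_nonneg x)) u
  simp only [Real.norm_eq_abs, sq_abs] at h2
  rw [MemEnergySpace, integrable_weighted_iff (continuous_fracSymbol hs).measurable
    (fracSymbol_nonneg s), h2, ENNReal.add_lt_top]
  rfl

theorem integrable_kinetic {s : ℝ} (hs : 0 < s) {V : ℝ → ℝ} {u v : L2 n}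
    (hu : MemEnergySpace s V u) (hv : MemEnergySpace s V v) :
    Integrable fun ξ : Rn n => fracSymbol s ξ * (inner ℂ (fourierL2 u ξ) (fourierL2 v ξ)).re := by
  refine (hu.1.add hv.1).mono' ((continuous_fracSymbol hs).aestronglyMeasurable.mul
    (Complex.continuous_re.comp_aestronglyMeasurable ((Lp.aestronglyMeasurable _).inner
      (Lp.aestronglyMeasurable _)))) (Eventually.of_forall fun ξ => ?_)
  rw [norm_mul, Real.norm_of_nonneg (fracSymbol_nonneg s ξ), Pi.add_apply, ← mul_add]
  refine mul_le_mul_of_nonneg_left ?_ (fracSymbol_nonneg s ξ)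
  have h1 := (Complex.abs_re_le_norm _).trans
    (norm_inner_le_norm (𝕜 := ℂ) (fourierL2 u ξ) (fourierL2 v ξ))
  rw [Real.norm_eq_abs]
  nlinarith [sq_nonneg (‖fourierL2 u ξ‖ - ‖fourierL2 v ξ‖), norm_nonneg (fourierL2 u ξ),
    norm_nonneg (fourierL2 v ξ)]

theorem integrable_potential {s : ℝ} {V : ℝ → ℝ} (hV : IsTrapping V) {u v : L2 n}
    (hu : MemEnergySpace s V u) (hv : MemEnergySpace s V v) :
    Integrable fun x : Rn n => V ‖x‖ * (u x * v x) := by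
  refine (hu.2.add hv.2).mono' ((continuous_potential hV).aestronglyMeasurable.mul
    ((Lp.aestronglyMeasurable _).mul (Lp.aestronglyMeasurable _)))
    (Eventually.of_forall fun x => ?_)
  have hV0 := hV.nonneg _ (norm_nonneg x)
  rw [norm_mul, Real.norm_of_nonneg hV0, Pi.add_apply, ← mul_add]
  refine mul_le_mul_of_nonneg_left ?_ hV0
  rw [Real.norm_eq_abs, abs_mul, ← sq_abs (u x), ← sq_abs (v x)]
  nlinarith [sq_nonneg (|u x| - |v x|), abs_nonneg (u x), abs_nonneg (v x)]

theorem memEnergySpace_add {s : ℝ} (hs : 0 < s) {V : ℝ → ℝ} (hV : IsTrapping V) {u v : L2 n}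
    (hu : MemEnergySpace s V u) (hv : MemEnergySpace s V v) : MemEnergySpace s V (u + v) := by
  constructor
  · refine ((hu.1.const_mul 2).add (hv.1.const_mul 2)).mono'
      ((continuous_fracSymbol hs).aestronglyMeasurable.mul
        ((Lp.aestronglyMeasurable _).norm.pow 2)) ?_
    filter_upwards [Lp.coeFn_add (fourierL2 u) (fourierL2 v)] with ξ h1
    rw [fourierL2_add, h1, Pi.add_apply, Pi.add_apply, norm_mul,
      Real.norm_of_nonneg (fracSymbol_nonneg s ξ), norm_pow, norm_norm]
    have h2 := norm_add_le (fourierL2 u ξ) (fourierL2 v ξ)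
    have h3 : ‖fourierL2 u ξ + fourierL2 v ξ‖ ^ 2 ≤
        2 * ‖fourierL2 u ξ‖ ^ 2 + 2 * ‖fourierL2 v ξ‖ ^ 2 := by
      nlinarith [sq_nonneg (‖fourierL2 u ξ‖ - ‖fourierL2 v ξ‖),
        norm_nonneg (fourierL2 u ξ + fourierL2 v ξ)]
    nlinarith [fracSymbol_nonneg s ξ]
  · refine ((hu.2.const_mul 2).add (hv.2.const_mul 2)).mono'
      ((continuous_potential hV).aestronglyMeasurable.mul
        ((Lp.aestronglyMeasurable _).pow 2)) ?_
    filter_upwards [Lp.coeFn_add u v] with x h1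
    have hV0 := hV.nonneg _ (norm_nonneg x)
    rw [h1, Pi.add_apply, Pi.add_apply, Real.norm_of_nonneg (by positivity)]
    nlinarith [mul_nonneg hV0 (sq_nonneg (u x - v x))]

theorem MemEnergySpace.smul {s : ℝ} {V : ℝ → ℝ} (c : ℝ) {u : L2 n}
    (hu : MemEnergySpace s V u) : MemEnergySpace s V (c • u) := by
  constructor
  · refine (hu.1.const_mul (c ^ 2)).congr ?_
    filter_upwards [Lp.coeFn_smul c (fourierL2 u)] with ξ h1
    rw [fourierL2_smul, h1, Pi.smul_apply, norm_smul, mul_pow, Real.norm_eq_abs, sq_abs]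
    ring
  · refine (hu.2.const_mul (c ^ 2)).congr ?_
    filter_upwards [Lp.coeFn_smul c u] with x h1
    rw [h1, Pi.smul_apply, smul_eq_mul]
    ring

/-- The energy space as a subspace of `L²`. -/
noncomputable def energySpace (n : ℕ) {s : ℝ} (hs : 0 < s) {V : ℝ → ℝ} (hV : IsTrapping V) :
    Submodule ℝ (L2 n) where
  carrier := {u | MemEnergySpace s V u}
  add_mem' := fun hu hv => memEnergySpace_add hs hV hu hv
  zero_mem' := by
    rw [Set.mem_ofPred_eq, memEnergySpace_iff hs hV]
    have h0 := norm_fourierL2 (0 : L2 n)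
    rw [norm_zero, norm_eq_zero] at h0
    have h1 : kinEnergy s (0 : L2 n) = 0 := by
      rw [kinEnergy, h0]
      refine lintegral_eq_zero_of_ae_eq_zero ?_
      filter_upwards [Lp.coeFn_zero ℂ 2 (volume : Measure (Rn n))] with ξ h
      rw [h]; simp
    have h2 : potEnergy V (0 : L2 n) = 0 := by
      refine lintegral_eq_zero_of_ae_eq_zero ?_
      filter_upwards [Lp.coeFn_zero ℝ 2 (volume : Measure (Rn n))] with ξ h
      rw [h]; simp
    rw [h1, h2]; simp
  smul_mem' := fun c _ hu => MemEnergySpace.smul c hu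

theorem kineticForm_self {s : ℝ} (hs : 0 < s) (u : L2 n) :
    kineticForm s u u = (kinEnergy s u).toReal := by
  rw [kinEnergy, ← integral_weighted_eq (continuous_fracSymbol hs).measurable (fracSymbol_nonneg s)]
  refine integral_congr_ae (Eventually.of_forall fun ξ => ?_)
  simp only
  rw [← RCLike.re_eq_complex_re, inner_self_eq_norm_sq]

theorem potentialForm_self {V : ℝ → ℝ} (hV : IsTrapping V) (u : L2 n) :
    potentialForm V u u = (potEnergy V u).toReal := by
  rw [potEnergy, ← integral_weighted_eq (continuous_potential hV).measurable
    (fun x => hV.nonneg _ (norm_nonneg x))]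
  refine integral_congr_ae (Eventually.of_forall fun ξ => ?_)
  simp only
  rw [Real.norm_eq_abs, sq_abs, sq]

theorem kineticForm_comm (s : ℝ) (u v : L2 n) : kineticForm s u v = kineticForm s v u := by
  refine integral_congr_ae (Eventually.of_forall fun ξ => ?_)
  simp only
  rw [← RCLike.re_eq_complex_re, inner_re_symm]

theorem potentialForm_comm (V : ℝ → ℝ) (u v : L2 n) :
    potentialForm V u v = potentialForm V v u := by
  refine integral_congr_ae (Eventually.of_forall fun x => ?_)
  simp only
  rw [mul_comm (u x)]

theorem kineticForm_add_left {s : ℝ} (hs : 0 < s) {V : ℝ → ℝ} {u v w : L2 n}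
    (hu : MemEnergySpace s V u) (hv : MemEnergySpace s V v) (hw : MemEnergySpace s V w) :
    kineticForm s (u + v) w = kineticForm s u w + kineticForm s v w := by
  rw [kineticForm, kineticForm, kineticForm,
    ← integral_add (integrable_kinetic hs hu hw) (integrable_kinetic hs hv hw)]
  refine integral_congr_ae ?_
  filter_upwards [Lp.coeFn_add (fourierL2 u) (fourierL2 v)] with ξ h1
  rw [fourierL2_add, h1, Pi.add_apply, inner_add_left, Complex.add_re, mul_add]

theorem kineticForm_smul_left (s : ℝ) (c : ℝ) (u w : L2 n) :
    kineticForm s (c • u) w = c * kineticForm s u w := by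
  rw [kineticForm, kineticForm, ← integral_const_mul]
  refine integral_congr_ae ?_
  filter_upwards [Lp.coeFn_smul c (fourierL2 u)] with ξ h1
  rw [fourierL2_smul, h1, Pi.smul_apply, Complex.real_smul, ← smul_eq_mul (α := ℂ),
    inner_smul_left]
  simp
  ring

theorem potentialForm_add_left {s : ℝ} {V : ℝ → ℝ} (hV : IsTrapping V) {u v w : L2 n}
    (hu : MemEnergySpace s V u) (hv : MemEnergySpace s V v) (hw : MemEnergySpace s V w) :
    potentialForm V (u + v) w = potentialForm V u w + potentialForm V v w := by
  rw [potentialForm, potentialForm, potentialForm,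
    ← integral_add (integrable_potential hV hu hw) (integrable_potential hV hv hw)]
  refine integral_congr_ae ?_
  filter_upwards [Lp.coeFn_add u v] with ξ h1
  rw [h1, Pi.add_apply]
  ring

theorem potentialForm_smul_left (V : ℝ → ℝ) (c : ℝ) (u w : L2 n) :
    potentialForm V (c • u) w = c * potentialForm V u w := by
  rw [potentialForm, potentialForm, ← integral_const_mul]
  refine integral_congr_ae ?_
  filter_upwards [Lp.coeFn_smul c u] with ξ h1
  rw [h1, Pi.smul_apply, smul_eq_mul]
  ring

theorem lowerSemicontinuous_energy {s : ℝ} (hs : 0 < s) {V : ℝ → ℝ} (hV : IsTrapping V) :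
    LowerSemicontinuous fun u : L2 n => kinEnergy s u + potEnergy V u :=
  ((lowerSemicontinuous_weighted (continuous_fracSymbol hs).measurable).comp
    continuous_fourierL2).add
    (lowerSemicontinuous_weighted (continuous_potential hV).measurable)

end EnergySpace

/-! ### A subcritical Sobolev inequality -/

section Sobolev

theorem lintegral_shift_le_one {u : L2 n} (hu : ‖u‖ ≤ 1) (x : Rn n) (B : Set (Rn n)) :
    ∫⁻ h in B, ‖u (x + h)‖ₑ ^ 2 ≤ 1 := by
  calc ∫⁻ h in B, ‖u (x + h)‖ₑ ^ 2 ≤ ∫⁻ h, ‖u (x + h)‖ₑ ^ 2 := setLIntegral_le_lintegral _ _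
    _ = ∫⁻ y, ‖u y‖ₑ ^ 2 := lintegral_add_left_eq_self (fun y => ‖u y‖ₑ ^ 2) x
    _ ≤ 1 := by
      rw [lintegral_enorm_sq_eq, ENNReal.ofReal_le_one]
      nlinarith [norm_nonneg u]

theorem measurable_lp (u : L2 n) : Measurable u := (Lp.stronglyMeasurable u).measurable

theorem measurable_shift_sub (u : L2 n) :
    Measurable fun z : Rn n × Rn n => ‖u (z.1 + z.2) - u z.1‖ₑ ^ 2 :=
  ((((measurable_lp u).comp (measurable_fst.add measurable_snd)).sub
    ((measurable_lp u).comp measurable_fst)).enorm).pow_const 2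

/-- Averaging over small balls approximates in `L²` with rate `r^{2s}` in terms of the kinetic
energy. -/
theorem lintegral_ball_shift_le {s : ℝ} (hs0 : 0 < s) (hs1 : s ≤ 1) (u : L2 n) (r : ℝ) :
    ∫⁻ x, ∫⁻ h in Metric.ball 0 r, ‖u (x + h) - u x‖ₑ ^ 2 ≤
      volume (Metric.ball (0 : Rn n) r) * (ENNReal.ofReal (4 * r ^ (2 * s)) * kinEnergy s u) := by
  rw [lintegral_lintegral_swap (measurable_shift_sub u).aemeasurable]
  calc ∫⁻ h in Metric.ball 0 r, ∫⁻ x, ‖u (x + h) - u x‖ₑ ^ 2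
      ≤ ∫⁻ h in Metric.ball (0 : Rn n) r, ENNReal.ofReal (4 * r ^ (2 * s)) * kinEnergy s u := by
        refine setLIntegral_mono measurable_const fun h hh => ?_
        refine (shiftEnergy_le hs0 hs1 h u).trans ?_
        gcongr
        exact (mem_ball_zero_iff.1 hh).le
    _ = _ := by rw [setLIntegral_const, mul_comm]

theorem enorm_sub_sq_le {E : Type*} [NormedAddCommGroup E] (a b : E) :
    ‖a - b‖ₑ ^ 2 ≤ 2 * ‖a‖ₑ ^ 2 + 2 * ‖b‖ₑ ^ 2 := by
  have h2 : (2 : ℝ≥0∞) = ENNReal.ofReal 2 := by simp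
  rw [← ofReal_norm, ← ofReal_norm, ← ofReal_norm, ← ENNReal.ofReal_pow (norm_nonneg _),
    ← ENNReal.ofReal_pow (norm_nonneg _), ← ENNReal.ofReal_pow (norm_nonneg _), h2,
    ← ENNReal.ofReal_mul zero_le_two, ← ENNReal.ofReal_mul zero_le_two,
    ← ENNReal.ofReal_add (by positivity) (by positivity)]
  refine ENNReal.ofReal_le_ofReal ?_
  nlinarith [norm_sub_le a b, sq_nonneg (‖a‖ - ‖b‖), norm_nonneg (a - b), norm_nonneg a,
    norm_nonneg b]

/-- The distribution function of a normalized `Hˢ` function, estimated by comparing the function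
with its averages over balls of radius `r`, which are at most `|B_r|^{-1/2}`. -/
theorem meas_lt_le_of_ball {s : ℝ} (hs0 : 0 < s) (hs1 : s ≤ 1) {u : L2 n} (hu : ‖u‖ ≤ 1)
    (hk : kinEnergy s u ≤ 1) {r t : ℝ} (hr : 0 < r) (ht : 0 < t)
    (hrt : 4 ≤ ENNReal.ofReal (t ^ 2) * volume (Metric.ball (0 : Rn n) r)) :
    ENNReal.ofReal (t ^ 2) * volume {x | t < |u x|} ≤ ENNReal.ofReal (16 * r ^ (2 * s)) := by
  set B : Set (Rn n) := Metric.ball 0 r with hB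
  set A : Rn n → ℝ≥0∞ := fun x => ∫⁻ h in B, ‖u (x + h) - u x‖ₑ ^ 2 with hA
  have hAm : Measurable A := (measurable_shift_sub u).lintegral_prod_right'
  have hB0 : volume B ≠ 0 := (Metric.measure_ball_pos volume 0 hr).ne'
  have hBt : volume B ≠ ∞ := measure_ball_lt_top.ne
  have hsub : {x | t < |u x|} ⊆ {x | ENNReal.ofReal (t ^ 2) * volume B ≤ 4 * A x} := by
    intro x hx
    have h1 : volume B * ‖u x‖ₑ ^ 2 ≤ 2 * A x + 2 := by
      calc volume B * ‖u x‖ₑ ^ 2 = ∫⁻ _ in B, ‖u x‖ₑ ^ 2 := by rw [setLIntegral_const, mul_comm]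
        _ ≤ ∫⁻ h in B, (2 * ‖u (x + h) - u x‖ₑ ^ 2 + 2 * ‖u (x + h)‖ₑ ^ 2) :=
          lintegral_mono fun h => by
            have h0 := enorm_sub_sq_le (u (x + h)) (u (x + h) - u x)
            rwa [sub_sub_cancel, add_comm] at h0
        _ = 2 * A x + 2 * ∫⁻ h in B, ‖u (x + h)‖ₑ ^ 2 := by
          rw [lintegral_add_left, lintegral_const_mul', lintegral_const_mul'] <;> try simp
          exact ((measurable_shift_sub u).comp measurable_prodMk_left).const_mul 2
        _ ≤ 2 * A x + 2 * 1 := by gcongr; exact lintegral_shift_le_one hu x B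
        _ = _ := by rw [mul_one]
    have h2 : ENNReal.ofReal (t ^ 2) ≤ ‖u x‖ₑ ^ 2 := by
      rw [← ofReal_norm, ← ENNReal.ofReal_pow (norm_nonneg _)]
      exact ENNReal.ofReal_le_ofReal (pow_le_pow_left₀ ht.le (le_of_lt hx) 2)
    have h3 : ENNReal.ofReal (t ^ 2) * volume B ≤ 2 * A x + 2 := by
      rw [mul_comm]; exact (mul_le_mul' le_rfl h2).trans h1
    have h4 : 2 * (ENNReal.ofReal (t ^ 2) * volume B) ≤
        4 * A x + ENNReal.ofReal (t ^ 2) * volume B := by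
      calc 2 * (ENNReal.ofReal (t ^ 2) * volume B) ≤ 2 * (2 * A x + 2) := by gcongr
        _ = 4 * A x + 4 := by ring
        _ ≤ _ := by gcongr
    rw [two_mul] at h4
    exact (ENNReal.add_le_add_iff_right
      (ENNReal.mul_ne_top ENNReal.ofReal_ne_top hBt)).1 h4
  have h1 : ENNReal.ofReal (t ^ 2) * volume B * volume {x | t < |u x|} ≤
      volume B * ENNReal.ofReal (16 * r ^ (2 * s)) := by
    calc _ ≤ ENNReal.ofReal (t ^ 2) * volume B *
          volume {x | ENNReal.ofReal (t ^ 2) * volume B ≤ 4 * A x} := by gcongr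
      _ ≤ ∫⁻ x, 4 * A x := mul_meas_ge_le_lintegral (hAm.const_mul 4) _
      _ = 4 * ∫⁻ x, A x := lintegral_const_mul' _ _ (by simp)
      _ ≤ 4 * (volume B * (ENNReal.ofReal (4 * r ^ (2 * s)) * 1)) := by
        gcongr
        exact (lintegral_ball_shift_le hs0 hs1 u r).trans (by gcongr)
      _ = _ := by
        rw [show (16 : ℝ) * r ^ (2 * s) = 4 * (4 * r ^ (2 * s)) by ring,
          ENNReal.ofReal_mul (p := 4) (by norm_num)]
        simp; ring
  rw [mul_comm (ENNReal.ofReal (t ^ 2)), mul_assoc] at h1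
  exact (ENNReal.mul_le_mul_iff_right hB0 hBt).1 h1

/-- A weak-type Sobolev inequality at the endpoint `2 + 4s/n` of the range of exponents needed. -/
theorem exists_meas_lt_le (hn : 1 ≤ n) {s : ℝ} (hs0 : 0 < s) (hs1 : s ≤ 1) :
    ∃ C : ℝ, 0 ≤ C ∧ ∀ u : L2 n, ‖u‖ ≤ 1 → kinEnergy s u ≤ 1 → ∀ t : ℝ, 0 < t →
      volume {x | t < |u x|} ≤ ENNReal.ofReal (C * t ^ (-2 - 4 * s / n)) := by
  have : NeZero n := ⟨by omega⟩
  have hn0 : (0 : ℝ) < n := by exact_mod_cast hn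
  set v : ℝ := volume.real (Metric.ball (0 : Rn n) 1) with hv
  have hv0 : 0 < v := ENNReal.toReal_pos (Metric.measure_ball_pos volume 0 one_pos).ne'
    measure_ball_lt_top.ne
  refine ⟨16 * (4 / v) ^ (2 * s / n), by positivity, fun u hu hk t ht => ?_⟩
  -- the radius for which `t² |B_r| = 4`
  set r : ℝ := (4 / v * t ^ (-2 : ℝ)) ^ (1 / n : ℝ) with hr
  have ha : 0 < 4 / v * t ^ (-2 : ℝ) := by positivity
  have hr0 : 0 < r := Real.rpow_pos_of_pos ha _
  have hball : volume (Metric.ball (0 : Rn n) r) = ENNReal.ofReal (r ^ n * v) := by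
    rw [Measure.addHaar_ball _ _ hr0.le, finrank_euclideanSpace_fin,
      ENNReal.ofReal_mul (by positivity), hv, ofReal_measureReal]
  have hrn : r ^ n = 4 / v * t ^ (-2 : ℝ) := by
    rw [hr, ← Real.rpow_natCast, ← Real.rpow_mul ha.le, one_div, inv_mul_cancel₀ hn0.ne',
      Real.rpow_one]
  have h1 := meas_lt_le_of_ball hs0 hs1 hu hk hr0 ht (by
    rw [hball, ← ENNReal.ofReal_mul (by positivity), hrn, Real.rpow_neg ht.le, Real.rpow_two]
    rw [show t ^ 2 * (4 / v * (t ^ 2)⁻¹ * v) = 4 by field_simp]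
    simp)
  have h2 : r ^ (2 * s) = (4 / v) ^ (2 * s / n) * t ^ (-(4 * s / n)) := by
    rw [hr, ← Real.rpow_mul ha.le, Real.mul_rpow (by positivity) (by positivity),
      ← Real.rpow_mul ht.le]
    congr 2 <;> ring
  rw [h2] at h1
  have ht2 : ENNReal.ofReal (t ^ 2) ≠ 0 := by
    rw [ENNReal.ofReal_ne_zero_iff]; positivity
  rw [← ENNReal.mul_le_mul_iff_right ht2 ENNReal.ofReal_ne_top]
  refine h1.trans (le_of_eq ?_)
  rw [← ENNReal.ofReal_mul (by positivity), sub_eq_add_neg, Real.rpow_add ht,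
    Real.rpow_neg ht.le 2, Real.rpow_two]
  congr 1
  field_simp

theorem meas_lt_le_inv_sq {u : L2 n} (hu : ‖u‖ ≤ 1) {t : ℝ} (ht : 0 < t) :
    volume {x | t < |u x|} ≤ ENNReal.ofReal (t ^ (-2 : ℝ)) := by
  have ht2 : ENNReal.ofReal (t ^ 2) ≠ 0 := by
    rw [ENNReal.ofReal_ne_zero_iff]; positivity
  rw [← ENNReal.mul_le_mul_iff_right ht2 ENNReal.ofReal_ne_top,
    ← ENNReal.ofReal_mul (by positivity), Real.rpow_neg ht.le, Real.rpow_two,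
    mul_inv_cancel₀ (by positivity), ENNReal.ofReal_one]
  calc _ ≤ ENNReal.ofReal (t ^ 2) * volume {x | ENNReal.ofReal (t ^ 2) ≤ ‖u x‖ₑ ^ 2} := by
        gcongr with x
        intro hx
        rw [← ofReal_norm, ← ENNReal.ofReal_pow (norm_nonneg _)]
        exact ENNReal.ofReal_le_ofReal (pow_le_pow_left₀ ht.le (le_of_lt hx) 2)
    _ ≤ ∫⁻ x, ‖u x‖ₑ ^ 2 :=
        mul_meas_ge_le_lintegral ((measurable_lp u).enorm.pow_const 2) _
    _ ≤ 1 := by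
      rw [lintegral_enorm_sq_eq, ENNReal.ofReal_le_one]
      nlinarith [norm_nonneg u]

/-- The Sobolev embedding `Hˢ ⊂ L^q` for `2 < q < 2 + 4s/n`, in normalized form. -/
theorem exists_sobolev_bound (hn : 1 ≤ n) {s : ℝ} (hs0 : 0 < s) (hs1 : s ≤ 1) {q : ℝ}
    (hq2 : 2 < q) (hq : q < 2 + 4 * s / n) :
    ∃ C : ℝ, ∀ u : L2 n, ‖u‖ ≤ 1 → kinEnergy s u ≤ 1 →
      ∫⁻ x, ENNReal.ofReal (|u x| ^ q) ≤ ENNReal.ofReal C := by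
  obtain ⟨C, hC0, hC⟩ := exists_meas_lt_le hn hs0 hs1
  have hI0 : IntegrableOn (fun t : ℝ => t ^ (q - 3)) (Set.Ioc 0 1) :=
    (intervalIntegrable_iff_integrableOn_Ioc_of_le zero_le_one).1
      (intervalIntegral.intervalIntegrable_rpow' (by linarith))
  have hI1 : IntegrableOn (fun t : ℝ => C * t ^ (q - 3 - 4 * s / n)) (Set.Ioi 1) :=
    (integrableOn_Ioi_rpow_of_lt (by linarith) one_pos).const_mul _
  set D : ℝ≥0∞ := ENNReal.ofReal q * ((∫⁻ t in Set.Ioc 0 1, ENNReal.ofReal (t ^ (q - 3))) +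
    ∫⁻ t in Set.Ioi 1, ENNReal.ofReal (C * t ^ (q - 3 - 4 * s / n))) with hD
  have hDt : D ≠ ∞ := ENNReal.mul_ne_top ENNReal.ofReal_ne_top
    (ENNReal.add_ne_top.2 ⟨hI0.lintegral_lt_top.ne, hI1.lintegral_lt_top.ne⟩)
  refine ⟨D.toReal, fun u hu hk => ?_⟩
  rw [ENNReal.ofReal_toReal hDt, lintegral_rpow_eq_lintegral_meas_lt_mul volume
    (Eventually.of_forall fun x => abs_nonneg (u x)) (measurable_lp u).abs.aemeasurable
    (by linarith)]
  refine mul_le_mul' le_rfl ?_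
  rw [← Set.Ioc_union_Ioi_eq_Ioi zero_le_one, lintegral_union measurableSet_Ioi
    (Set.Ioc_disjoint_Ioi le_rfl)]
  refine add_le_add (setLIntegral_mono' measurableSet_Ioc fun t ht => ?_)
    (setLIntegral_mono' measurableSet_Ioi fun t ht => ?_)
  · refine (mul_le_mul_left (meas_lt_le_inv_sq hu ht.1) _).trans (le_of_eq ?_)
    rw [← ENNReal.ofReal_mul (Real.rpow_nonneg ht.1.le _), ← Real.rpow_add ht.1]
    congr 2; ring
  · have ht0 : 0 < t := lt_trans one_pos ht
    refine (mul_le_mul_left (hC u hu hk t ht0) _).trans (le_of_eq ?_)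
    rw [← ENNReal.ofReal_mul (by positivity), mul_assoc, ← Real.rpow_add ht0]
    congr 3; ring

theorem kinEnergy_smul (s c : ℝ) (u : L2 n) :
    kinEnergy s (c • u) = ENNReal.ofReal (c ^ 2) * kinEnergy s u := by
  rw [kinEnergy, kinEnergy, ← lintegral_const_mul' _ _ ENNReal.ofReal_ne_top]
  refine lintegral_congr_ae ?_
  filter_upwards [Lp.coeFn_smul c (fourierL2 u)] with ξ h1
  rw [fourierL2_smul, h1, Pi.smul_apply, enorm_smul, mul_pow, ← ofReal_norm c,
    ← ENNReal.ofReal_pow (norm_nonneg _), Real.norm_eq_abs, sq_abs]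
  ring

theorem integrable_rpow_of_kinEnergy (hn : 1 ≤ n) {s : ℝ} (hs0 : 0 < s) (hs1 : s ≤ 1) {q : ℝ}
    (hq2 : 2 < q) (hq : q < 2 + 4 * s / n) {u : L2 n} (hu : kinEnergy s u ≠ ∞) :
    Integrable fun x => |u x| ^ q := by
  obtain ⟨C, hC⟩ := exists_sobolev_bound hn hs0 hs1 hq2 hq
  set R : ℝ := 1 + ‖u‖ + (kinEnergy s u).toReal with hR
  have hk0 : 0 ≤ (kinEnergy s u).toReal := ENNReal.toReal_nonneg
  have hR1 : 1 ≤ R := by have := norm_nonneg u; linarith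
  have hR0 : 0 < R := by linarith
  have h1 : ‖R⁻¹ • u‖ ≤ 1 := by
    rw [norm_smul, norm_inv, Real.norm_of_nonneg hR0.le, inv_mul_le_one₀ hR0]
    linarith
  have h2 : kinEnergy s (R⁻¹ • u) ≤ 1 := by
    rw [kinEnergy_smul, ← ENNReal.ofReal_toReal hu, ← ENNReal.ofReal_mul (by positivity),
      ENNReal.ofReal_le_one, inv_pow, inv_mul_le_one₀ (by positivity)]
    nlinarith [norm_nonneg u]
  have h3 := hC _ h1 h2
  have h4 : Integrable fun x => |(R⁻¹ • u) x| ^ q := by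
    refine ⟨((measurable_lp _).abs.pow_const q).aestronglyMeasurable, ?_⟩
    rw [hasFiniteIntegral_iff_ofReal (Eventually.of_forall fun x => by positivity)]
    exact h3.trans_lt ENNReal.ofReal_lt_top
  refine (h4.const_mul (R ^ q)).congr ?_
  filter_upwards [Lp.coeFn_smul R⁻¹ u] with x hx
  rw [hx, Pi.smul_apply, smul_eq_mul, abs_mul, abs_of_pos (inv_pos.2 hR0),
    ← Real.mul_rpow hR0.le (by positivity), mul_inv_cancel_left₀ hR0.ne']

end Sobolev

section NonlinearForm

/-- `∫ |φ|^{p-1} u v`. -/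
noncomputable def nonlinForm (p : ℝ) (φ u v : L2 n) : ℝ :=
  ∫ x : Rn n, |φ x| ^ (p - 1) * (u x * v x)

/-- A weighted Young inequality: one of the two terms dominates, according to which of `a` and `κ b`
is larger. -/
theorem rpow_mul_sq_le {p κ a b : ℝ} (hp : 1 < p) (hκ : 0 < κ) (ha : 0 ≤ a) (hb : 0 ≤ b) :
    a ^ (p - 1) * b ^ 2 ≤ (κ ^ 2)⁻¹ * a ^ (p + 1) + κ ^ (p - 1) * b ^ (p + 1) := by
  have key : ∀ c : ℝ, 0 ≤ c → c ^ (p + 1) = c ^ (p - 1) * c ^ 2 := by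
    intro c hc
    rw [← Real.rpow_two, ← Real.rpow_add_of_nonneg hc (by linarith) (by norm_num)]
    congr 1; ring
  rw [key a ha, key b hb]
  have ha' := Real.rpow_nonneg ha (p - 1)
  have hb' := Real.rpow_nonneg hb (p - 1)
  have hκ' := Real.rpow_nonneg hκ.le (p - 1)
  rcases le_total a (κ * b) with h | h
  · have h1 : a ^ (p - 1) ≤ κ ^ (p - 1) * b ^ (p - 1) := by
      rw [← Real.mul_rpow hκ.le hb]
      exact Real.rpow_le_rpow ha h (by linarith)
    have : 0 ≤ (κ ^ 2)⁻¹ * (a ^ (p - 1) * a ^ 2) := by positivity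
    nlinarith [sq_nonneg b]
  · have h1 : b ^ 2 ≤ (κ ^ 2)⁻¹ * a ^ 2 := by
      rw [inv_mul_eq_div, le_div_iff₀ (by positivity)]
      nlinarith [mul_nonneg hκ.le hb]
    have : 0 ≤ κ ^ (p - 1) * (b ^ (p - 1) * b ^ 2) := by positivity
    nlinarith [sq_nonneg b]

theorem rpow_mul_mul_le {p a b c : ℝ} (hp : 1 < p) (ha : 0 ≤ a) :
    |a ^ (p - 1) * (b * c)| ≤ a ^ (p + 1) + |b| ^ (p + 1) + |c| ^ (p + 1) := by
  have h1 := rpow_mul_sq_le hp one_pos ha (abs_nonneg b)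
  have h2 := rpow_mul_sq_le hp one_pos ha (abs_nonneg c)
  simp only [one_pow, inv_one, one_mul, Real.one_rpow] at h1 h2
  have ha' := Real.rpow_nonneg ha (p - 1)
  rw [abs_mul, abs_of_nonneg ha', abs_mul]
  have h3 : |b| * |c| ≤ (|b| ^ 2 + |c| ^ 2) / 2 := by nlinarith [sq_nonneg (|b| - |c|)]
  have := Real.rpow_nonneg (abs_nonneg b) (p + 1)
  have := Real.rpow_nonneg (abs_nonneg c) (p + 1)
  nlinarith [mul_le_mul_of_nonneg_left h3 ha']

theorem integrable_nonlin {p : ℝ} (hp : 1 < p) {φ u v : L2 n}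
    (hφ : Integrable fun x => |φ x| ^ (p + 1)) (hu : Integrable fun x => |u x| ^ (p + 1))
    (hv : Integrable fun x => |v x| ^ (p + 1)) :
    Integrable fun x => |φ x| ^ (p - 1) * (u x * v x) := by
  refine ((hφ.add hu).add hv).mono' (((measurable_lp φ).abs.pow_const _).mul
    ((measurable_lp u).mul (measurable_lp v))).aestronglyMeasurable
    (Eventually.of_forall fun x => ?_)
  exact rpow_mul_mul_le hp (abs_nonneg _)

theorem exists_tail_lt {f : Rn n → ℝ} (hf : Measurable f) {q : ℝ}
    (hfi : Integrable fun x => |f x| ^ q) {ε : ℝ} (hε : 0 < ε) :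
    ∃ L : ℝ, 0 ≤ L ∧ ∫ x, {x | L < |f x|}.indicator (fun x => |f x| ^ q) x < ε := by
  have hlim : Tendsto (fun k : ℕ => ∫ x, {x | (k : ℝ) < |f x|}.indicator (fun x => |f x| ^ q) x)
      atTop (𝓝 (∫ _ : Rn n, (0 : ℝ))) := by
    refine tendsto_integral_of_dominated_convergence (fun x => |f x| ^ q) (fun k => ?_) hfi
      (fun k => Eventually.of_forall fun x => ?_) (Eventually.of_forall fun x => ?_)
    · exact (hf.abs.pow_const q).aestronglyMeasurable.indicator
        (measurableSet_lt measurable_const hf.abs)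
    · refine (norm_indicator_le_norm_self _ _).trans ?_
      rw [Real.norm_of_nonneg (by positivity)]
    · refine tendsto_const_nhds.congr' ?_
      filter_upwards [eventually_ge_atTop ⌈|f x|⌉₊] with k hk
      rw [Set.indicator_of_notMem]
      simpa using (Nat.le_ceil _).trans (by exact_mod_cast hk)
  rw [integral_zero] at hlim
  obtain ⟨k, hk⟩ := (hlim.eventually (gt_mem_nhds hε)).exists
  exact ⟨k, k.cast_nonneg, hk⟩

/-- The form of `|φ|^{p-1}` is infinitesimally bounded with respect to the kinetic energy. -/
theorem nonlinForm_self_le (hn : 1 ≤ n) {s : ℝ} (hs0 : 0 < s) (hs1 : s ≤ 1) {p : ℝ}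
    (hp1 : 1 < p) (hp2 : p < 1 + 4 * s / n) {φ : L2 n}
    (hφ : Integrable fun x => |φ x| ^ (p + 1)) {ε : ℝ} (hε : 0 < ε) :
    ∃ C : ℝ, 0 ≤ C ∧ ∀ u : L2 n, kinEnergy s u ≠ ∞ →
      nonlinForm p φ u u ≤ ε * (kinEnergy s u).toReal + C * ‖u‖ ^ 2 := by
  obtain ⟨C₀, hC₀⟩ := exists_sobolev_bound hn hs0 hs1 (q := p + 1) (by linarith) (by linarith)
  set C₁ : ℝ := |C₀| + 1 with hC₁
  have hC₁0 : 0 < C₁ := by positivity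
  set κ : ℝ := (ε / (2 * C₁)) ^ (1 / (p - 1)) with hκ
  have hκ0 : 0 < κ := by positivity
  have hκp : κ ^ (p - 1) = ε / (2 * C₁) := by
    rw [hκ, ← Real.rpow_mul (by positivity), one_div, inv_mul_cancel₀ (by linarith), Real.rpow_one]
  obtain ⟨L, hL0, hL⟩ := exists_tail_lt (measurable_lp φ) hφ
    (by positivity : 0 < κ ^ 2 * (ε / 2))
  have hL' : 0 ≤ L ^ (p - 1) := Real.rpow_nonneg hL0 _
  -- the bound for normalized functions; the general case follows by homogeneity
  have norm_case : ∀ u : L2 n, ‖u‖ ≤ 1 → kinEnergy s u ≤ 1 →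
      nonlinForm p φ u u ≤ L ^ (p - 1) * ‖u‖ ^ 2 + ε := by
    intro u hu hk
    have hui := integrable_rpow_of_kinEnergy hn hs0 hs1 (q := p + 1) (by linarith) (by linarith)
      (hk.trans_lt ENNReal.one_lt_top).ne
    have hu2 : Integrable fun x => u x ^ 2 := (Lp.memLp u).integrable_sq
    have huq : ∫ x, |u x| ^ (p + 1) ≤ C₁ := by
      rw [integral_eq_lintegral_of_nonneg_ae (Eventually.of_forall fun x => by positivity)
        hui.aestronglyMeasurable]
      refine ENNReal.toReal_le_of_le_ofReal hC₁0.le ((hC₀ u hu hk).trans ?_)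
      exact ENNReal.ofReal_le_ofReal (by have := le_abs_self C₀; linarith)
    have hu2n : ∫ x, u x ^ 2 = ‖u‖ ^ 2 := by
      rw [← real_inner_self_eq_norm_sq, L2.inner_def]
      refine integral_congr_ae (Eventually.of_forall fun x => ?_)
      simp [sq]
    have hmI : Integrable fun x => {x | L < |φ x|}.indicator (fun x => |φ x| ^ (p + 1)) x :=
      hφ.indicator (measurableSet_lt measurable_const (measurable_lp φ).abs)
    have hI := ((hu2.const_mul (L ^ (p - 1))).add (hmI.const_mul (κ ^ 2)⁻¹)).add
      (hui.const_mul (κ ^ (p - 1)))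
    have hle := integral_mono (integrable_nonlin hp1 hφ hui hui) hI fun x => by
      simp only [Pi.add_apply]
      rw [← sq, ← sq_abs (u x)]
      have hb := Real.rpow_nonneg (abs_nonneg (u x)) (p + 1)
      by_cases hx : L < |φ x|
      · rw [Set.indicator_of_mem (show x ∈ {x | L < |φ x|} from hx)]
        have := rpow_mul_sq_le hp1 hκ0 (abs_nonneg (φ x)) (abs_nonneg (u x))
        have := mul_nonneg hL' (sq_nonneg |u x|)
        linarith
      · rw [Set.indicator_of_notMem (show x ∉ {x | L < |φ x|} from hx)]
        have h1 : |φ x| ^ (p - 1) ≤ L ^ (p - 1) :=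
          Real.rpow_le_rpow (abs_nonneg _) (not_lt.1 hx) (by linarith)
        have h2 := mul_le_mul_of_nonneg_right h1 (sq_nonneg |u x|)
        have h3 : 0 ≤ κ ^ (p - 1) * |u x| ^ (p + 1) := by positivity
        linarith
    have e : ∫ x, ((fun x => L ^ (p - 1) * u x ^ 2) + (fun x => (κ ^ 2)⁻¹ *
        {x | L < |φ x|}.indicator (fun x => |φ x| ^ (p + 1)) x) +
        fun x => κ ^ (p - 1) * |u x| ^ (p + 1)) x = L ^ (p - 1) * ‖u‖ ^ 2 + (κ ^ 2)⁻¹ *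
        (∫ x, {x | L < |φ x|}.indicator (fun x => |φ x| ^ (p + 1)) x) +
        κ ^ (p - 1) * ∫ x, |u x| ^ (p + 1) := by
      rw [integral_add' ((hu2.const_mul (L ^ (p - 1))).add (hmI.const_mul (κ ^ 2)⁻¹))
        (hui.const_mul (κ ^ (p - 1))), integral_add' (hu2.const_mul (L ^ (p - 1)))
        (hmI.const_mul (κ ^ 2)⁻¹), integral_const_mul, integral_const_mul, integral_const_mul,
        hu2n]
    rw [e] at hle
    refine hle.trans ?_
    have h1 : (κ ^ 2)⁻¹ * (∫ x, {x | L < |φ x|}.indicator (fun x => |φ x| ^ (p + 1)) x) ≤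
        ε / 2 := by
      rw [inv_mul_le_iff₀ (by positivity)]; exact hL.le
    have h2 : κ ^ (p - 1) * (∫ x, |u x| ^ (p + 1)) ≤ ε / 2 := by
      rw [hκp]
      calc ε / (2 * C₁) * (∫ x, |u x| ^ (p + 1)) ≤ ε / (2 * C₁) * C₁ := by gcongr
        _ = ε / 2 := by field_simp
    linarith
  refine ⟨L ^ (p - 1) + ε, by positivity, fun u hu => ?_⟩
  set K := (kinEnergy s u).toReal with hK
  have hK0 : 0 ≤ K := ENNReal.toReal_nonneg
  rcases eq_or_ne u 0 with rfl | hu0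
  · have : nonlinForm p φ (0 : L2 n) 0 = 0 := by
      refine integral_eq_zero_of_ae ?_
      filter_upwards [Lp.coeFn_zero ℝ 2 (volume : Measure (Rn n))] with x hx
      rw [hx]; simp
    rw [this]
    positivity
  have hun : 0 < ‖u‖ := norm_pos_iff.2 hu0
  set R : ℝ := √(K + ‖u‖ ^ 2) with hR
  have hR2 : R ^ 2 = K + ‖u‖ ^ 2 := Real.sq_sqrt (by positivity)
  have hR0 : 0 < R := Real.sqrt_pos.2 (by positivity)
  have h1 : ‖R⁻¹ • u‖ ≤ 1 := by
    rw [norm_smul, norm_inv, Real.norm_of_nonneg hR0.le, inv_mul_le_one₀ hR0]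
    exact Real.le_sqrt_of_sq_le (by linarith)
  have h2 : kinEnergy s (R⁻¹ • u) ≤ 1 := by
    rw [kinEnergy_smul, ← ENNReal.ofReal_toReal hu, ← ENNReal.ofReal_mul (by positivity),
      ENNReal.ofReal_le_one, inv_pow, inv_mul_le_one₀ (by positivity), hR2]
    nlinarith
  have h3 := norm_case _ h1 h2
  have h4 : nonlinForm p φ (R⁻¹ • u) (R⁻¹ • u) = (R ^ 2)⁻¹ * nonlinForm p φ u u := by
    rw [nonlinForm, nonlinForm, ← integral_const_mul]
    refine integral_congr_ae ?_
    filter_upwards [Lp.coeFn_smul R⁻¹ u] with x hx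
    rw [hx, Pi.smul_apply, smul_eq_mul]
    ring
  rw [h4, norm_smul, norm_inv, Real.norm_of_nonneg hR0.le, inv_mul_le_iff₀ (by positivity)] at h3
  calc nonlinForm p φ u u ≤ R ^ 2 * (L ^ (p - 1) * (R⁻¹ * ‖u‖) ^ 2 + ε) := h3
    _ = L ^ (p - 1) * ‖u‖ ^ 2 + ε * R ^ 2 := by field_simp
    _ = _ := by rw [hR2]; ring

end NonlinearForm

/-! ### Compactness of the energy space in `L²` -/

section Compactness

/-- The integral of `u` over the ball of radius `r` around `x`. -/
noncomputable def ballIntegral (r : ℝ) (u : L2 n) (x : Rn n) : ℝ :=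
  ∫ h in Metric.ball (0 : Rn n) r, u (x + h)

theorem ballIntegral_eq_inner (r : ℝ) (u : L2 n) (x : Rn n) :
    ballIntegral r u x = ⟪indicatorConstLp 2 (measurableSet_ball (x := x) (ε := r))
      measure_ball_lt_top.ne (1 : ℝ), u⟫_ℝ := by
  rw [L2.inner_indicatorConstLp_one, ballIntegral,
    ← (measurePreserving_add_left volume x).setIntegral_preimage_emb
      (measurableEmbedding_addLeft x) u (Metric.ball x r)]
  simp

theorem measurable_ballIntegral (r : ℝ) (u : L2 n) : Measurable (ballIntegral r u) := by
  have h : StronglyMeasurable fun z : Rn n × Rn n => u (z.1 + z.2) :=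
    ((measurable_lp u).comp (measurable_fst.add measurable_snd)).stronglyMeasurable
  exact h.integral_prod_right'.measurable

theorem ballIntegral_sub (r : ℝ) (u v : L2 n) (x : Rn n) :
    ballIntegral r (u - v) x = ballIntegral r u x - ballIntegral r v x := by
  simp only [ballIntegral_eq_inner, inner_sub_right]

theorem abs_ballIntegral_le (r : ℝ) {u : L2 n} (hu : ‖u‖ ≤ 1) (x : Rn n) :
    |ballIntegral r u x| ≤ volume.real (Metric.ball (0 : Rn n) r) ^ (1 / (2 : ℝ)) := by
  rw [ballIntegral_eq_inner]
  refine (abs_real_inner_le_norm _ _).trans ?_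
  rw [norm_indicatorConstLp (by simp) (by simp), norm_one, one_mul]
  have : volume.real (Metric.ball x r) = volume.real (Metric.ball (0 : Rn n) r) := by
    rw [measureReal_def, Measure.addHaar_ball_center, measureReal_def]
  rw [this]
  simp only [ENNReal.toReal_ofNat]
  have h0 : 0 ≤ volume.real (Metric.ball (0 : Rn n) r) ^ (1 / (2 : ℝ)) := by positivity
  nlinarith

/-- Jensen's inequality on a ball: `u(x)` is close to its ball average unless its increments are
large. -/
theorem sq_le_ball_average {r : ℝ} (hr : 0 < r) (u : L2 n) (x : Rn n) :
    volume (Metric.ball (0 : Rn n) r) * ‖u x‖ₑ ^ 2 ≤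
      2 * (∫⁻ h in Metric.ball 0 r, ‖u (x + h) - u x‖ₑ ^ 2) +
      ENNReal.ofReal (2 * (volume.real (Metric.ball (0 : Rn n) r))⁻¹ *
        (ballIntegral r u x) ^ 2) := by
  set B : Set (Rn n) := Metric.ball 0 r with hB
  set β : ℝ := volume.real B with hβ
  have hβ0 : 0 < β := ENNReal.toReal_pos (Metric.measure_ball_pos volume 0 hr).ne'
    measure_ball_lt_top.ne
  have : IsFiniteMeasure (volume.restrict B) :=
    ⟨by rw [Measure.restrict_apply_univ]; exact measure_ball_lt_top⟩
  have hm : MemLp (fun h => u (x + h)) 2 (volume.restrict B) :=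
    ((Lp.memLp u).comp_measurePreserving (measurePreserving_add_left volume x)).restrict B
  have hm2 : MemLp (fun h => u (x + h) - u x) 2 (volume.restrict B) := hm.sub (memLp_const _)
  have hi2 : Integrable (fun h => (u (x + h) - u x) ^ 2) (volume.restrict B) := hm2.integrable_sq
  have hi1 : Integrable (fun h => u (x + h) - u x) (volume.restrict B) :=
    hm2.integrable one_le_two
  set m := ballIntegral r u x with hmdef
  have e1 : ∫ h in B, (u (x + h) - u x) = m - β * u x := by
    rw [integral_sub (hm.integrable one_le_two) (integrable_const _), integral_const,
      measureReal_restrict_apply_univ, smul_eq_mul]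
    rfl
  -- the square of `u (x + h) - u x` lies above its tangent line at `m / β - u x`
  have h1 : β * (m / β - u x) ^ 2 ≤ ∫ h in B, (u (x + h) - u x) ^ 2 := by
    have hle : ∫ h in B, (2 * (m / β - u x) * (u (x + h) - u x) - (m / β - u x) ^ 2) ≤
        ∫ h in B, (u (x + h) - u x) ^ 2 :=
      integral_mono ((hi1.const_mul _).sub (integrable_const _)) hi2 fun h => by
        simp only
        nlinarith [sq_nonneg ((u (x + h) - u x) - (m / β - u x))]
    rw [integral_sub (hi1.const_mul _) (integrable_const _), integral_const_mul, e1,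
      integral_const, measureReal_restrict_apply_univ, smul_eq_mul] at hle
    refine le_of_eq_of_le ?_ hle
    rw [← hβ]
    field_simp
    ring
  have h2 : β * u x ^ 2 ≤ 2 * (∫ h in B, (u (x + h) - u x) ^ 2) + 2 * β⁻¹ * m ^ 2 := by
    have h3 : u x ^ 2 ≤ 2 * (m / β - u x) ^ 2 + 2 * (m / β) ^ 2 := by
      nlinarith [sq_nonneg (2 * (m / β) - u x)]
    calc β * u x ^ 2 ≤ β * (2 * (m / β - u x) ^ 2 + 2 * (m / β) ^ 2) := by gcongr
      _ = 2 * (β * (m / β - u x) ^ 2) + 2 * β⁻¹ * m ^ 2 := by field_simp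
      _ ≤ _ := by gcongr
  have e2 : ∫⁻ h in B, ‖u (x + h) - u x‖ₑ ^ 2 =
      ENNReal.ofReal (∫ h in B, (u (x + h) - u x) ^ 2) := by
    rw [ofReal_integral_eq_lintegral_ofReal hi2 (Eventually.of_forall fun h => sq_nonneg _)]
    refine lintegral_congr fun h => ?_
    rw [← ofReal_norm, ← ENNReal.ofReal_pow (norm_nonneg _), Real.norm_eq_abs, sq_abs]
  have e3 : volume B = ENNReal.ofReal β := by rw [hβ, ofReal_measureReal]
  have hI0 : 0 ≤ ∫ h in B, (u (x + h) - u x) ^ 2 := integral_nonneg fun h => sq_nonneg _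
  have h20 : 2 * ENNReal.ofReal (∫ h in B, (u (x + h) - u x) ^ 2) =
      ENNReal.ofReal (2 * ∫ h in B, (u (x + h) - u x) ^ 2) := by
    rw [ENNReal.ofReal_mul zero_le_two]; simp
  rw [e2, e3, ← ofReal_norm, ← ENNReal.ofReal_pow (norm_nonneg _), Real.norm_eq_abs, sq_abs,
    ← ENNReal.ofReal_mul hβ0.le, h20, ← ENNReal.ofReal_add (by positivity) (by positivity)]
  exact ENNReal.ofReal_le_ofReal h2

theorem weighted_sub_le {E : Type*} [NormedAddCommGroup E] {w : Rn n → ℝ} (hw : Measurable w)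
    (f g : Lp E 2 (volume : Measure (Rn n))) :
    ∫⁻ x, ENNReal.ofReal (w x) * ‖(f - g) x‖ₑ ^ 2 ≤
      2 * (∫⁻ x, ENNReal.ofReal (w x) * ‖f x‖ₑ ^ 2) +
      2 * ∫⁻ x, ENNReal.ofReal (w x) * ‖g x‖ₑ ^ 2 := by
  have hm : AEMeasurable (fun x => 2 * (ENNReal.ofReal (w x) * ‖f x‖ₑ ^ 2)) :=
    (hw.ennreal_ofReal.aemeasurable.mul
      ((Lp.aestronglyMeasurable f).enorm.pow_const 2)).const_mul 2
  rw [← lintegral_const_mul' _ _ (by simp), ← lintegral_const_mul' _ _ (by simp),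
    ← lintegral_add_left' hm]
  refine lintegral_mono_ae ?_
  filter_upwards [Lp.coeFn_sub f g] with x hx
  rw [hx, Pi.sub_apply]
  calc _ ≤ ENNReal.ofReal (w x) * (2 * ‖f x‖ₑ ^ 2 + 2 * ‖g x‖ₑ ^ 2) := by
        gcongr; exact enorm_sub_sq_le _ _
    _ = _ := by ring

theorem energy_sub_le {s : ℝ} (hs : 0 < s) {V : ℝ → ℝ} (hV : IsTrapping V) (u v : L2 n) :
    kinEnergy s (u - v) + potEnergy V (u - v) ≤
      2 * (kinEnergy s u + potEnergy V u) + 2 * (kinEnergy s v + potEnergy V v) := by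
  have h1 := weighted_sub_le (continuous_fracSymbol hs).measurable (fourierL2 u) (fourierL2 v)
  have h2 := weighted_sub_le (continuous_potential (n := n) hV).measurable u v
  rw [← fourierL2_sub] at h1
  refine (add_le_add h1 h2).trans (le_of_eq ?_)
  rw [kinEnergy, kinEnergy, potEnergy, potEnergy]
  ring

/-- A weakly convergent sequence has a strongly convergent ball average on bounded sets. -/
theorem tendsto_ballIntegral_diff {w : ℕ → L2 n} (hw1 : ∀ k, ‖w k‖ ≤ 1) (r R : ℝ)
    (hw : ∀ x, ∃ a, Tendsto (fun k => ballIntegral r (w k) x) atTop (𝓝 a)) :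
    Tendsto (fun z : ℕ × ℕ => ∫⁻ x in Metric.ball (0 : Rn n) R,
      ENNReal.ofReal (ballIntegral r (w z.1 - w z.2) x ^ 2)) atTop (𝓝 0) := by
  set b := volume.real (Metric.ball (0 : Rn n) r) ^ (1 / (2 : ℝ)) with hb
  have h0 : ∫⁻ _ in Metric.ball (0 : Rn n) R, (0 : ℝ≥0∞) = 0 := by simp
  rw [← h0]
  refine tendsto_lintegral_filter_of_dominated_convergence
    (fun _ => ENNReal.ofReal ((b + b) ^ 2))
    (Eventually.of_forall fun z =>
      ((measurable_ballIntegral r (w z.1 - w z.2)).pow_const 2).ennreal_ofReal)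
    (Eventually.of_forall fun z => Eventually.of_forall fun x => ?_) ?_
    (Eventually.of_forall fun x => ?_)
  · refine ENNReal.ofReal_le_ofReal ?_
    rw [ballIntegral_sub, ← sq_abs]
    refine pow_le_pow_left₀ (abs_nonneg _) ((abs_sub _ _).trans ?_) 2
    exact add_le_add (abs_ballIntegral_le r (hw1 _) x) (abs_ballIntegral_le r (hw1 _) x)
  · rw [setLIntegral_const]
    exact ENNReal.mul_ne_top ENNReal.ofReal_ne_top measure_ball_lt_top.ne
  · obtain ⟨a, ha⟩ := hw x
    have h1 : Tendsto (fun z : ℕ × ℕ => ballIntegral r (w z.1) x) atTop (𝓝 a) := by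
      rw [← prod_atTop_atTop_eq]; exact ha.comp tendsto_fst
    have h2 : Tendsto (fun z : ℕ × ℕ => ballIntegral r (w z.2) x) atTop (𝓝 a) := by
      rw [← prod_atTop_atTop_eq]; exact ha.comp tendsto_snd
    have h3 := ENNReal.tendsto_ofReal ((h1.sub h2).pow 2)
    simpa [ballIntegral_sub] using h3

theorem lintegral_compl_ball_le {V : ℝ → ℝ} {M R : ℝ} (hM : 0 < M)
    (hR : ∀ ρ, R ≤ ρ → M ≤ V ρ) (u : L2 n) :
    ∫⁻ x in (Metric.ball (0 : Rn n) R)ᶜ, ‖u x‖ₑ ^ 2 ≤ ENNReal.ofReal M⁻¹ * potEnergy V u := by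
  rw [potEnergy, ← lintegral_const_mul' _ _ ENNReal.ofReal_ne_top]
  refine (setLIntegral_mono' measurableSet_ball.compl fun x hx => ?_).trans
    (setLIntegral_le_lintegral _ _)
  have h1 : M ≤ V ‖x‖ := hR _ (by simpa using hx)
  rw [← mul_assoc, ← ENNReal.ofReal_mul (by positivity)]
  refine le_mul_of_one_le_left' ?_
  rw [ENNReal.one_le_ofReal, inv_mul_eq_div, one_le_div hM]
  exact h1

/-- The `L²` norm is controlled by the kinetic energy on small scales, by the ball averages inside a
large ball, and by the potential energy outside of it. -/
theorem norm_sq_le_of_energy {s : ℝ} (hs0 : 0 < s) (hs1 : s ≤ 1) {V : ℝ → ℝ}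
    {M R r : ℝ} (hM : 0 < M) (hr : 0 < r) (hR : ∀ ρ, R ≤ ρ → M ≤ V ρ) (u : L2 n) :
    ENNReal.ofReal (‖u‖ ^ 2) ≤ ENNReal.ofReal (8 * r ^ (2 * s)) * kinEnergy s u +
      ENNReal.ofReal (2 * (volume.real (Metric.ball (0 : Rn n) r))⁻¹ ^ 2) *
        (∫⁻ x in Metric.ball (0 : Rn n) R, ENNReal.ofReal (ballIntegral r u x ^ 2)) +
      ENNReal.ofReal M⁻¹ * potEnergy V u := by
  set B : Set (Rn n) := Metric.ball 0 r with hB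
  set β : ℝ := volume.real B with hβ
  have hβ0 : 0 < β := ENNReal.toReal_pos (Metric.measure_ball_pos volume 0 hr).ne'
    measure_ball_lt_top.ne
  have e3 : volume B = ENNReal.ofReal β := by rw [hβ, ofReal_measureReal]
  rw [← lintegral_enorm_sq_eq, ← lintegral_add_compl _ (measurableSet_ball (x := (0 : Rn n))
    (ε := R))]
  refine add_le_add ?_ (lintegral_compl_ball_le hM hR u)
  have hβe : ENNReal.ofReal β ≠ 0 := by rw [ENNReal.ofReal_ne_zero_iff]; exact hβ0
  rw [← ENNReal.mul_le_mul_iff_right hβe ENNReal.ofReal_ne_top,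
    ← lintegral_const_mul' _ _ ENNReal.ofReal_ne_top]
  calc ∫⁻ x in Metric.ball (0 : Rn n) R, ENNReal.ofReal β * ‖u x‖ₑ ^ 2
      ≤ ∫⁻ x in Metric.ball (0 : Rn n) R, (2 * (∫⁻ h in B, ‖u (x + h) - u x‖ₑ ^ 2) +
        ENNReal.ofReal (2 * β⁻¹) * ENNReal.ofReal (ballIntegral r u x ^ 2)) := by
        refine lintegral_mono fun x => ?_
        rw [← e3, ← ENNReal.ofReal_mul (by positivity)]
        exact sq_le_ball_average hr u x
    _ = 2 * (∫⁻ x in Metric.ball (0 : Rn n) R, ∫⁻ h in B, ‖u (x + h) - u x‖ₑ ^ 2) +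
        ENNReal.ofReal (2 * β⁻¹) *
          ∫⁻ x in Metric.ball (0 : Rn n) R, ENNReal.ofReal (ballIntegral r u x ^ 2) := by
        rw [lintegral_add_left ((measurable_shift_sub u).lintegral_prod_right'.const_mul 2),
          lintegral_const_mul' _ _ (by simp), lintegral_const_mul' _ _ ENNReal.ofReal_ne_top]
    _ ≤ 2 * (volume B * (ENNReal.ofReal (4 * r ^ (2 * s)) * kinEnergy s u)) +
        ENNReal.ofReal (2 * β⁻¹) *
          ∫⁻ x in Metric.ball (0 : Rn n) R, ENNReal.ofReal (ballIntegral r u x ^ 2) := by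
        gcongr
        exact (setLIntegral_le_lintegral _ _).trans (lintegral_ball_shift_le hs0 hs1 u r)
    _ = _ := by
        rw [mul_add, e3, show (8 : ℝ) * r ^ (2 * s) = 2 * (4 * r ^ (2 * s)) by ring,
          ENNReal.ofReal_mul (p := 2) (by norm_num), ← mul_assoc (ENNReal.ofReal β)
          (ENNReal.ofReal (2 * β⁻¹ ^ 2)), ← ENNReal.ofReal_mul hβ0.le]
        congr 1
        · simp; ring
        · rw [show β * (2 * β⁻¹ ^ 2) = 2 * β⁻¹ by field_simp,
            ENNReal.ofReal_mul (p := 2) zero_le_two]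

/-- The energy space of a trapping potential embeds compactly into `L²`. -/
theorem isCompact_energy_le {s : ℝ} (hs0 : 0 < s) (hs1 : s ≤ 1) {V : ℝ → ℝ}
    (hV : IsTrapping V) (b : ℝ) :
    IsCompact {u : L2 n | ‖u‖ ≤ 1 ∧ kinEnergy s u + potEnergy V u ≤ ENNReal.ofReal b} := by
  refine IsSeqCompact.isCompact fun u hu => ?_
  have : Fact ((2 : ℝ≥0∞) ≠ ∞) := ⟨by simp⟩
  obtain ⟨a, -, ψ, hψ, ha⟩ := WeakDual.isSeqCompact_closedBall ℝ (L2 n) 0 1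
    (x := fun k => StrongDual.toWeakDual (InnerProductSpace.toDual ℝ (L2 n) (u k)))
    (fun k => by
      have h := (hu k).1
      simpa using h)
  have hweak : ∀ v : L2 n, Tendsto (fun k => ⟪v, u (ψ k)⟫_ℝ) atTop (𝓝 (a v)) := by
    intro v
    have h1 := ((WeakDual.eval_continuous v).tendsto a).comp ha
    refine h1.congr fun k => ?_
    simp only [Function.comp]
    rw [real_inner_comm]
    rfl
  set w : ℕ → L2 n := fun k => u (ψ k) with hw
  have hw1 : ∀ k, ‖w k‖ ≤ 1 := fun k => (hu (ψ k)).1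
  have hE : ∀ z : ℕ × ℕ, kinEnergy s (w z.1 - w z.2) + potEnergy V (w z.1 - w z.2) ≤
      ENNReal.ofReal (4 * b) := by
    intro z
    refine (energy_sub_le hs0 hV _ _).trans ((add_le_add (mul_le_mul' le_rfl (hu (ψ z.1)).2)
      (mul_le_mul' le_rfl (hu (ψ z.2)).2)).trans (le_of_eq ?_))
    rw [ENNReal.ofReal_mul (by norm_num), ← add_mul]
    norm_num
  have hcauchy : CauchySeq w := by
    rw [cauchySeq_iff_tendsto_dist_atTop_0, Metric.tendsto_nhds]
    intro ε hε
    set b' : ℝ := |b| + 1 with hb'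
    have hb0 : 0 < b' := by positivity
    have hE' : ∀ z : ℕ × ℕ, kinEnergy s (w z.1 - w z.2) + potEnergy V (w z.1 - w z.2) ≤
        ENNReal.ofReal (4 * b') := fun z => (hE z).trans
      (ENNReal.ofReal_le_ofReal (by have := le_abs_self b; linarith))
    set δ : ℝ := ε ^ 2 / 4 with hδ
    have hδ0 : 0 < δ := by positivity
    set r : ℝ := (δ / (32 * b')) ^ (1 / (2 * s)) with hr
    have hr0 : 0 < r := by positivity
    have hrs : r ^ (2 * s) = δ / (32 * b') := by
      rw [hr, ← Real.rpow_mul (by positivity), one_div, inv_mul_cancel₀ (by positivity),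
        Real.rpow_one]
    set M : ℝ := 4 * b' / δ with hM
    have hM0 : 0 < M := by positivity
    obtain ⟨R, hR⟩ := (hV.tendsto.eventually (eventually_ge_atTop M)).exists_forall_of_atTop
    have hlim := tendsto_ballIntegral_diff hw1 r R fun x =>
      ⟨_, by simpa only [ballIntegral_eq_inner] using hweak _⟩
    set c : ℝ≥0∞ := ENNReal.ofReal (2 * (volume.real (Metric.ball (0 : Rn n) r))⁻¹ ^ 2) with hc
    have hlim' := ENNReal.Tendsto.const_mul (a := c) hlim (Or.inr ENNReal.ofReal_ne_top)
    rw [mul_zero] at hlim'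
    have hev := hlim'.eventually (gt_mem_nhds (ENNReal.ofReal_pos.2 hδ0))
    filter_upwards [hev] with z hz
    have h1 := norm_sq_le_of_energy hs0 hs1 hM0 hr0 hR (w z.1 - w z.2)
    have hk := (le_self_add).trans (hE' z)
    have hp := (le_add_self).trans (hE' z)
    have h2 : ENNReal.ofReal (‖w z.1 - w z.2‖ ^ 2) ≤ ENNReal.ofReal (3 * δ) := by
      calc _ ≤ _ := h1
        _ ≤ ENNReal.ofReal (8 * r ^ (2 * s)) * ENNReal.ofReal (4 * b') + ENNReal.ofReal δ +
            ENNReal.ofReal M⁻¹ * ENNReal.ofReal (4 * b') := by gcongr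
        _ = ENNReal.ofReal (3 * δ) := by
          rw [← ENNReal.ofReal_mul (by positivity), ← ENNReal.ofReal_mul (by positivity),
            ← ENNReal.ofReal_add (by positivity) (by positivity),
            ← ENNReal.ofReal_add (by positivity) (by positivity), hrs, hM]
          congr 1
          field_simp
          ring
    rw [ENNReal.ofReal_le_ofReal_iff (by positivity)] at h2
    rw [Real.dist_eq, sub_zero, abs_of_nonneg dist_nonneg, dist_eq_norm]
    refine lt_of_pow_lt_pow_left₀ 2 hε.le (h2.trans_lt ?_)
    rw [hδ]
    nlinarith [sq_pos_of_pos hε]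
  obtain ⟨v, hv⟩ := cauchySeq_tendsto_of_complete hcauchy
  have hcl : IsClosed {u : L2 n | ‖u‖ ≤ 1 ∧ kinEnergy s u + potEnergy V u ≤ ENNReal.ofReal b} :=
    (isClosed_le continuous_norm continuous_const).inter
      ((lowerSemicontinuous_iff_isClosed_preimage.1 (lowerSemicontinuous_energy hs0 hV)) _)
  exact ⟨v, hcl.mem_of_tendsto hv (Eventually.of_forall fun k => hu (ψ k)), ψ, hψ, hv⟩

end Compactness

/-! ### Schrödinger forms: lower bounds and minimizers -/

section Forms

/-- The standing assumptions on the dimension, the exponents and the potential. -/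
structure Admissible (n : ℕ) (s p : ℝ) (V : ℝ → ℝ) : Prop where
  one_le_dim : 1 ≤ n
  s_pos : 0 < s
  s_le_one : s ≤ 1
  one_lt_p : 1 < p
  p_lt : p < 1 + 4 * s / n
  trapping : IsTrapping V

/-- The form of `(-Δ)ˢ + V + ω - c |φ|^{p-1}` on the energy space, with a free constant `ω`. -/
noncomputable def schrodForm (s p : ℝ) (V : ℝ → ℝ) (φ : L2 n) (c ω : ℝ) (u v : L2 n) : ℝ :=
  kineticForm s u v + potentialForm V u v + ω * ⟪u, v⟫_ℝ - c * nonlinForm p φ u v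

theorem linForm_eq (s p : ℝ) (V : ℝ → ℝ) (φ : L2 n) (c : ℝ) (u v : L2 n) :
    linForm s p V φ c u v = schrodForm s p V φ c (multiplier s p V φ) u v := rfl

variable {s p : ℝ} {V : ℝ → ℝ}

theorem MemEnergySpace.kinEnergy_ne_top (H : Admissible n s p V) {u : L2 n}
    (hu : MemEnergySpace s V u) : kinEnergy s u ≠ ∞ :=
  ((ENNReal.add_lt_top.1 ((memEnergySpace_iff H.s_pos H.trapping).1 hu)).1).ne

theorem MemEnergySpace.integrable_rpow (H : Admissible n s p V) {u : L2 n}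
    (hu : MemEnergySpace s V u) : Integrable fun x => |u x| ^ (p + 1) := by
  have h1 := H.one_lt_p
  have h2 := H.p_lt
  exact integrable_rpow_of_kinEnergy H.one_le_dim H.s_pos H.s_le_one (by linarith) (by linarith)
    (hu.kinEnergy_ne_top H)

theorem MemEnergySpace.sub (H : Admissible n s p V) {u v : L2 n}
    (hu : MemEnergySpace s V u) (hv : MemEnergySpace s V v) : MemEnergySpace s V (u - v) :=
  (energySpace n H.s_pos H.trapping).sub_mem hu hv

theorem MemEnergySpace.add (H : Admissible n s p V) {u v : L2 n}
    (hu : MemEnergySpace s V u) (hv : MemEnergySpace s V v) : MemEnergySpace s V (u + v) :=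
  memEnergySpace_add H.s_pos H.trapping hu hv

theorem energy_abs_le (H : Admissible n s p V) (u : L2 n) :
    kinEnergy s |u| + potEnergy V |u| ≤ kinEnergy s u + potEnergy V u := by
  rw [potEnergy_abs]
  gcongr
  exact kinEnergy_abs_le H.one_le_dim H.s_pos H.s_le_one u

theorem MemEnergySpace.abs (H : Admissible n s p V) {u : L2 n}
    (hu : MemEnergySpace s V u) : MemEnergySpace s V |u| := by
  rw [memEnergySpace_iff H.s_pos H.trapping] at hu ⊢
  exact (energy_abs_le H u).trans_lt hu

theorem kineticForm_add_potentialForm_self (H : Admissible n s p V) {u : L2 n}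
    (hu : MemEnergySpace s V u) :
    kineticForm s u u + potentialForm V u u = (kinEnergy s u + potEnergy V u).toReal := by
  have := ENNReal.add_lt_top.1 ((memEnergySpace_iff H.s_pos H.trapping).1 hu)
  rw [ENNReal.toReal_add this.1.ne this.2.ne, kineticForm_self H.s_pos,
    potentialForm_self H.trapping]

theorem nonlinForm_comm (p : ℝ) (φ u v : L2 n) : nonlinForm p φ u v = nonlinForm p φ v u := by
  refine integral_congr_ae (Eventually.of_forall fun x => ?_)
  simp only
  rw [mul_comm (u x)]

theorem nonlinForm_smul_left (p : ℝ) (φ : L2 n) (a : ℝ) (u w : L2 n) :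
    nonlinForm p φ (a • u) w = a * nonlinForm p φ u w := by
  rw [nonlinForm, nonlinForm, ← integral_const_mul]
  refine integral_congr_ae ?_
  filter_upwards [Lp.coeFn_smul a u] with ξ h1
  rw [h1, Pi.smul_apply, smul_eq_mul]
  ring

theorem MemEnergySpace.integrable_nonlin (H : Admissible n s p V) {φ u v : L2 n}
    (hφ : MemEnergySpace s V φ) (hu : MemEnergySpace s V u) (hv : MemEnergySpace s V v) :
    Integrable fun x => |φ x| ^ (p - 1) * (u x * v x) :=
  TrappedNLS.integrable_nonlin H.one_lt_p (hφ.integrable_rpow H) (hu.integrable_rpow H)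
    (hv.integrable_rpow H)

theorem nonlinForm_add_left (H : Admissible n s p V) {φ u v w : L2 n}
    (hφ : MemEnergySpace s V φ) (hu : MemEnergySpace s V u) (hv : MemEnergySpace s V v)
    (hw : MemEnergySpace s V w) :
    nonlinForm p φ (u + v) w = nonlinForm p φ u w + nonlinForm p φ v w := by
  rw [nonlinForm, nonlinForm, nonlinForm,
    ← integral_add (hφ.integrable_nonlin H hu hw) (hφ.integrable_nonlin H hv hw)]
  refine integral_congr_ae ?_
  filter_upwards [Lp.coeFn_add u v] with ξ h1
  rw [h1, Pi.add_apply]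
  ring

theorem nonlinForm_self_nonneg (p : ℝ) (φ u : L2 n) : 0 ≤ nonlinForm p φ u u :=
  integral_nonneg fun x => mul_nonneg (by positivity) (mul_self_nonneg _)

theorem nonlinForm_abs (p : ℝ) (φ u : L2 n) : nonlinForm p φ |u| |u| = nonlinForm p φ u u := by
  refine integral_congr_ae ?_
  filter_upwards [Lp.coeFn_abs u] with x h1
  rw [h1, abs_mul_abs_self]

theorem schrodForm_comm (φ : L2 n) (c ω : ℝ) (u v : L2 n) :
    schrodForm s p V φ c ω u v = schrodForm s p V φ c ω v u := by
  rw [schrodForm, schrodForm, kineticForm_comm, potentialForm_comm, nonlinForm_comm,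
    real_inner_comm]

theorem schrodForm_smul_left (φ : L2 n) (c ω a : ℝ) (u v : L2 n) :
    schrodForm s p V φ c ω (a • u) v = a * schrodForm s p V φ c ω u v := by
  rw [schrodForm, schrodForm, kineticForm_smul_left, potentialForm_smul_left,
    nonlinForm_smul_left, real_inner_smul_left]
  ring

theorem schrodForm_zero_left (φ : L2 n) (c ω : ℝ) (v : L2 n) :
    schrodForm s p V φ c ω 0 v = 0 := by
  have := schrodForm_smul_left (s := s) (p := p) (V := V) φ c ω 0 (0 : L2 n) v
  rwa [zero_smul, zero_mul] at this

theorem schrodForm_smul_right (φ : L2 n) (c ω a : ℝ) (u v : L2 n) :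
    schrodForm s p V φ c ω u (a • v) = a * schrodForm s p V φ c ω u v := by
  rw [schrodForm_comm, schrodForm_smul_left, schrodForm_comm]

theorem schrodForm_add_left (H : Admissible n s p V) {φ u v w : L2 n} (c ω : ℝ)
    (hφ : MemEnergySpace s V φ) (hu : MemEnergySpace s V u) (hv : MemEnergySpace s V v)
    (hw : MemEnergySpace s V w) :
    schrodForm s p V φ c ω (u + v) w =
      schrodForm s p V φ c ω u w + schrodForm s p V φ c ω v w := by
  rw [schrodForm, schrodForm, schrodForm, kineticForm_add_left H.s_pos hu hv hw,
    potentialForm_add_left H.trapping hu hv hw, nonlinForm_add_left H hφ hu hv hw,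
    inner_add_left]
  ring

theorem schrodForm_add_right (H : Admissible n s p V) {φ u v w : L2 n} (c ω : ℝ)
    (hφ : MemEnergySpace s V φ) (hu : MemEnergySpace s V u) (hv : MemEnergySpace s V v)
    (hw : MemEnergySpace s V w) :
    schrodForm s p V φ c ω w (u + v) =
      schrodForm s p V φ c ω w u + schrodForm s p V φ c ω w v := by
  rw [schrodForm_comm, schrodForm_add_left H c ω hφ hu hv hw, schrodForm_comm φ c ω u,
    schrodForm_comm φ c ω v]

/-- Expansion of the quadratic form along a line. -/
theorem schrodForm_add_smul_self (H : Admissible n s p V) {φ u v : L2 n} (c ω a b : ℝ)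
    (hφ : MemEnergySpace s V φ) (hu : MemEnergySpace s V u) (hv : MemEnergySpace s V v) :
    schrodForm s p V φ c ω (a • u + b • v) (a • u + b • v) =
      a ^ 2 * schrodForm s p V φ c ω u u + 2 * a * b * schrodForm s p V φ c ω u v +
        b ^ 2 * schrodForm s p V φ c ω v v := by
  have h1 := hu.smul a
  have h2 := hv.smul b
  rw [schrodForm_add_left H c ω hφ h1 h2 (h1.add H h2),
    schrodForm_add_right H c ω hφ h1 h2 h1, schrodForm_add_right H c ω hφ h1 h2 h2]
  simp only [schrodForm_smul_left, schrodForm_smul_right]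
  rw [schrodForm_comm φ c ω v u]
  ring

theorem schrodForm_abs_le (H : Admissible n s p V) {φ u : L2 n} (c ω : ℝ)
    (hu : MemEnergySpace s V u) :
    schrodForm s p V φ c ω |u| |u| ≤ schrodForm s p V φ c ω u u := by
  rw [schrodForm, schrodForm, kineticForm_add_potentialForm_self H hu,
    kineticForm_add_potentialForm_self H (hu.abs H), nonlinForm_abs,
    real_inner_self_eq_norm_sq, real_inner_self_eq_norm_sq, norm_abs_eq_norm]
  have := ENNReal.toReal_mono ((memEnergySpace_iff H.s_pos H.trapping).1 hu).ne
    (energy_abs_le H u)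
  linarith

/-- Gårding's inequality: the form controls the energy norm modulo the `L²` norm. -/
theorem exists_energy_le_schrodForm (H : Admissible n s p V) {φ : L2 n} {c : ℝ} (hc : 0 ≤ c)
    (ω : ℝ) (hφ : MemEnergySpace s V φ) :
    ∃ C : ℝ, ∀ u : L2 n, MemEnergySpace s V u →
      (kinEnergy s u + potEnergy V u).toReal ≤
        2 * schrodForm s p V φ c ω u u + C * ‖u‖ ^ 2 := by
  obtain ⟨C, hC0, hC⟩ := nonlinForm_self_le H.one_le_dim H.s_pos H.s_le_one H.one_lt_p H.p_lt
    (hφ.integrable_rpow H) (ε := 1 / (2 * (c + 1))) (by positivity)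
  refine ⟨2 * (c * C - ω), fun u hu => ?_⟩
  have h1 := hC u (hu.kinEnergy_ne_top H)
  have h2 := ENNReal.add_lt_top.1 ((memEnergySpace_iff H.s_pos H.trapping).1 hu)
  rw [schrodForm, kineticForm_add_potentialForm_self H hu, real_inner_self_eq_norm_sq]
  have h3 := mul_le_mul_of_nonneg_left h1 hc
  have h4 : c * (1 / (2 * (c + 1)) * (kinEnergy s u).toReal) ≤ (kinEnergy s u).toReal / 2 := by
    have hK : 0 ≤ (kinEnergy s u).toReal := ENNReal.toReal_nonneg
    rw [← mul_assoc]
    have : c * (1 / (2 * (c + 1))) ≤ 1 / 2 := by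
      rw [mul_one_div, div_le_div_iff₀ (by positivity) (by norm_num)]; linarith
    nlinarith
  rw [ENNReal.toReal_add h2.1.ne h2.2.ne]
  have hP : 0 ≤ (potEnergy V u).toReal := ENNReal.toReal_nonneg
  nlinarith

theorem nonlinForm_add_le (H : Admissible n s p V) {φ u d : L2 n}
    (hφ : MemEnergySpace s V φ) (hu : MemEnergySpace s V u) (hd : MemEnergySpace s V d)
    {η : ℝ} (hη : 0 < η) :
    nonlinForm p φ (u + d) (u + d) ≤
      (1 + η) * nonlinForm p φ u u + (1 + η⁻¹) * nonlinForm p φ d d := by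
  rw [nonlinForm, nonlinForm, nonlinForm, ← integral_const_mul, ← integral_const_mul,
    ← integral_add ((hφ.integrable_nonlin H hu hu).const_mul _)
      ((hφ.integrable_nonlin H hd hd).const_mul _)]
  refine integral_mono_ae (hφ.integrable_nonlin H (hu.add H hd) (hu.add H hd))
    (((hφ.integrable_nonlin H hu hu).const_mul _).add
      ((hφ.integrable_nonlin H hd hd).const_mul _)) ?_
  filter_upwards [Lp.coeFn_add u d] with x hx
  simp only [hx, Pi.add_apply]
  have hw : 0 ≤ |φ x| ^ (p - 1) := by positivity
  have key : (u x + d x) * (u x + d x) ≤ (1 + η) * (u x * u x) + (1 + η⁻¹) * (d x * d x) := by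
    have h1 : 0 ≤ η⁻¹ * (η * u x - d x) ^ 2 := by positivity
    have h2 : η⁻¹ * (η * u x - d x) ^ 2 = η * (u x * u x) - 2 * (u x * d x) +
        η⁻¹ * (d x * d x) := by field_simp; ring
    nlinarith
  nlinarith [mul_le_mul_of_nonneg_left key hw]

/-- The form `∫ |φ|^{p-1} u²` is upper semicontinuous for the `L²` topology on sets of bounded
energy. -/
theorem eventually_nonlinForm_lt (H : Admissible n s p V) {φ u₀ : L2 n}
    (hφ : MemEnergySpace s V φ) {b : ℝ}
    (hu₀ : kinEnergy s u₀ + potEnergy V u₀ ≤ ENNReal.ofReal b) {y : ℝ}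
    (hy : nonlinForm p φ u₀ u₀ < y) :
    ∀ᶠ u in 𝓝[{u : L2 n | kinEnergy s u + potEnergy V u ≤ ENNReal.ofReal b}] u₀,
      nonlinForm p φ u u < y := by
  have hmem : ∀ u : L2 n, kinEnergy s u + potEnergy V u ≤ ENNReal.ofReal b →
      MemEnergySpace s V u := fun u hu =>
    (memEnergySpace_iff H.s_pos H.trapping).2 (hu.trans_lt ENNReal.ofReal_lt_top)
  set N₀ := nonlinForm p φ u₀ u₀ with hN₀
  have hN0 : 0 ≤ N₀ := nonlinForm_self_nonneg p φ u₀
  set η : ℝ := (y - N₀) / (3 * (N₀ + 1)) with hη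
  have hd0 : 0 < y - N₀ := by linarith
  have hη0 : 0 < η := by positivity
  have hηN : η * N₀ ≤ (y - N₀) / 3 := by
    rw [hη, div_mul_eq_mul_div, div_le_div_iff₀ (by positivity) (by norm_num)]
    nlinarith
  set K : ℝ := 1 + η⁻¹ with hK
  have hK0 : 0 < K := by positivity
  obtain ⟨C, hC0, hC⟩ := nonlinForm_self_le H.one_le_dim H.s_pos H.s_le_one H.one_lt_p H.p_lt
    (hφ.integrable_rpow H) (ε := (y - N₀) / (3 * K * (4 * |b| + 1))) (by positivity)
  have hcont : Tendsto (fun u : L2 n => K * (C * ‖u - u₀‖ ^ 2)) (𝓝 u₀) (𝓝 0) := by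
    have : Continuous fun u : L2 n => K * (C * ‖u - u₀‖ ^ 2) := by fun_prop
    simpa using this.tendsto u₀
  filter_upwards [self_mem_nhdsWithin, nhdsWithin_le_nhds
    (hcont.eventually (gt_mem_nhds (by positivity : 0 < (y - N₀) / 3)))] with u hu hu2
  have hdE : kinEnergy s (u - u₀) ≤ ENNReal.ofReal (4 * |b|) := by
    refine le_self_add.trans ((energy_sub_le H.s_pos H.trapping u u₀).trans
      ((add_le_add (mul_le_mul' le_rfl hu) (mul_le_mul' le_rfl hu₀)).trans ?_))
    rw [← add_mul]
    refine (le_of_eq ?_).trans (ENNReal.ofReal_le_ofReal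
      (mul_le_mul_of_nonneg_left (le_abs_self b) (by norm_num)))
    rw [ENNReal.ofReal_mul (by norm_num)]
    norm_num
  have h1 := hC (u - u₀) (hdE.trans_lt ENNReal.ofReal_lt_top).ne
  have h2 : (kinEnergy s (u - u₀)).toReal ≤ 4 * |b| :=
    ENNReal.toReal_le_of_le_ofReal (by positivity) hdE
  have h3 := nonlinForm_add_le H hφ (hmem u₀ hu₀) ((hmem u hu).sub H (hmem u₀ hu₀)) hη0
  rw [add_sub_cancel] at h3
  have h4 : K * ((y - N₀) / (3 * K * (4 * |b| + 1)) * (kinEnergy s (u - u₀)).toReal) ≤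
      (y - N₀) / 3 := by
    calc _ ≤ K * ((y - N₀) / (3 * K * (4 * |b| + 1)) * (4 * |b| + 1)) := by
          gcongr; linarith
      _ = _ := by field_simp
  have h5 := mul_le_mul_of_nonneg_left h1 hK0.le
  nlinarith

/-- The quadratic form attains its minimum over the unit sphere of a closed subspace. -/
theorem exists_isMin_schrodForm (H : Admissible n s p V) {φ : L2 n} {c : ℝ} (hc : 0 ≤ c)
    (ω : ℝ) (hφ : MemEnergySpace s V φ) (S : Submodule ℝ (L2 n)) (hS : IsClosed (S : Set (L2 n)))
    (hne : ∃ v ∈ S, MemEnergySpace s V v ∧ v ≠ 0) :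
    ∃ u ∈ S, MemEnergySpace s V u ∧ ‖u‖ = 1 ∧ ∀ v ∈ S, MemEnergySpace s V v →
      schrodForm s p V φ c ω u u * ‖v‖ ^ 2 ≤ schrodForm s p V φ c ω v v := by
  obtain ⟨C, hC⟩ := exists_energy_le_schrodForm H hc ω hφ
  obtain ⟨v₀, hv₀S, hv₀, hv₀0⟩ := hne
  have normalize : ∀ v ∈ S, MemEnergySpace s V v → v ≠ 0 → ‖v‖⁻¹ • v ∈ S ∧
      MemEnergySpace s V (‖v‖⁻¹ • v) ∧ ‖‖v‖⁻¹ • v‖ = 1 := fun v hvS hv hv0 =>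
    ⟨S.smul_mem _ hvS, hv.smul _, by
      rw [norm_smul, norm_inv, norm_norm, inv_mul_cancel₀ (norm_ne_zero_iff.2 hv0)]⟩
  obtain ⟨hw₀S, hw₀, hw₀1⟩ := normalize v₀ hv₀S hv₀ hv₀0
  set w₀ := ‖v₀‖⁻¹ • v₀ with hw₀def
  set b : ℝ := 2 * schrodForm s p V φ c ω w₀ w₀ + C with hb
  set T : L2 n → ℝ≥0∞ := fun u => kinEnergy s u + potEnergy V u with hT
  have hmem : ∀ u : L2 n, T u ≤ ENNReal.ofReal b → MemEnergySpace s V u := fun u hu =>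
    (memEnergySpace_iff H.s_pos H.trapping).2 (hu.trans_lt ENNReal.ofReal_lt_top)
  set A : Set (L2 n) := {u | ‖u‖ ≤ 1 ∧ T u ≤ ENNReal.ofReal b} ∩ {u | ‖u‖ = 1 ∧ u ∈ S} with hA
  have hAc : IsCompact A := (isCompact_energy_le H.s_pos H.s_le_one H.trapping b).inter_right
    ((isClosed_eq continuous_norm continuous_const).inter hS)
  have hle : ∀ u : L2 n, MemEnergySpace s V u → ‖u‖ = 1 →
      schrodForm s p V φ c ω u u ≤ schrodForm s p V φ c ω w₀ w₀ → T u ≤ ENNReal.ofReal b := by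
    intro u hu hu1 hu2
    have := hC u hu
    rw [hu1] at this
    rw [← ENNReal.ofReal_toReal (a := T u) ((memEnergySpace_iff H.s_pos H.trapping).1 hu).ne]
    exact ENNReal.ofReal_le_ofReal (by rw [hb]; linarith)
  have hw₀A : w₀ ∈ A := ⟨⟨hw₀1.le, hle w₀ hw₀ hw₀1 le_rfl⟩, hw₀1, hw₀S⟩
  have hlsc : LowerSemicontinuousOn (fun u => schrodForm s p V φ c ω u u) A := by
    intro u₀ hu₀ y hy
    have hu₀m := hmem u₀ hu₀.1.2
    have hform : ∀ u ∈ A, schrodForm s p V φ c ω u u =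
        (T u).toReal + ω - c * nonlinForm p φ u u := by
      intro u hu
      rw [schrodForm, kineticForm_add_potentialForm_self H (hmem u hu.1.2),
        real_inner_self_eq_norm_sq, hu.2.1]
      ring
    simp only at hy ⊢
    rw [hform u₀ hu₀] at hy
    set ε : ℝ := ((T u₀).toReal + ω - c * nonlinForm p φ u₀ u₀ - y) / (2 * (c + 1)) with hε
    have hε0 : 0 < ε := div_pos (by linarith) (by positivity)
    have hεe : 2 * (c + 1) * ε = (T u₀).toReal + ω - c * nonlinForm p φ u₀ u₀ - y := by
      rw [hε]; field_simp
    have h1 := eventually_nonlinForm_lt H hφ hu₀.1.2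
      (y := nonlinForm p φ u₀ u₀ + ε) (by linarith)
    have h2 : ∀ᶠ u in 𝓝[A] u₀, (T u₀).toReal - ε < (T u).toReal := by
      rcases lt_or_ge ((T u₀).toReal - ε) 0 with h0 | h0
      · exact Eventually.of_forall fun u => h0.trans_le ENNReal.toReal_nonneg
      · have h3 : ENNReal.ofReal ((T u₀).toReal - ε) < T u₀ := by
          rw [ENNReal.ofReal_lt_iff_lt_toReal h0
            ((memEnergySpace_iff H.s_pos H.trapping).1 hu₀m).ne]
          linarith
        have h4 := lowerSemicontinuous_energy H.s_pos H.trapping u₀ _ h3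
        filter_upwards [self_mem_nhdsWithin, nhdsWithin_le_nhds h4] with u hu hu2
        exact (ENNReal.ofReal_lt_iff_lt_toReal h0
          ((memEnergySpace_iff H.s_pos H.trapping).1 (hmem u hu.1.2)).ne).1 hu2
    have hsub : A ⊆ {u : L2 n | kinEnergy s u + potEnergy V u ≤ ENNReal.ofReal b} :=
      fun u hu => hu.1.2
    filter_upwards [self_mem_nhdsWithin, nhdsWithin_mono _ hsub h1, h2] with u hu hu1 hu2
    rw [hform u hu]
    nlinarith
  obtain ⟨u, huA, hmin⟩ := hlsc.exists_isMinOn ⟨w₀, hw₀A⟩ hAc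
  refine ⟨u, huA.2.2, hmem u huA.1.2, huA.2.1, fun v hvS hv => ?_⟩
  have hunit : ∀ w ∈ S, MemEnergySpace s V w → ‖w‖ = 1 →
      schrodForm s p V φ c ω u u ≤ schrodForm s p V φ c ω w w := by
    intro w hwS hw hw1
    rcases le_or_gt (schrodForm s p V φ c ω w w) (schrodForm s p V φ c ω w₀ w₀) with h | h
    · exact hmin ⟨⟨hw1.le, hle w hw hw1 h⟩, hw1, hwS⟩
    · exact (hmin hw₀A).trans h.le
  rcases eq_or_ne v 0 with rfl | hv0
  · simp [schrodForm_zero_left]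
  · obtain ⟨h1, h2, h3⟩ := normalize v hvS hv hv0
    have h4 := hunit _ h1 h2 h3
    rw [schrodForm_smul_left, schrodForm_smul_right] at h4
    have hv1 : 0 < ‖v‖ := norm_pos_iff.2 hv0
    calc _ ≤ ‖v‖⁻¹ * (‖v‖⁻¹ * schrodForm s p V φ c ω v v) * ‖v‖ ^ 2 := by gcongr
      _ = _ := by field_simp

/-- A null vector of a form that is nonnegative on a subspace is orthogonal, with respect to the
form, to the subspace. -/
theorem schrodForm_eq_zero_of_null (H : Admissible n s p V) {φ u v : L2 n} {c ω : ℝ}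
    (hφ : MemEnergySpace s V φ) (S : Submodule ℝ (L2 n))
    (hpos : ∀ w ∈ S, MemEnergySpace s V w → 0 ≤ schrodForm s p V φ c ω w w)
    (huS : u ∈ S) (hu : MemEnergySpace s V u) (hvS : v ∈ S) (hv : MemEnergySpace s V v)
    (hu0 : schrodForm s p V φ c ω u u = 0) : schrodForm s p V φ c ω u v = 0 := by
  set a := schrodForm s p V φ c ω u v with ha
  set b := schrodForm s p V φ c ω v v with hb
  have hb0 : 0 ≤ b := hpos v hvS hv
  have h := hpos ((1 : ℝ) • u + (-a / (b + 1)) • v)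
    (S.add_mem (S.smul_mem _ huS) (S.smul_mem _ hvS)) ((hu.smul _).add H (hv.smul _))
  rw [schrodForm_add_smul_self H c ω _ _ hφ hu hv, hu0, ← ha, ← hb] at h
  have e : 1 ^ 2 * 0 + 2 * 1 * (-a / (b + 1)) * a + (-a / (b + 1)) ^ 2 * b =
      -(a ^ 2 * (b + 2)) / (b + 1) ^ 2 := by field_simp; ring
  rw [e, le_div_iff₀ (by positivity)] at h
  have : a ^ 2 ≤ 0 := by nlinarith [mul_nonneg (sq_nonneg a) hb0]
  exact (pow_eq_zero_iff two_ne_zero).1 (le_antisymm this (sq_nonneg a))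

end Forms

/-! ### Second variation at a ground state -/

section SecondVariation

variable {s p : ℝ} {V : ℝ → ℝ}

theorem hasDerivAt_abs_rpow_mul (hp : 1 < p) (y : ℝ) :
    HasDerivAt (fun y : ℝ => |y| ^ (p - 1) * y) (p * |y| ^ (p - 1)) y := by
  rcases lt_trichotomy y 0 with hy | rfl | hy
  · have h1 : HasDerivAt (fun y : ℝ => -(-y) ^ p) (-(p * (-y) ^ (p - 1) * -1)) y := by
      have := (Real.hasDerivAt_rpow_const (x := -y) (p := p) (Or.inr hp.le)).comp y
        (hasDerivAt_neg y)
      exact this.neg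
    have h2 : (fun y : ℝ => |y| ^ (p - 1) * y) =ᶠ[𝓝 y] fun y => -(-y) ^ p := by
      filter_upwards [gt_mem_nhds hy] with z hz
      rw [abs_of_neg hz]
      nth_rewrite 2 [← neg_neg z]
      rw [mul_neg, ← Real.rpow_add_one (by linarith), sub_add_cancel]
    refine (h1.congr_of_eventuallyEq h2).congr_deriv ?_
    rw [abs_of_neg hy]; ring
  · have h0 : (0 : ℝ) ^ (p - 1) = 0 := Real.zero_rpow (by linarith)
    rw [abs_zero, h0, mul_zero, hasDerivAt_iff_tendsto_slope]
    have h1 : Tendsto (fun y : ℝ => |y| ^ (p - 1)) (𝓝[≠] 0) (𝓝 0) := by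
      have : Continuous fun y : ℝ => |y| ^ (p - 1) :=
        continuous_abs.rpow_const fun _ => Or.inr (by linarith)
      have h2 := this.tendsto 0
      rw [abs_zero, h0] at h2
      exact h2.mono_left nhdsWithin_le_nhds
    refine h1.congr' ?_
    filter_upwards [self_mem_nhdsWithin] with z hz
    rw [slope_def_field, mul_zero, sub_zero, sub_zero, mul_div_cancel_right₀ _ hz]
  · have h1 := Real.hasDerivAt_rpow_const (x := y) (p := p) (Or.inr hp.le)
    have h2 : (fun y : ℝ => |y| ^ (p - 1) * y) =ᶠ[𝓝 y] fun y => y ^ p := by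
      filter_upwards [lt_mem_nhds hy] with z hz
      rw [abs_of_pos hz, ← Real.rpow_add_one hz.ne', sub_add_cancel]
    refine (h1.congr_of_eventuallyEq h2).congr_deriv ?_
    rw [abs_of_pos hy]

theorem abs_le_of_cos_sin (t a b : ℝ) : |Real.cos t * a + Real.sin t * b| ≤ |a| + |b| := by
  refine (abs_add_le _ _).trans ?_
  rw [abs_mul, abs_mul]
  nlinarith [Real.abs_cos_le_one t, Real.abs_sin_le_one t, abs_nonneg a, abs_nonneg b]

theorem abs_le_of_sin_cos (t a b : ℝ) : |-Real.sin t * a + Real.cos t * b| ≤ |a| + |b| := by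
  refine (abs_add_le _ _).trans ?_
  rw [abs_mul, abs_mul, abs_neg]
  nlinarith [Real.abs_cos_le_one t, Real.abs_sin_le_one t, abs_nonneg a, abs_nonneg b]

theorem hasDerivAt_rotation (t a b : ℝ) :
    HasDerivAt (fun t => Real.cos t * a + Real.sin t * b)
      (-Real.sin t * a + Real.cos t * b) t :=
  ((Real.hasDerivAt_cos t).mul_const a).add ((Real.hasDerivAt_sin t).mul_const b)

theorem hasDerivAt_rotation' (t a b : ℝ) :
    HasDerivAt (fun t => -Real.sin t * a + Real.cos t * b)
      (-(Real.cos t * a + Real.sin t * b)) t := by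
  refine (((Real.hasDerivAt_sin t).neg.mul_const a).add
    ((Real.hasDerivAt_cos t).mul_const b)).congr_deriv ?_
  ring

theorem abs_rpow_mul_mul_le (hp : 1 < p) {y z m : ℝ} (hy : |y| ≤ m) (hz : |z| ≤ m) :
    ‖|y| ^ (p - 1) * y * z‖ ≤ m ^ (p + 1) := by
  have hm : 0 ≤ m := (abs_nonneg y).trans hy
  rw [norm_mul, norm_mul, Real.norm_eq_abs, Real.norm_eq_abs, Real.norm_eq_abs,
    abs_of_nonneg (Real.rpow_nonneg (abs_nonneg y) _)]
  calc |y| ^ (p - 1) * |y| * |z| ≤ m ^ (p - 1) * m * m := by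
        gcongr
    _ = m ^ (p + 1) := by
      rw [mul_assoc, ← sq, ← Real.rpow_two,
        ← Real.rpow_add_of_nonneg hm (by linarith) (by norm_num)]
      congr 1; ring

section Derivatives

variable {φ h : L2 n}

theorem hasDerivAt_integral_abs_rpow (hp : 1 < p)
    (hm : Integrable fun x => (|φ x| + |h x|) ^ (p + 1)) (t : ℝ) :
    HasDerivAt (fun t => ∫ x, |Real.cos t * φ x + Real.sin t * h x| ^ (p + 1))
      (∫ x, (p + 1) * (|Real.cos t * φ x + Real.sin t * h x| ^ (p - 1) *
        (Real.cos t * φ x + Real.sin t * h x) * (-Real.sin t * φ x + Real.cos t * h x))) t := by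
  have hφm := measurable_lp φ
  have hhm := measurable_lp h
  have hmeas : ∀ t : ℝ, AEStronglyMeasurable
      (fun x => |Real.cos t * φ x + Real.sin t * h x| ^ (p + 1)) volume := fun t =>
    (((hφm.const_mul _).add (hhm.const_mul _)).abs.pow_const _).aestronglyMeasurable
  refine (hasDerivAt_integral_of_dominated_loc_of_deriv_le (s := Set.univ)
    (F' := fun t x => (p + 1) * (|Real.cos t * φ x + Real.sin t * h x| ^ (p - 1) *
      (Real.cos t * φ x + Real.sin t * h x) * (-Real.sin t * φ x + Real.cos t * h x)))
    (bound := fun x => (p + 1) * (|φ x| + |h x|) ^ (p + 1)) univ_mem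
    (Eventually.of_forall hmeas) (hm.mono' (hmeas t) (Eventually.of_forall fun x => ?_)) ?_
    (Eventually.of_forall fun x τ _ => ?_) (hm.const_mul _)
    (Eventually.of_forall fun x τ _ => ?_)).2
  · rw [Real.norm_of_nonneg (by positivity)]
    exact Real.rpow_le_rpow (abs_nonneg _) (abs_le_of_cos_sin _ _ _) (by linarith)
  · exact ((((((hφm.const_mul _).add (hhm.const_mul _)).abs.pow_const _).mul
      ((hφm.const_mul _).add (hhm.const_mul _))).mul
      ((hφm.const_mul _).add (hhm.const_mul _))).const_mul _).aestronglyMeasurable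
  · rw [norm_mul, Real.norm_of_nonneg (by linarith : 0 ≤ p + 1)]
    exact mul_le_mul_of_nonneg_left (abs_rpow_mul_mul_le hp (abs_le_of_cos_sin _ _ _)
      (abs_le_of_sin_cos _ _ _)) (by linarith)
  · have h1 := (hasDerivAt_abs_rpow (Real.cos τ * φ x + Real.sin τ * h x)
      (p := p + 1) (by linarith)).comp τ (hasDerivAt_rotation τ (φ x) (h x))
    refine h1.congr_deriv ?_
    rw [show p + 1 - 2 = p - 1 by ring]
    ring

theorem hasDerivAt_integral_abs_rpow_mul (hp : 1 < p)
    (hm : Integrable fun x => (|φ x| + |h x|) ^ (p + 1)) :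
    HasDerivAt (fun t => ∫ x, (p + 1) * (|Real.cos t * φ x + Real.sin t * h x| ^ (p - 1) *
        (Real.cos t * φ x + Real.sin t * h x) * (-Real.sin t * φ x + Real.cos t * h x)))
      (∫ x, (p + 1) * (p * (|φ x| ^ (p - 1) * (h x * h x)) -
        |φ x| ^ (p - 1) * (φ x * φ x))) 0 := by
  have hφm := measurable_lp φ
  have hhm := measurable_lp h
  have hmeas : ∀ t : ℝ, AEStronglyMeasurable
      (fun x => (p + 1) * (|Real.cos t * φ x + Real.sin t * h x| ^ (p - 1) *
        (Real.cos t * φ x + Real.sin t * h x) * (-Real.sin t * φ x + Real.cos t * h x))) volume :=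
    fun t => ((((((hφm.const_mul _).add (hhm.const_mul _)).abs.pow_const _).mul
      ((hφm.const_mul _).add (hhm.const_mul _))).mul
      ((hφm.const_mul _).add (hhm.const_mul _))).const_mul _).aestronglyMeasurable
  have hrot : ∀ t : ℝ, ∀ x, |-(Real.cos t * φ x + Real.sin t * h x)| ≤ |φ x| + |h x| :=
    fun t x => by rw [abs_neg]; exact abs_le_of_cos_sin _ _ _
  have key : ∀ t : ℝ, ∀ x, HasDerivAt (fun t => (p + 1) *
      (|Real.cos t * φ x + Real.sin t * h x| ^ (p - 1) *
        (Real.cos t * φ x + Real.sin t * h x) * (-Real.sin t * φ x + Real.cos t * h x)))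
      ((p + 1) * (p * |Real.cos t * φ x + Real.sin t * h x| ^ (p - 1) *
        (-Real.sin t * φ x + Real.cos t * h x) * (-Real.sin t * φ x + Real.cos t * h x) +
        |Real.cos t * φ x + Real.sin t * h x| ^ (p - 1) *
        (Real.cos t * φ x + Real.sin t * h x) * -(Real.cos t * φ x + Real.sin t * h x))) t := by
    intro t x
    have h1 := (hasDerivAt_abs_rpow_mul hp (Real.cos t * φ x + Real.sin t * h x)).comp t
      (hasDerivAt_rotation t (φ x) (h x))
    exact (h1.mul (hasDerivAt_rotation' t (φ x) (h x))).const_mul (p + 1)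
  have h0 := (hasDerivAt_integral_of_dominated_loc_of_deriv_le (s := Set.univ)
    (bound := fun x => (p + 1) * (p * (|φ x| + |h x|) ^ (p + 1) + (|φ x| + |h x|) ^ (p + 1)))
    (x₀ := (0 : ℝ)) univ_mem
    (Eventually.of_forall hmeas) ((hm.const_mul (p + 1)).mono' (hmeas 0)
      (Eventually.of_forall fun x => ?_)) ?_
    (Eventually.of_forall fun x τ _ => ?_) (((hm.const_mul p).add hm).const_mul _)
    (Eventually.of_forall fun x τ _ => key τ x)).2
  · refine h0.congr_deriv (integral_congr_ae (Eventually.of_forall fun x => ?_))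
    simp only [Real.cos_zero, Real.sin_zero]
    ring_nf
  · rw [norm_mul, Real.norm_of_nonneg (by linarith : 0 ≤ p + 1)]
    exact mul_le_mul_of_nonneg_left (abs_rpow_mul_mul_le hp (abs_le_of_cos_sin _ _ _)
      (abs_le_of_sin_cos _ _ _)) (by linarith)
  · refine Measurable.aestronglyMeasurable ?_
    fun_prop
  · rw [norm_mul, Real.norm_of_nonneg (by linarith : 0 ≤ p + 1)]
    refine mul_le_mul_of_nonneg_left ((norm_add_le _ _).trans (add_le_add ?_ ?_)) (by linarith)
    · have hz := abs_le_of_sin_cos τ (φ x) (h x)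
      have hy := abs_le_of_cos_sin τ (φ x) (h x)
      have hM : 0 ≤ |φ x| + |h x| := by positivity
      rw [mul_assoc, mul_assoc, norm_mul, Real.norm_of_nonneg (by linarith : 0 ≤ p), norm_mul,
        norm_mul, Real.norm_eq_abs, Real.norm_eq_abs,
        abs_of_nonneg (Real.rpow_nonneg (abs_nonneg _) _)]
      refine mul_le_mul_of_nonneg_left ?_ (by linarith)
      calc _ ≤ (|φ x| + |h x|) ^ (p - 1) * ((|φ x| + |h x|) * (|φ x| + |h x|)) := by
            gcongr
        _ = _ := by
          rw [← sq, ← Real.rpow_two, ← Real.rpow_add_of_nonneg hM (by linarith) (by norm_num)]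
          congr 1; ring
    · exact abs_rpow_mul_mul_le hp (abs_le_of_cos_sin _ _ _) (hrot τ x)

end Derivatives

/-- The necessary conditions of first and second order at a minimum. -/
theorem deriv_conditions_of_isLocalMin {f f' : ℝ → ℝ} {f'' x : ℝ}
    (hf : ∀ t, HasDerivAt f (f' t) t) (hf' : HasDerivAt f' f'' x) (hmin : IsLocalMin f x) :
    f' x = 0 ∧ 0 ≤ f'' := by
  have h0 : f' x = 0 := hmin.hasDerivAt_eq_zero (hf x)
  refine ⟨h0, ?_⟩
  by_contra hneg
  push Not at hneg
  have hd : deriv f = f' := funext fun t => (hf t).deriv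
  have hdn : deriv (fun t => -f t) = fun t => -f' t := funext fun t => (hf t).neg.deriv
  -- otherwise `x` is also a local maximum, so that `f` is constant near `x`
  have hmax : IsLocalMin (fun t => -f t) x := by
    refine isLocalMin_of_deriv_deriv_pos ?_ ?_ (hf x).neg.continuousAt
    · rw [hdn]
      have : deriv (fun t => -f' t) x = -f'' := hf'.neg.deriv
      linarith
    · rw [hdn]
      simp only [h0, neg_zero]
  have hconst : f =ᶠ[𝓝 x] fun _ => f x := by
    filter_upwards [hmin, hmax] with t h1 h2
    exact le_antisymm (by simpa using h2) h1
  have h1 : f' =ᶠ[𝓝 x] fun _ => 0 := by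
    have := hconst.deriv
    rw [hd] at this
    filter_upwards [this] with t ht
    rw [ht]; simp
  have h2 := (hf'.congr_of_eventuallyEq h1.symm).unique (hasDerivAt_const x (0 : ℝ))
  linarith

theorem norm_sq_eq_integral (u : L2 n) : ‖u‖ ^ 2 = ∫ x, u x ^ 2 := by
  rw [← real_inner_self_eq_norm_sq, L2.inner_def]
  refine integral_congr_ae (Eventually.of_forall fun x => ?_)
  simp [sq]

theorem nonlinForm_self_self (hp : 1 < p) (φ : L2 n) :
    nonlinForm p φ φ φ = ∫ x, |φ x| ^ (p + 1) := by
  refine integral_congr_ae (Eventually.of_forall fun x => ?_)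
  simp only
  rw [← abs_mul_abs_self, ← sq, ← Real.rpow_two,
    ← Real.rpow_add_of_nonneg (abs_nonneg _) (by linarith) (by norm_num)]
  congr 1; ring

theorem multiplier_mul (hp : 1 < p) {lam : ℝ} (hlam : 0 < lam) {φ : L2 n}
    (hφ : IsNormalizedWave s p V lam φ) :
    multiplier s p V φ * lam =
      -(kineticForm s φ φ + potentialForm V φ φ - nonlinForm p φ φ φ) := by
  rw [multiplier, hφ.mass, div_mul_cancel₀ _ hlam.ne', nonlinForm_self_self hp]

/-- First and second variation of the energy at a minimizer along the great circle
`cos t φ + sin t h` of the sphere of mass `lam`. -/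
theorem variation_of_normalized (H : Admissible n s p V) {lam : ℝ} (hlam : 0 < lam) {φ h : L2 n}
    (hφ : IsNormalizedWave s p V lam φ) (hh : MemEnergySpace s V h) (horth : ⟪φ, h⟫_ℝ = 0)
    (hnorm : ‖h‖ ^ 2 = lam) : formMinus s p V φ φ h = 0 ∧ 0 ≤ formPlus s p V φ h h := by
  have hp := H.one_lt_p
  have hφX := hφ.mem
  have hφn : ‖φ‖ ^ 2 = lam := by rw [norm_sq_eq_integral, hφ.mass]
  set w : ℝ → L2 n := fun t => Real.cos t • φ + Real.sin t • h with hw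
  have hwX : ∀ t, MemEnergySpace s V (w t) := fun t => (hφX.smul _).add H (hh.smul _)
  have hwn : ∀ t, ∫ x, w t x ^ 2 = lam := by
    intro t
    rw [← norm_sq_eq_integral, ← real_inner_self_eq_norm_sq]
    have horth' : ⟪h, φ⟫_ℝ = 0 := by rw [real_inner_comm]; exact horth
    have h1 : ⟪φ, φ⟫_ℝ = lam := by rw [real_inner_self_eq_norm_sq, hφn]
    have h2 : ⟪h, h⟫_ℝ = lam := by rw [real_inner_self_eq_norm_sq, hnorm]
    simp only [hw, inner_add_left, inner_add_right, real_inner_smul_left, real_inner_smul_right,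
      horth, horth', h1, h2]
    nlinarith [Real.sin_sq_add_cos_sq t]
  have hm : Integrable fun x => (|φ x| + |h x|) ^ (p + 1) := by
    refine (((hφX.abs H).add H (hh.abs H)).integrable_rpow H).congr ?_
    filter_upwards [Lp.coeFn_add |φ| |h|, Lp.coeFn_abs φ, Lp.coeFn_abs h] with x h1 h2 h3
    rw [h1, Pi.add_apply, h2, h3, abs_of_nonneg (by positivity)]
  set a := kineticForm s φ φ + potentialForm V φ φ with ha
  set b := kineticForm s φ h + potentialForm V φ h with hb
  set d := kineticForm s h h + potentialForm V h h with hd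
  have hquad : ∀ t, kineticForm s (w t) (w t) + potentialForm V (w t) (w t) =
      Real.cos t ^ 2 * a + 2 * Real.cos t * Real.sin t * b + Real.sin t ^ 2 * d := by
    intro t
    have := schrodForm_add_smul_self H 0 0 (Real.cos t) (Real.sin t) hφX hφX hh
    simpa only [schrodForm, zero_mul, add_zero, sub_zero] using this
  have hE : ∀ t, energy s p V (w t) = (1 / 2) * (Real.cos t ^ 2 * a +
      2 * Real.cos t * Real.sin t * b + Real.sin t ^ 2 * d) -
      (1 / (p + 1)) * ∫ x, |Real.cos t * φ x + Real.sin t * h x| ^ (p + 1) := by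
    intro t
    rw [energy, hquad]
    congr 2
    refine integral_congr_ae ?_
    filter_upwards [Lp.coeFn_add (Real.cos t • φ) (Real.sin t • h),
      Lp.coeFn_smul (Real.cos t) φ, Lp.coeFn_smul (Real.sin t) h] with x h1 h2 h3
    rw [h1, Pi.add_apply, h2, h3]
    rfl
  have hmin : IsLocalMin (fun t => energy s p V (w t)) 0 := by
    refine Eventually.of_forall fun t => ?_
    have hw0 : w 0 = φ := by simp [hw]
    simp only [hw0]
    exact hφ.minimal _ (hwX t) (hwn t)
  set F : ℝ → ℝ := fun t => ∫ x, (p + 1) * (|Real.cos t * φ x + Real.sin t * h x| ^ (p - 1) *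
        (Real.cos t * φ x + Real.sin t * h x) * (-Real.sin t * φ x + Real.cos t * h x)) with hF
  have hd1 : ∀ t, HasDerivAt (fun t => energy s p V (w t))
      (Real.cos t * Real.sin t * (d - a) + (Real.cos t ^ 2 - Real.sin t ^ 2) * b -
        (1 / (p + 1)) * F t) t := by
    intro t
    rw [funext hE]
    have hc := Real.hasDerivAt_cos t
    have hs := Real.hasDerivAt_sin t
    have h1 := ((((hc.pow 2).mul_const a).add (((hc.const_mul 2).mul hs).mul_const b)).add
      ((hs.pow 2).mul_const d)).const_mul (1 / 2)
    refine (h1.sub ((hasDerivAt_integral_abs_rpow hp hm t).const_mul (1 / (p + 1)))).congr_deriv ?_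
    rw [hF]
    congr 1
    simp
    ring
  have hd2 := (((((Real.hasDerivAt_cos 0).mul (Real.hasDerivAt_sin 0)).mul_const (d - a)).add
    ((((Real.hasDerivAt_cos 0).pow 2).sub ((Real.hasDerivAt_sin 0).pow 2)).mul_const b)).sub
    ((hasDerivAt_integral_abs_rpow_mul hp hm).const_mul (1 / (p + 1))))
  obtain ⟨h1, h2⟩ := deriv_conditions_of_isLocalMin hd1 hd2 hmin
  have hF0 : F 0 = (p + 1) * nonlinForm p φ φ h := by
    rw [nonlinForm, ← integral_const_mul]
    refine integral_congr_ae (Eventually.of_forall fun x => ?_)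
    simp [mul_assoc]
  have hF1 : (∫ x, (p + 1) * (p * (|φ x| ^ (p - 1) * (h x * h x)) -
      |φ x| ^ (p - 1) * (φ x * φ x))) =
      (p + 1) * (p * nonlinForm p φ h h - nonlinForm p φ φ φ) := by
    rw [integral_const_mul, integral_sub ((hφX.integrable_nonlin H hh hh).const_mul p)
      (hφX.integrable_nonlin H hφX hφX), integral_const_mul]
    rfl
  have hp1 : p + 1 ≠ 0 := by linarith
  rw [hF0] at h1
  rw [hF1] at h2
  simp only [one_div, inv_mul_cancel_left₀ hp1, Real.cos_zero, Real.sin_zero] at h1 h2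
  have hmul := multiplier_mul hp hlam hφ
  constructor
  · rw [formMinus, linForm_eq, schrodForm, horth]
    rw [← hb]
    linarith
  · rw [formPlus, linForm_eq, schrodForm, real_inner_self_eq_norm_sq, hnorm, hmul, ← ha, ← hd]
    simp at h2
    linarith

theorem exists_normalizing_scalar {lam : ℝ} (hlam : 0 < lam) {h : L2 n} (hh : h ≠ 0) :
    ∃ r : ℝ, r ≠ 0 ∧ ‖r • h‖ ^ 2 = lam := by
  have hn : 0 < ‖h‖ := norm_pos_iff.2 hh
  refine ⟨√lam / ‖h‖, by positivity, ?_⟩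
  rw [norm_smul, Real.norm_of_nonneg (by positivity), div_mul_cancel₀ _ hn.ne',
    Real.sq_sqrt hlam.le]

/-- `L₊ ≥ 0` on the orthogonal complement of `φ`: this is the second-order condition at a minimizer,
extended from the sphere of mass `lam` by homogeneity. -/
theorem formPlus_nonneg_of_orthogonal (H : Admissible n s p V) {lam : ℝ} (hlam : 0 < lam)
    {φ h : L2 n} (hφ : IsNormalizedWave s p V lam φ) (hh : MemEnergySpace s V h)
    (horth : ⟪φ, h⟫_ℝ = 0) : 0 ≤ formPlus s p V φ h h := by
  rcases eq_or_ne h 0 with rfl | h0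
  · rw [formPlus, linForm_eq, schrodForm_zero_left]
  · obtain ⟨r, hr, hrn⟩ := exists_normalizing_scalar hlam h0
    have := (variation_of_normalized H hlam hφ (hh.smul r)
      (by rw [real_inner_smul_right, horth, mul_zero]) hrn).2
    rw [formPlus, linForm_eq, schrodForm_smul_left, schrodForm_smul_right, ← mul_assoc] at this
    exact nonneg_of_mul_nonneg_right this (mul_self_pos.2 hr)

theorem inner_self_eq_mass {lam : ℝ} {φ : L2 n} (hφ : IsNormalizedWave s p V lam φ) :
    ⟪φ, φ⟫_ℝ = lam := by
  rw [real_inner_self_eq_norm_sq, norm_sq_eq_integral, hφ.mass]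

/-- The component of `v` orthogonal to `φ`. -/
theorem inner_sub_proj_eq_zero {φ : L2 n} (hφ : ⟪φ, φ⟫_ℝ ≠ 0) (v : L2 n) :
    ⟪φ, v - (⟪φ, v⟫_ℝ / ⟪φ, φ⟫_ℝ) • φ⟫_ℝ = 0 := by
  rw [inner_sub_right, real_inner_smul_right, div_mul_cancel₀ _ hφ, sub_self]

theorem formMinus_self (H : Admissible n s p V) {lam : ℝ} (hlam : 0 < lam)
    {φ : L2 n} (hφ : IsNormalizedWave s p V lam φ) : formMinus s p V φ φ φ = 0 := by
  rw [formMinus, linForm_eq, schrodForm, inner_self_eq_mass hφ, multiplier_mul H.one_lt_p hlam hφ]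
  ring

/-- The Euler-Lagrange equation of a normalized ground state. -/
theorem formMinus_eq_zero (H : Admissible n s p V) {lam : ℝ} (hlam : 0 < lam)
    {φ v : L2 n} (hφ : IsNormalizedWave s p V lam φ) (hv : MemEnergySpace s V v) :
    formMinus s p V φ φ v = 0 := by
  have hφX := hφ.mem
  have orth_case : ∀ h : L2 n, MemEnergySpace s V h → ⟪φ, h⟫_ℝ = 0 →
      formMinus s p V φ φ h = 0 := by
    intro h hh horth
    rcases eq_or_ne h 0 with rfl | h0
    · rw [formMinus, linForm_eq, schrodForm_comm, schrodForm_zero_left]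
    · obtain ⟨r, hr, hrn⟩ := exists_normalizing_scalar hlam h0
      have := (variation_of_normalized H hlam hφ (hh.smul r)
        (by rw [real_inner_smul_right, horth, mul_zero]) hrn).1
      rw [formMinus, linForm_eq, schrodForm_smul_right] at this
      exact (mul_eq_zero.1 this).resolve_left hr
  have h0 : ⟪φ, φ⟫_ℝ ≠ 0 := by rw [inner_self_eq_mass hφ]; exact hlam.ne'
  set r := ⟪φ, v⟫_ℝ / ⟪φ, φ⟫_ℝ with hr
  have h1 := orth_case (v - r • φ) (hv.sub H (hφX.smul r)) (inner_sub_proj_eq_zero h0 v)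
  have h2 := formMinus_self H hlam hφ
  rw [formMinus, linForm_eq] at h1 h2 ⊢
  have h3 := schrodForm_add_right H 1 (multiplier s p V φ) hφX (hv.sub H (hφX.smul r))
    (hφX.smul r) hφX
  rw [sub_add_cancel, h1, schrodForm_smul_right, h2] at h3
  simpa using h3

end SecondVariation

/-! ### Irreducibility: nonnegative null vectors are not disjoint -/

section Irreducibility

variable {s p : ℝ} {V : ℝ → ℝ}

/-- If almost every translate of `f` is disjoint from `g`, then one of them vanishes. -/
theorem ae_eq_zero_of_translates_disjoint {f g : Rn n → ℝ≥0∞} (hf : Measurable f)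
    (hg : Measurable g) (hfg : ∀ᵐ h : Rn n, ∀ᵐ x : Rn n, f (x + h) * g x = 0) :
    f =ᵐ[volume] 0 ∨ g =ᵐ[volume] 0 := by
  have h1 : ∫⁻ h : Rn n, ∫⁻ x : Rn n, f (x + h) * g x = 0 := by
    refine lintegral_eq_zero_of_ae_eq_zero ?_
    filter_upwards [hfg] with h hh
    exact lintegral_eq_zero_of_ae_eq_zero hh
  have hm : Measurable fun z : Rn n × Rn n => f (z.2 + z.1) * g z.2 :=
    (hf.comp (measurable_snd.add measurable_fst)).mul (hg.comp measurable_snd)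
  rw [lintegral_lintegral_swap hm.aemeasurable] at h1
  have h2 : ∀ x : Rn n, ∫⁻ h : Rn n, f (x + h) * g x = (∫⁻ y, f y) * g x := by
    intro x
    have hfx : Measurable fun h => f (x + h) := hf.comp (measurable_const_add x)
    rw [lintegral_mul_const _ hfx, lintegral_add_left_eq_self (fun y => f y) x]
  simp only [h2] at h1
  rw [lintegral_const_mul _ hg, mul_eq_zero, lintegral_eq_zero_iff hf, lintegral_eq_zero_iff hg]
    at h1
  exact h1

theorem abs_sub_eq_add_of_disjoint {u v : L2 n} (hu : ∀ᵐ x, 0 ≤ u x) (hv : ∀ᵐ x, 0 ≤ v x)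
    (huv : ∀ᵐ x, u x * v x = 0) : |u - v| = u + v := by
  refine Lp.ext ?_
  filter_upwards [Lp.coeFn_abs (u - v), Lp.coeFn_sub u v, Lp.coeFn_add u v, hu, hv, huv]
    with x h1 h2 h3 h4 h5 h6
  rw [h1, h2, h3, Pi.sub_apply, Pi.add_apply]
  rcases mul_eq_zero.1 h6 with h | h
  · rw [h, zero_sub, abs_neg, abs_of_nonneg h5, zero_add]
  · rw [h, sub_zero, abs_of_nonneg h4, add_zero]

theorem shiftEnergy_ne_top (h : Rn n) (u : L2 n) : shiftEnergy h u ≠ ∞ := by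
  have h1 : shiftEnergy h u ≤ ∫⁻ x, ‖(translate h u - u) x‖ₑ ^ 2 := by
    refine lintegral_mono_ae ?_
    filter_upwards [Lp.coeFn_sub (translate h u) u, coeFn_translate h u] with x h1 h2
    rw [h1, Pi.sub_apply, h2]
  rw [lintegral_enorm_sq_eq] at h1
  exact (h1.trans_lt ENNReal.ofReal_lt_top).ne

theorem measurable_shiftEnergy (u : L2 n) : Measurable fun h => shiftEnergy h u :=
  ((measurable_shift_sub u).comp measurable_swap).lintegral_prod_right'

/-- Equality of the shift energies of `u + v` and `u - v` for disjoint nonnegative functions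
means that the shift of `u` is disjoint from `v`. -/
theorem ae_shift_mul_eq_zero {u v : L2 n} (hu : ∀ᵐ x, 0 ≤ u x) (hv : ∀ᵐ x, 0 ≤ v x)
    (huv : ∀ᵐ x, u x * v x = 0) {h : Rn n}
    (hh : shiftEnergy h (u - v) ≤ shiftEnergy h (u + v)) : ∀ᵐ x, u (x + h) * v x = 0 := by
  have key : ∀ᵐ x, (u + v) x = u x + v x ∧ (u - v) x = u x - v x ∧ 0 ≤ u x ∧ 0 ≤ v x ∧
      u x * v x = 0 := by
    filter_upwards [Lp.coeFn_add u v, Lp.coeFn_sub u v, hu, hv, huv] with x h1 h2 h3 h4 h5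
    exact ⟨h1, h2, h3, h4, h5⟩
  have hle : ∀ᵐ x, ‖(u + v) (x + h) - (u + v) x‖ₑ ^ 2 ≤ ‖(u - v) (x + h) - (u - v) x‖ₑ ^ 2 := by
    have h0 := abs_sub_eq_add_of_disjoint hu hv huv
    filter_upwards [Lp.coeFn_abs (u - v), ae_shift (Lp.coeFn_abs (u - v)) h] with x h1 h2
    rw [h0] at h1 h2
    rw [h1, h2]
    gcongr
    rw [← ofReal_norm, ← ofReal_norm]
    exact ENNReal.ofReal_le_ofReal (abs_abs_sub_abs_le _ _)
  have hm : Measurable fun x => ‖(u - v) (x + h) - (u - v) x‖ₑ ^ 2 :=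
    ((((measurable_lp (u - v)).comp (measurable_add_const h)).sub
      (measurable_lp (u - v))).enorm).pow_const 2
  have heq := ae_eq_of_ae_le_of_lintegral_le hle (shiftEnergy_ne_top h (u + v))
    hm.aemeasurable hh
  filter_upwards [heq, key, ae_shift key h] with x h1 h2 h3
  obtain ⟨a1, a2, a3, a4, a5⟩ := h2
  obtain ⟨b1, b2, b3, b4, b5⟩ := h3
  rw [a1, a2, b1, b2, ← ofReal_norm, ← ofReal_norm, ← ENNReal.ofReal_pow (norm_nonneg _),
    ← ENNReal.ofReal_pow (norm_nonneg _), ENNReal.ofReal_eq_ofReal_iff (by positivity)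
    (by positivity), Real.norm_eq_abs, Real.norm_eq_abs, sq_abs, sq_abs] at h1
  have h4 : u (x + h) * v x + u x * v (x + h) = 0 := by nlinarith
  have := mul_nonneg b3 a4
  have := mul_nonneg a3 b4
  linarith

theorem kineticForm_sub_add_self (H : Admissible n s p V) {u v : L2 n}
    (hu : MemEnergySpace s V u) (hv : MemEnergySpace s V v) (huv : kineticForm s u v = 0) :
    kinEnergy s (u - v) = kinEnergy s (u + v) := by
  rw [← ENNReal.toReal_eq_toReal_iff' ((hu.sub H hv).kinEnergy_ne_top H)
    ((hu.add H hv).kinEnergy_ne_top H), ← kineticForm_self H.s_pos, ← kineticForm_self H.s_pos]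
  have hvu : kineticForm s v u = 0 := by rw [kineticForm_comm]; exact huv
  have e : u - v = u + (-1 : ℝ) • v := by rw [neg_one_smul, sub_eq_add_neg]
  have expand : ∀ c : ℝ, kineticForm s (u + c • v) (u + c • v) =
      kineticForm s u u + c ^ 2 * kineticForm s v v := by
    intro c
    have hc := hv.smul c
    rw [kineticForm_add_left H.s_pos hu hc (hu.add H hc), kineticForm_comm s u,
      kineticForm_comm s (c • v), kineticForm_add_left H.s_pos hu hc hu,
      kineticForm_add_left H.s_pos hu hc hc, kineticForm_smul_left, kineticForm_smul_left,
      kineticForm_comm s u (c • v), kineticForm_comm s v (c • v), kineticForm_smul_left,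
      kineticForm_smul_left, hvu]
    ring
  have h1 := expand 1
  rw [one_smul] at h1
  rw [e, expand, h1]
  norm_num

/-- Nonlocality: for `s < 1`, two nonzero nonnegative functions with disjoint supports are never
orthogonal for the kinetic form. -/
theorem eq_zero_of_kineticForm_eq_zero (H : Admissible n s p V) (hs : s < 1) {u v : L2 n}
    (hu : MemEnergySpace s V u) (hv : MemEnergySpace s V v) (hu0 : ∀ᵐ x, 0 ≤ u x)
    (hv0 : ∀ᵐ x, 0 ≤ v x) (huv : ∀ᵐ x, u x * v x = 0) (hk : kineticForm s u v = 0) :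
    u = 0 ∨ v = 0 := by
  obtain ⟨c, hc0, hct, hc⟩ := exists_kinEnergy_eq H.one_le_dim H.s_pos hs
  have hE := kineticForm_sub_add_self H hu hv hk
  have hle : ∀ h, ENNReal.ofReal (gagliardoKernel s h) * shiftEnergy h (u + v) ≤
      ENNReal.ofReal (gagliardoKernel s h) * shiftEnergy h (u - v) := by
    intro h
    rw [← abs_sub_eq_add_of_disjoint hu0 hv0 huv]
    exact mul_le_mul' le_rfl (shiftEnergy_abs_le h _)
  have hfin : ∫⁻ h : Rn n, ENNReal.ofReal (gagliardoKernel s h) * shiftEnergy h (u + v) ≠ ∞ := by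
    rw [← hc]
    exact ENNReal.mul_ne_top hct ((hu.add H hv).kinEnergy_ne_top H)
  have heq := ae_eq_of_ae_le_of_lintegral_le (Eventually.of_forall hle) hfin
    ((measurable_gagliardoKernel s).ennreal_ofReal.mul (measurable_shiftEnergy _)).aemeasurable
    (by rw [← hc, ← hc, hE])
  have : NeZero n := ⟨by have := H.one_le_dim; omega⟩
  have hne : ∀ᵐ h : Rn n, h ≠ 0 := Measure.ae_ne volume 0
  have hdis : ∀ᵐ h : Rn n, ∀ᵐ x : Rn n, ‖u (x + h)‖ₑ * ‖v x‖ₑ = 0 := by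
    filter_upwards [heq, hne] with h h1 h2
    have h3 : ENNReal.ofReal (gagliardoKernel s h) ≠ 0 := by
      rw [ENNReal.ofReal_ne_zero_iff]; exact gagliardoKernel_pos s h2
    have h4 := (ENNReal.mul_right_inj h3 ENNReal.ofReal_ne_top).1 h1
    filter_upwards [ae_shift_mul_eq_zero hu0 hv0 huv h4.ge] with x hx
    rw [← enorm_mul, hx, enorm_zero]
  refine (ae_eq_zero_of_translates_disjoint (measurable_lp u).enorm (measurable_lp v).enorm
    hdis).imp (fun h => ?_) (fun h => ?_)
  all_goals
    rw [Lp.eq_zero_iff_ae_eq_zero]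
    filter_upwards [h] with x hx
    simpa using hx

/-- The energy space contains smooth cutoff functions equal to one on any given ball. -/
theorem exists_cutoff (H : Admissible n s p V) {R : ℝ} (hR : 0 < R) :
    ∃ f : L2 n, MemEnergySpace s V f ∧ (∀ᵐ x, 0 ≤ f x) ∧
      ∀ᵐ x : Rn n, x ∈ Metric.ball (0 : Rn n) R → f x = 1 := by
  let b : ContDiffBump (0 : Rn n) := ⟨R, R + 1, hR, by linarith⟩
  have hbc : ContDiff ℝ ((⊤ : ℕ∞) : WithTop ℕ∞) (b : Rn n → ℝ) := b.contDiff
  have hb : HasCompactSupport (b : Rn n → ℝ) := b.hasCompactSupport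
  let f : SchwartzMap (Rn n) ℝ := hb.toSchwartzMap hbc
  have hgs : HasCompactSupport (fun x => ((b x : ℝ) : ℂ)) := hb.comp_left Complex.ofReal_zero
  have hgc : ContDiff ℝ ((⊤ : ℕ∞) : WithTop ℕ∞) (fun x => ((b x : ℝ) : ℂ)) :=
    Complex.ofRealCLM.contDiff.comp hbc
  let g : SchwartzMap (Rn n) ℂ := hgs.toSchwartzMap hgc
  have hf := f.coeFn_toLp 2 (volume : Measure (Rn n))
  have hfb : ∀ x, f x = b x := fun x => rfl
  have hfour : fourierL2 (f.toLp 2 volume) = (𝓕 g).toLp 2 volume := by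
    have hcomp : Complex.ofRealCLM.compLp (f.toLp 2 (volume : Measure (Rn n)))
        = g.toLp 2 volume := by
      refine Lp.ext ?_
      filter_upwards [Complex.ofRealCLM.coeFn_compLp (f.toLp 2 (volume : Measure (Rn n))), hf,
        g.coeFn_toLp 2 (volume : Measure (Rn n))] with x h1 h2 h3
      rw [h1, h2, h3]
      rfl
    rw [← SchwartzMap.toLp_fourier_eq, fourierL2, ← hcomp]
  refine ⟨f.toLp 2 volume, ⟨?_, ?_⟩, ?_, ?_⟩
  · obtain ⟨M, hM⟩ := (𝓕 g).decay 0 0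
    have hM' : ∀ ξ, ‖𝓕 g ξ‖ ≤ M := fun ξ => by simpa using hM.2 ξ
    have hi : Integrable fun ξ : Rn n =>
        M * (‖ξ‖ ^ 0 * ‖𝓕 g ξ‖ + (2 * Real.pi) ^ 2 * (‖ξ‖ ^ 2 * ‖𝓕 g ξ‖)) :=
      (((𝓕 g).integrable_pow_mul volume 0).add
        (((𝓕 g).integrable_pow_mul volume 2).const_mul _)).const_mul M
    refine hi.mono' ((continuous_fracSymbol H.s_pos).aestronglyMeasurable.mul
      ((Lp.aestronglyMeasurable _).norm.pow 2)) ?_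
    rw [hfour]
    filter_upwards [(𝓕 g).coeFn_toLp 2 (volume : Measure (Rn n))] with ξ hξ
    rw [hξ, Real.norm_of_nonneg (mul_nonneg (fracSymbol_nonneg _ _) (by positivity))]
    have h1 := fracSymbol_le_one_add H.s_pos H.s_le_one ξ
    have h2 : fracSymbol 1 ξ = (2 * Real.pi) ^ 2 * ‖ξ‖ ^ 2 := by
      rw [fracSymbol, mul_one, Real.rpow_two, mul_pow]
    rw [h2] at h1
    calc fracSymbol s ξ * ‖𝓕 g ξ‖ ^ 2
        ≤ (1 + (2 * Real.pi) ^ 2 * ‖ξ‖ ^ 2) * (M * ‖𝓕 g ξ‖) := by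
          rw [sq]
          gcongr
          exact hM' ξ
      _ = _ := by ring
  · have hc : Continuous fun x : Rn n => V ‖x‖ * b x ^ 2 :=
      (continuous_potential H.trapping).mul (hbc.continuous.pow 2)
    have hi : Integrable fun x : Rn n => V ‖x‖ * b x ^ 2 := by
      refine hc.integrable_of_hasCompactSupport (hb.mono fun x hx => ?_)
      rw [Function.mem_support] at hx ⊢
      intro h0
      exact hx (by rw [h0]; ring)
    refine hi.congr ?_
    filter_upwards [hf] with x hx
    rw [hx, hfb]
  · filter_upwards [hf] with x hx
    rw [hx, hfb]
    exact b.nonneg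
  · filter_upwards [hf] with x hx hxR
    rw [hx, hfb]
    exact b.one_of_mem_closedBall (Metric.ball_subset_closedBall hxR)

/-- The minimum of `f` and `g`, written with the absolute value. -/
noncomputable def latticeMin (f g : L2 n) : L2 n :=
  (1 / 2 : ℝ) • (f + g) + (-1 / 2 : ℝ) • |f - g|

theorem coeFn_latticeMin (f g : L2 n) : latticeMin f g =ᵐ[volume] fun x => min (f x) (g x) := by
  filter_upwards [Lp.coeFn_add ((1 / 2 : ℝ) • (f + g)) ((-1 / 2 : ℝ) • |f - g|),
    Lp.coeFn_smul (1 / 2 : ℝ) (f + g), Lp.coeFn_smul (-1 / 2 : ℝ) |f - g|, Lp.coeFn_add f g,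
    Lp.coeFn_abs (f - g), Lp.coeFn_sub f g] with x h1 h2 h3 h4 h5 h6
  rw [latticeMin, h1, Pi.add_apply, h2, h3, Pi.smul_apply, Pi.smul_apply, h4, h5, h6,
    Pi.add_apply, Pi.sub_apply, smul_eq_mul, smul_eq_mul]
  rcases le_total (f x) (g x) with h | h
  · rw [min_eq_left h, abs_of_nonpos (by linarith)]; ring
  · rw [min_eq_right h, abs_of_nonneg (by linarith)]; ring

/-- A nonnegative form that decreases under absolute values is submodular: truncating `f` by a
null vector `g` does not increase it. -/
theorem schrodForm_latticeMin_le (H : Admissible n s p V) {φ f g : L2 n} {c ω : ℝ}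
    (hφ : MemEnergySpace s V φ)
    (hpos : ∀ w, MemEnergySpace s V w → 0 ≤ schrodForm s p V φ c ω w w)
    (hf : MemEnergySpace s V f) (hg : MemEnergySpace s V g)
    (hg0 : schrodForm s p V φ c ω g g = 0) :
    schrodForm s p V φ c ω (latticeMin f g) (latticeMin f g) ≤ schrodForm s p V φ c ω f f := by
  have ha := hf.add H hg
  have hd := hf.sub H hg
  have hb := hd.abs H
  have h1 := schrodForm_add_smul_self H c ω (1 / 2) (-1 / 2) hφ ha hb
  have h2 := schrodForm_add_smul_self H c ω (1 / 2) (1 / 2) hφ ha hb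
  have h3 := schrodForm_abs_le H (φ := φ) c ω hd
  have h4 := schrodForm_add_smul_self H c ω 1 1 hφ hf hg
  have h5 := schrodForm_add_smul_self H c ω 1 (-1) hφ hf hg
  rw [one_smul, one_smul] at h4
  rw [one_smul, neg_one_smul, ← sub_eq_add_neg] at h5
  have h6 := hpos _ ((ha.smul (1 / 2)).add H (hb.smul (1 / 2)))
  rw [latticeMin, h1]
  linarith

theorem memEnergySpace_latticeMin (H : Admissible n s p V) {f g : L2 n}
    (hf : MemEnergySpace s V f) (hg : MemEnergySpace s V g) :
    MemEnergySpace s V (latticeMin f g) :=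
  ((hf.add H hg).smul _).add H (((hf.sub H hg).abs H).smul _)

/-- The restriction of `f` to the set where `θ` is positive. -/
noncomputable def restrictPos (θ f : L2 n) : L2 n :=
  ((Lp.memLp f).indicator (measurableSet_lt measurable_const (measurable_lp θ))).toLp
    ({x | 0 < θ x}.indicator f)

theorem coeFn_restrictPos (θ f : L2 n) :
    restrictPos θ f =ᵐ[volume] {x | 0 < θ x}.indicator f := MemLp.coeFn_toLp _

theorem tendsto_latticeMin {θ f : L2 n} (hθ : ∀ᵐ x, 0 ≤ θ x) (hf : ∀ᵐ x, 0 ≤ f x) :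
    Tendsto (fun k : ℕ => latticeMin f ((k : ℝ) • θ)) atTop (𝓝 (restrictPos θ f)) := by
  have hae : ∀ᵐ x, ∀ k : ℕ, (latticeMin f ((k : ℝ) • θ) - restrictPos θ f) x =
      min (f x) (k * θ x) - {x | 0 < θ x}.indicator f x := by
    rw [ae_all_iff]
    intro k
    filter_upwards [coeFn_latticeMin f ((k : ℝ) • θ), Lp.coeFn_smul (k : ℝ) θ,
      coeFn_restrictPos θ f, Lp.coeFn_sub (latticeMin f ((k : ℝ) • θ)) (restrictPos θ f)]
      with x h1 h2 h3 h4
    rw [h4, Pi.sub_apply, h1, h2, h3]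
    rfl
  have hlim : Tendsto (fun k : ℕ => ∫⁻ x, ‖(latticeMin f ((k : ℝ) • θ) - restrictPos θ f) x‖ₑ ^ 2)
      atTop (𝓝 (∫⁻ _ : Rn n, 0)) := by
    refine tendsto_lintegral_of_dominated_convergence (fun x => ‖f x‖ₑ ^ 2)
      (fun k => (measurable_lp _).enorm.pow_const 2) (fun k => ?_) ?_ ?_
    · filter_upwards [hae, hθ, hf] with x h1 h2 h3
      rw [h1 k]
      gcongr
      rw [← ofReal_norm, ← ofReal_norm]
      refine ENNReal.ofReal_le_ofReal ?_
      rw [Real.norm_eq_abs, Real.norm_of_nonneg h3, abs_le]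
      have hk : 0 ≤ (k : ℝ) * θ x := by positivity
      have h4 : 0 ≤ min (f x) (k * θ x) := le_min h3 hk
      have h5 := min_le_left (f x) (k * θ x)
      by_cases hx : 0 < θ x
      · rw [Set.indicator_of_mem (show x ∈ {x | 0 < θ x} from hx)]
        constructor <;> linarith
      · rw [Set.indicator_of_notMem (show x ∉ {x | 0 < θ x} from hx)]
        constructor <;> linarith
    · rw [lintegral_enorm_sq_eq]; exact ENNReal.ofReal_ne_top
    · filter_upwards [hae, hθ, hf] with x h1 h2 h3
      refine tendsto_const_nhds.congr' ?_
      by_cases hx : 0 < θ x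
      · filter_upwards [eventually_ge_atTop ⌈f x / θ x⌉₊] with k hk
        have h4 : f x ≤ k * θ x := by
          rw [← div_le_iff₀ hx]
          exact (Nat.le_ceil _).trans (by exact_mod_cast hk)
        rw [h1 k, min_eq_left h4, Set.indicator_of_mem (show x ∈ {x | 0 < θ x} from hx)]
        simp
      · have h4 : θ x = 0 := le_antisymm (not_lt.1 hx) h2
        filter_upwards with k
        rw [h1 k, h4, mul_zero, min_eq_right h3,
          Set.indicator_of_notMem (show x ∉ {x | 0 < θ x} from hx)]
        simp
  rw [lintegral_zero] at hlim
  rw [tendsto_iff_norm_sub_tendsto_zero]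
  have h1 := (ENNReal.tendsto_toReal ENNReal.zero_ne_top).comp hlim
  have h2 : Tendsto (fun k : ℕ => ‖latticeMin f ((k : ℝ) • θ) - restrictPos θ f‖ ^ 2) atTop
      (𝓝 0) := by
    refine h1.congr fun k => ?_
    rw [Function.comp, lintegral_enorm_sq_eq, ENNReal.toReal_ofReal (by positivity)]
  have h3 := h2.sqrt
  simpa [Real.sqrt_sq] using h3

/-- The positivity set of a nonnegative null vector `θ` of a nonnegative form is invariant: the
energy space is stable under restriction to it, because the truncations `min f (kθ)` have bounded
energy. -/
theorem memEnergySpace_restrictPos (H : Admissible n s p V) {φ θ f : L2 n} {c ω : ℝ}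
    (hc : 0 ≤ c) (hφ : MemEnergySpace s V φ)
    (hpos : ∀ w, MemEnergySpace s V w → 0 ≤ schrodForm s p V φ c ω w w)
    (hθ : MemEnergySpace s V θ) (hθ0 : ∀ᵐ x, 0 ≤ θ x) (hf : MemEnergySpace s V f)
    (hf0 : ∀ᵐ x, 0 ≤ f x) (hnull : schrodForm s p V φ c ω θ θ = 0) :
    MemEnergySpace s V (restrictPos θ f) := by
  obtain ⟨C, hC⟩ := exists_energy_le_schrodForm H hc ω hφ
  set b := 2 * schrodForm s p V φ c ω f f + |C| * ‖f‖ ^ 2 with hb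
  have hbound : ∀ k : ℕ, kinEnergy s (latticeMin f ((k : ℝ) • θ)) +
      potEnergy V (latticeMin f ((k : ℝ) • θ)) ≤ ENNReal.ofReal b := by
    intro k
    have hkθ := hθ.smul (k : ℝ)
    have hmem := memEnergySpace_latticeMin H hf hkθ
    have h1 := schrodForm_latticeMin_le H hφ hpos hf hkθ
      (by rw [schrodForm_smul_left, schrodForm_smul_right, hnull, mul_zero, mul_zero])
    have h2 : ‖latticeMin f ((k : ℝ) • θ)‖ ≤ ‖f‖ := by
      refine Lp.norm_le_norm_of_ae_le ?_
      filter_upwards [coeFn_latticeMin f ((k : ℝ) • θ), Lp.coeFn_smul (k : ℝ) θ, hθ0, hf0]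
        with x h1 h2 h3 h4
      rw [h1, h2, Pi.smul_apply, smul_eq_mul, Real.norm_of_nonneg h4,
        Real.norm_of_nonneg (le_min h4 (by positivity))]
      exact min_le_left _ _
    have h3 := hC _ hmem
    rw [← ENNReal.ofReal_toReal ((memEnergySpace_iff H.s_pos H.trapping).1 hmem).ne]
    refine ENNReal.ofReal_le_ofReal (h3.trans ?_)
    rw [hb]
    have h4 : C * ‖latticeMin f ((k : ℝ) • θ)‖ ^ 2 ≤ |C| * ‖f‖ ^ 2 := by
      calc _ ≤ |C| * ‖latticeMin f ((k : ℝ) • θ)‖ ^ 2 := by gcongr; exact le_abs_self C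
        _ ≤ _ := by gcongr
    linarith
  rw [memEnergySpace_iff H.s_pos H.trapping]
  have hcl : IsClosed {u : L2 n | kinEnergy s u + potEnergy V u ≤ ENNReal.ofReal b} :=
    lowerSemicontinuous_iff_isClosed_preimage.1 (lowerSemicontinuous_energy H.s_pos H.trapping) _
  exact (hcl.mem_of_tendsto (tendsto_latticeMin hθ0 hf0)
    (Eventually.of_forall hbound)).trans_lt ENNReal.ofReal_lt_top

/-- The part of the ball of radius `R` where membership in `A` changes under translation by `h`. -/
def shiftDiff (A : Set (Rn n)) (R : ℝ) (h : Rn n) : Set (Rn n) :=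
  {x | x ∈ Metric.ball (0 : Rn n) R ∧ ¬(x ∈ A ↔ x + h ∈ A)}

theorem shiftDiff_subset_iUnion (A : Set (Rn n)) (R : ℝ) (h : Rn n) {N : ℕ} (hN : 0 < N) :
    shiftDiff A R h ⊆ ⋃ j ∈ Finset.range N,
      (fun x => x + ((j : ℝ) / N) • h) ⁻¹' shiftDiff A (R + ‖h‖) ((N : ℝ)⁻¹ • h) := by
  rintro x ⟨hxR, hx⟩
  by_contra hcon
  simp only [Set.mem_iUnion, not_exists] at hcon
  have hN0 : (0 : ℝ) < N := by exact_mod_cast hN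
  have step : ∀ j : ℕ, j ≤ N → (x ∈ A ↔ x + ((j : ℝ) / N) • h ∈ A) := by
    intro j
    induction j with
    | zero => intro _; simp
    | succ j ih =>
      intro hj
      have h1 := hcon j (Finset.mem_range.2 (by omega))
      have hball : x + ((j : ℝ) / N) • h ∈ Metric.ball (0 : Rn n) (R + ‖h‖) := by
        rw [mem_ball_zero_iff] at hxR ⊢
        refine (norm_add_le _ _).trans_lt ?_
        have : ‖((j : ℝ) / N) • h‖ ≤ ‖h‖ := by
          rw [norm_smul, Real.norm_of_nonneg (by positivity)]
          refine mul_le_of_le_one_left (norm_nonneg _) ?_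
          rw [div_le_one hN0]
          exact_mod_cast (by omega : j ≤ N)
        linarith
      have h2 : x + ((j : ℝ) / N) • h ∈ A ↔ x + ((j : ℝ) / N) • h + (N : ℝ)⁻¹ • h ∈ A := by
        by_contra h3
        exact h1 ⟨hball, h3⟩
      rw [ih (by omega), h2, add_assoc, ← add_smul]
      have : (j : ℝ) / N + (N : ℝ)⁻¹ = ((j + 1 : ℕ) : ℝ) / N := by push_cast; ring
      rw [this]
  refine hx ?_
  have := step N le_rfl
  rwa [div_self hN0.ne', one_smul] at this

/-- If small translations change `A` inside every ball by a set of quadratically small measure,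
then subdividing a translation into `N` equal steps shows that no translation changes `A`. -/
theorem volume_shiftDiff_eq_zero {A : Set (Rn n)}
    (hA : ∀ R : ℝ, 0 < R → ∃ K : ℝ, 0 ≤ K ∧ ∀ h : Rn n, ‖h‖ ≤ R →
      volume (shiftDiff A R h) ≤ ENNReal.ofReal (K * ‖h‖ ^ 2)) {R : ℝ} (hR : 0 < R) (h : Rn n) :
    volume (shiftDiff A R h) = 0 := by
  obtain ⟨K, hK0, hK⟩ := hA (R + ‖h‖) (by positivity)
  have hle : ∀ N : ℕ, 0 < N → volume (shiftDiff A R h) ≤ ENNReal.ofReal (K * ‖h‖ ^ 2 / N) := by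
    intro N hN
    have hN0 : (0 : ℝ) < N := by exact_mod_cast hN
    have hN1 : (1 : ℝ) ≤ N := by exact_mod_cast hN
    have hnorm : ‖(N : ℝ)⁻¹ • h‖ = ‖h‖ / N := by
      rw [norm_smul, norm_inv, Real.norm_of_nonneg hN0.le, inv_mul_eq_div]
    have hsmall := hK ((N : ℝ)⁻¹ • h) (by
      rw [hnorm]
      have : ‖h‖ / N ≤ ‖h‖ := div_le_self (norm_nonneg _) hN1
      linarith)
    calc volume (shiftDiff A R h)
        ≤ ∑ j ∈ Finset.range N, volume ((fun x => x + ((j : ℝ) / N) • h) ⁻¹'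
            shiftDiff A (R + ‖h‖) ((N : ℝ)⁻¹ • h)) :=
          (measure_mono (shiftDiff_subset_iUnion A R h hN)).trans
            (measure_biUnion_finset_le _ _)
      _ = ∑ j ∈ Finset.range N, volume (shiftDiff A (R + ‖h‖) ((N : ℝ)⁻¹ • h)) := by
          refine Finset.sum_congr rfl fun j _ => ?_
          exact measure_preimage_add_right _ _ _
      _ ≤ ∑ j ∈ Finset.range N, ENNReal.ofReal (K * ‖(N : ℝ)⁻¹ • h‖ ^ 2) :=
          Finset.sum_le_sum fun _ _ => hsmall
      _ = ENNReal.ofReal (K * ‖h‖ ^ 2 / N) := by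
          rw [Finset.sum_const, Finset.card_range, nsmul_eq_mul, hnorm, ← ENNReal.ofReal_natCast,
            ← ENNReal.ofReal_mul hN0.le]
          congr 1
          field_simp
  have hlim : Tendsto (fun N : ℕ => ENNReal.ofReal (K * ‖h‖ ^ 2 / N)) atTop (𝓝 0) := by
    have := ENNReal.tendsto_ofReal (tendsto_const_div_atTop_nhds_zero_nat (K * ‖h‖ ^ 2))
    simpa using this
  refine le_antisymm (ge_of_tendsto hlim ?_) zero_le
  filter_upwards [eventually_gt_atTop 0] with N hN using hle N hN

/-- The strong maximum principle in the local case: a nonnegative null vector of a nonnegative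
form vanishes identically or is positive almost everywhere. -/
theorem eq_zero_or_pos_of_null {φ θ : L2 n} (H : Admissible n 1 p V) {c ω : ℝ} (hc : 0 ≤ c)
    (hφ : MemEnergySpace 1 V φ)
    (hpos : ∀ w, MemEnergySpace 1 V w → 0 ≤ schrodForm 1 p V φ c ω w w)
    (hθ : MemEnergySpace 1 V θ) (hθ0 : ∀ᵐ x, 0 ≤ θ x)
    (hnull : schrodForm 1 p V φ c ω θ θ = 0) : θ = 0 ∨ ∀ᵐ x, 0 < θ x := by
  set A : Set (Rn n) := {x | 0 < θ x} with hA
  have hAm : MeasurableSet A := measurableSet_lt measurable_const (measurable_lp θ)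
  have hquad : ∀ R : ℝ, 0 < R → ∃ K : ℝ, 0 ≤ K ∧ ∀ h : Rn n, ‖h‖ ≤ R →
      volume (shiftDiff A R h) ≤ ENNReal.ofReal (K * ‖h‖ ^ 2) := by
    intro R hR
    obtain ⟨f, hf, hf0, hf1⟩ := exists_cutoff H (by linarith : 0 < 2 * R)
    have hF := memEnergySpace_restrictPos H hc hφ hpos hθ hθ0 hf hf0 hnull
    set F := restrictPos θ f with hFdef
    have hFA : ∀ᵐ x : Rn n, x ∈ Metric.ball (0 : Rn n) (2 * R) →
        F x = A.indicator (fun _ => 1) x := by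
      filter_upwards [coeFn_restrictPos θ f, hf1] with x h1 h2 h3
      rw [h1]
      by_cases hx : x ∈ A
      · rw [Set.indicator_of_mem hx, Set.indicator_of_mem hx, h2 h3]
      · rw [Set.indicator_of_notMem hx, Set.indicator_of_notMem hx]
    refine ⟨4 * (kinEnergy 1 F).toReal, by positivity, fun h hh => ?_⟩
    have hDm : MeasurableSet (shiftDiff A R h) := by
      have h2 : MeasurableSet ((fun x => x + h) ⁻¹' A) := measurable_add_const h hAm
      have : shiftDiff A R h = Metric.ball 0 R ∩ (A \ ((fun x => x + h) ⁻¹' A) ∪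
          ((fun x => x + h) ⁻¹' A) \ A) := by
        ext x
        simp only [shiftDiff, Set.mem_ofPred_eq, Set.mem_inter_iff, Set.mem_union, Set.mem_sdiff,
          Set.mem_preimage]
        tauto
      rw [this]
      exact measurableSet_ball.inter ((hAm.diff h2).union (h2.diff hAm))
    calc volume (shiftDiff A R h) = ∫⁻ _ in shiftDiff A R h, 1 := by simp
      _ ≤ ∫⁻ x in shiftDiff A R h, ‖F (x + h) - F x‖ₑ ^ 2 := by
        refine setLIntegral_mono_ae' hDm ?_
        filter_upwards [hFA, ae_shift hFA h] with x h1 h2 hx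
        obtain ⟨hxR, hxA⟩ := hx
        rw [mem_ball_zero_iff] at hxR
        rw [h1 (by rw [mem_ball_zero_iff]; linarith),
          h2 (by rw [mem_ball_zero_iff]; exact (norm_add_le _ _).trans_lt (by linarith))]
        by_cases hxA' : x ∈ A
        · have : x + h ∉ A := fun h3 => hxA ⟨fun _ => h3, fun _ => hxA'⟩
          simp [hxA', this]
        · have : x + h ∈ A := by
            by_contra h3
            exact hxA ⟨fun h4 => absurd h4 hxA', fun h4 => absurd h4 h3⟩
          simp [hxA', this]
      _ ≤ shiftEnergy h F := setLIntegral_le_lintegral _ _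
      _ ≤ ENNReal.ofReal (4 * ‖h‖ ^ (2 * (1 : ℝ))) * kinEnergy 1 F :=
        shiftEnergy_le one_pos le_rfl h F
      _ = ENNReal.ofReal (4 * (kinEnergy 1 F).toReal * ‖h‖ ^ 2) := by
        rw [mul_one, Real.rpow_two, ← ENNReal.ofReal_toReal (hF.kinEnergy_ne_top H),
          ← ENNReal.ofReal_mul (by positivity), ENNReal.toReal_ofReal ENNReal.toReal_nonneg]
        congr 1
        ring
  have hinv : ∀ h : Rn n, ∀ᵐ x : Rn n, (x ∈ A ↔ x + h ∈ A) := by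
    intro h
    have h1 : ∀ k : ℕ, ∀ᵐ x : Rn n, x ∉ shiftDiff A (k + 1) h := fun k =>
      measure_eq_zero_iff_ae_notMem.1 (volume_shiftDiff_eq_zero hquad (by positivity) h)
    filter_upwards [ae_all_iff.2 h1] with x hx
    by_contra h2
    obtain ⟨k, hk⟩ := exists_nat_gt ‖x‖
    exact hx k ⟨by rw [mem_ball_zero_iff]; linarith, h2⟩
  have hdis : ∀ᵐ h : Rn n, ∀ᵐ x : Rn n,
      A.indicator (fun _ => (1 : ℝ≥0∞)) (x + h) * Aᶜ.indicator (fun _ => (1 : ℝ≥0∞)) x = 0 := by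
    refine Eventually.of_forall fun h => ?_
    filter_upwards [hinv h] with x hx
    by_cases h1 : x ∈ A
    · simp [h1]
    · have h2 : x + h ∉ A := fun h3 => h1 (hx.2 h3)
      simp [h2]
  refine (ae_eq_zero_of_translates_disjoint (measurable_const.indicator hAm)
    (measurable_const.indicator hAm.compl) hdis).imp (fun h => ?_) (fun h => ?_)
  · rw [Lp.eq_zero_iff_ae_eq_zero]
    filter_upwards [h, hθ0] with x h1 h2
    have h3 : x ∉ A := fun h4 => by simp [h4] at h1
    exact le_antisymm (not_lt.1 h3) h2
  · filter_upwards [h] with x h1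
    by_contra h3
    have h4 : x ∈ Aᶜ := h3
    simp [h4] at h1

/-- Two nonnegative functions with disjoint supports, one of them a null vector of a nonnegative
form, cannot both be nonzero. -/
theorem eq_zero_of_disjoint_null (H : Admissible n s p V) {φ u v : L2 n} {c ω : ℝ}
    (hc : 0 ≤ c) (hφ : MemEnergySpace s V φ)
    (hpos : ∀ w, MemEnergySpace s V w → 0 ≤ schrodForm s p V φ c ω w w)
    (hu : MemEnergySpace s V u) (hv : MemEnergySpace s V v) (hu0 : ∀ᵐ x, 0 ≤ u x)
    (hv0 : ∀ᵐ x, 0 ≤ v x) (huv : ∀ᵐ x, u x * v x = 0)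
    (hnull : schrodForm s p V φ c ω u u = 0) : u = 0 ∨ v = 0 := by
  rcases H.s_le_one.lt_or_eq with hs | rfl
  · refine eq_zero_of_kineticForm_eq_zero H hs hu hv hu0 hv0 huv ?_
    have h0 := schrodForm_eq_zero_of_null H hφ ⊤ (fun w _ hw => hpos w hw) trivial hu trivial hv
      hnull
    have h1 : potentialForm V u v = 0 := integral_eq_zero_of_ae (by
      filter_upwards [huv] with x hx; simp [hx])
    have h2 : nonlinForm p φ u v = 0 := integral_eq_zero_of_ae (by
      filter_upwards [huv] with x hx; simp [hx])
    have h3 : ⟪u, v⟫_ℝ = 0 := by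
      rw [L2.inner_def]
      refine integral_eq_zero_of_ae ?_
      filter_upwards [huv] with x hx
      simpa [mul_comm] using hx
    rw [schrodForm, h1, h2, h3] at h0
    linarith
  · refine (eq_zero_or_pos_of_null H hc hφ hpos hu hu0 hnull).imp_right fun h => ?_
    rw [Lp.eq_zero_iff_ae_eq_zero]
    filter_upwards [h, huv] with x h1 h2
    exact (mul_eq_zero.1 h2).resolve_left h1.ne'

end Irreducibility

/-! ### Spectral properties of `L₊` and `L₋` -/

section GroundState

variable {s p : ℝ} {V : ℝ → ℝ}

theorem ae_mul_eq_zero_of_inner_eq_zero {u v : L2 n} (hu : ∀ᵐ x, 0 ≤ u x)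
    (hv : ∀ᵐ x, 0 ≤ v x) (h : ⟪u, v⟫_ℝ = 0) : ∀ᵐ x, u x * v x = 0 := by
  have hi : Integrable fun x => ⟪u x, v x⟫_ℝ := L2.integrable_inner u v
  rw [L2.inner_def, integral_eq_zero_iff_of_nonneg_ae (by
    filter_upwards [hu, hv] with x h1 h2
    simpa using mul_nonneg h2 h1) hi] at h
  filter_upwards [h] with x hx
  simpa [mul_comm] using hx

theorem abs_nonneg_ae (u : L2 n) : ∀ᵐ x, 0 ≤ |u| x := by
  filter_upwards [Lp.coeFn_abs u] with x hx
  rw [hx]; exact abs_nonneg _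

theorem abs_eq_zero_lp {u : L2 n} (h : |u| = 0) : u = 0 := by
  rw [← norm_eq_zero, ← norm_abs_eq_norm, h, norm_zero]

theorem nonlinForm_abs_left (p : ℝ) (φ u v : L2 n) :
    nonlinForm p |φ| u v = nonlinForm p φ u v := by
  refine integral_congr_ae ?_
  filter_upwards [Lp.coeFn_abs φ] with x h1
  rw [h1, abs_abs]

theorem integral_abs_rpow_abs (q : ℝ) (φ : L2 n) :
    ∫ x, |(|φ| : L2 n) x| ^ q = ∫ x, |φ x| ^ q := by
  refine integral_congr_ae ?_
  filter_upwards [Lp.coeFn_abs φ] with x h1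
  rw [h1, abs_abs]

theorem potentialForm_abs (V : ℝ → ℝ) (u : L2 n) :
    potentialForm V |u| |u| = potentialForm V u u := by
  refine integral_congr_ae ?_
  filter_upwards [Lp.coeFn_abs u] with x h1
  rw [h1, abs_mul_abs_self]

theorem kineticForm_abs_le (H : Admissible n s p V) {u : L2 n} (hu : MemEnergySpace s V u) :
    kineticForm s |u| |u| ≤ kineticForm s u u := by
  rw [kineticForm_self H.s_pos, kineticForm_self H.s_pos]
  exact ENNReal.toReal_mono (hu.kinEnergy_ne_top H)
    (kinEnergy_abs_le H.one_le_dim H.s_pos H.s_le_one u)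

theorem integral_abs_sq (u : L2 n) : ∫ x, (|u| : L2 n) x ^ 2 = ∫ x, u x ^ 2 := by
  rw [← norm_sq_eq_integral, ← norm_sq_eq_integral, norm_abs_eq_norm]

theorem energy_abs (H : Admissible n s p V) {u : L2 n} (hu : MemEnergySpace s V u) :
    energy s p V |u| ≤ energy s p V u := by
  rw [energy, energy, potentialForm_abs, integral_abs_rpow_abs]
  linarith [kineticForm_abs_le H hu]

/-- The absolute value of a ground state is a ground state. -/
theorem IsNormalizedWave.abs (H : Admissible n s p V) {lam : ℝ} {φ : L2 n}
    (hφ : IsNormalizedWave s p V lam φ) : IsNormalizedWave s p V lam |φ| where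
  mem := hφ.mem.abs H
  mass := by rw [integral_abs_sq, hφ.mass]
  minimal u hu hm := (energy_abs H hφ.mem).trans (hφ.minimal u hu hm)

/-- The kinetic energies of `|φ|` and `φ` agree by minimality, hence so do the multipliers. -/
theorem multiplier_abs (H : Admissible n s p V) {lam : ℝ} {φ : L2 n}
    (hφ : IsNormalizedWave s p V lam φ) : multiplier s p V |φ| = multiplier s p V φ := by
  have h1 := hφ.minimal _ (hφ.mem.abs H) (hφ.abs H).mass
  rw [energy, energy, potentialForm_abs, integral_abs_rpow_abs] at h1
  have h2 : kineticForm s |φ| |φ| = kineticForm s φ φ :=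
    le_antisymm (kineticForm_abs_le H hφ.mem) (by linarith)
  rw [multiplier, multiplier, h2, potentialForm_abs, integral_abs_rpow_abs, integral_abs_sq]

theorem formMinus_abs_eq_zero (H : Admissible n s p V) {lam : ℝ} (hlam : 0 < lam)
    {φ v : L2 n} (hφ : IsNormalizedWave s p V lam φ) (hv : MemEnergySpace s V v) :
    formMinus s p V φ |φ| v = 0 := by
  have h := formMinus_eq_zero H hlam (hφ.abs H) hv
  rw [formMinus, linForm_eq, schrodForm, nonlinForm_abs_left, multiplier_abs H hφ] at h
  exact h

theorem IsNormalizedWave.ne_zero {lam : ℝ} (hlam : 0 < lam) {φ : L2 n}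
    (hφ : IsNormalizedWave s p V lam φ) : φ ≠ 0 := by
  rintro rfl
  have := inner_self_eq_mass hφ
  rw [inner_zero_left] at this
  exact hlam.ne this

theorem schrodForm_shift (φ : L2 n) (c ω E : ℝ) (u v : L2 n) :
    schrodForm s p V φ c (ω - E) u v = schrodForm s p V φ c ω u v - E * ⟪u, v⟫_ℝ := by
  rw [schrodForm, schrodForm]; ring

/-- The minimum of the form on the unit sphere, written as the nonnegativity of the form shifted
by the bottom `E` of the spectrum together with a normalized null vector. -/
theorem exists_bottom (H : Admissible n s p V) {φ : L2 n} {c : ℝ} (hc : 0 ≤ c) (ω : ℝ)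
    (hφ : MemEnergySpace s V φ) (hφ0 : φ ≠ 0) :
    ∃ (E : ℝ) (w : L2 n), MemEnergySpace s V w ∧ ‖w‖ = 1 ∧
      schrodForm s p V φ c (ω - E) w w = 0 ∧
      ∀ v, MemEnergySpace s V v → 0 ≤ schrodForm s p V φ c (ω - E) v v := by
  obtain ⟨w, -, hw, hw1, hmin⟩ := exists_isMin_schrodForm H hc ω hφ ⊤ isClosed_univ
    ⟨φ, trivial, hφ, hφ0⟩
  refine ⟨schrodForm s p V φ c ω w w, w, hw, hw1, ?_, fun v hv => ?_⟩
  · rw [schrodForm_shift, real_inner_self_eq_norm_sq, hw1]; ring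
  · rw [schrodForm_shift, real_inner_self_eq_norm_sq]
    linarith [hmin v trivial hv]

theorem schrodForm_abs_null (H : Admissible n s p V) {φ w : L2 n} {c ω : ℝ}
    (hpos : ∀ v, MemEnergySpace s V v → 0 ≤ schrodForm s p V φ c ω v v)
    (hw : MemEnergySpace s V w) (hnull : schrodForm s p V φ c ω w w = 0) :
    schrodForm s p V φ c ω |w| |w| = 0 :=
  le_antisymm ((schrodForm_abs_le H c ω hw).trans hnull.le) (hpos _ (hw.abs H))

/-- `L₋ ≥ 0`: otherwise the positive eigenfunction at the bottom of the spectrum and the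
null vector `|φ|` are orthogonal nonnegative functions. -/
theorem formMinus_nonneg (H : Admissible n s p V) {lam : ℝ} (hlam : 0 < lam)
    {φ h : L2 n} (hφ : IsNormalizedWave s p V lam φ) (hh : MemEnergySpace s V h) :
    0 ≤ formMinus s p V φ h h := by
  have hφ0 := hφ.ne_zero hlam
  obtain ⟨E, w, hw, hw1, hnull, hpos⟩ := exists_bottom H zero_le_one (multiplier s p V φ)
    hφ.mem hφ0
  have hE : 0 ≤ E := by
    by_contra hneg
    have hnull' := schrodForm_abs_null H hpos hw hnull
    have h1 := schrodForm_eq_zero_of_null H hφ.mem ⊤ (fun v _ hv => hpos v hv) trivial (hw.abs H)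
      trivial (hφ.mem.abs H) hnull'
    have h2 := formMinus_abs_eq_zero H hlam hφ (hw.abs H)
    rw [formMinus, linForm_eq, schrodForm_comm] at h2
    rw [schrodForm_shift, h2, zero_sub, neg_eq_zero, mul_eq_zero] at h1
    have h3 : ⟪|w|, |φ|⟫_ℝ = 0 := h1.resolve_left (by intro h0; rw [h0] at hneg; simp at hneg)
    have h4 := ae_mul_eq_zero_of_inner_eq_zero (abs_nonneg_ae w) (abs_nonneg_ae φ) h3
    rcases eq_zero_of_disjoint_null H zero_le_one hφ.mem hpos (hw.abs H) (hφ.mem.abs H)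
      (abs_nonneg_ae w) (abs_nonneg_ae φ) h4 hnull' with h5 | h5
    · rw [abs_eq_zero_lp h5] at hw1
      simp at hw1
    · exact hφ0 (abs_eq_zero_lp h5)
  have h1 := hpos h hh
  rw [schrodForm_shift, real_inner_self_eq_norm_sq] at h1
  rw [formMinus, linForm_eq]
  nlinarith [sq_nonneg ‖h‖]

/-- Null vectors of a nonnegative form have a constant sign. -/
theorem eq_abs_or_eq_neg_abs_of_null (H : Admissible n s p V) {φ w : L2 n} {c ω : ℝ}
    (hc : 0 ≤ c) (hφ : MemEnergySpace s V φ)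
    (hpos : ∀ v, MemEnergySpace s V v → 0 ≤ schrodForm s p V φ c ω v v)
    (hw : MemEnergySpace s V w) (hnull : schrodForm s p V φ c ω w w = 0) :
    w = |w| ∨ w = -|w| := by
  have hwa := hw.abs H
  have h1 := schrodForm_abs_null H hpos hw hnull
  have h2 := schrodForm_eq_zero_of_null H hφ ⊤ (fun v _ hv => hpos v hv) trivial hwa trivial hw h1
  have hp := schrodForm_add_smul_self H c ω 2⁻¹ 2⁻¹ hφ hwa hw
  simp only [h1, h2, hnull, mul_zero, add_zero] at hp
  have hcoe : ∀ᵐ x, ((2⁻¹ : ℝ) • |w| + (2⁻¹ : ℝ) • w) x = (|w x| + w x) / 2 ∧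
      ((2⁻¹ : ℝ) • |w| + (-2⁻¹ : ℝ) • w) x = (|w x| - w x) / 2 := by
    filter_upwards [Lp.coeFn_add ((2⁻¹ : ℝ) • |w|) ((2⁻¹ : ℝ) • w),
      Lp.coeFn_add ((2⁻¹ : ℝ) • |w|) ((-2⁻¹ : ℝ) • w), Lp.coeFn_smul (2⁻¹ : ℝ) |w|,
      Lp.coeFn_smul (2⁻¹ : ℝ) w, Lp.coeFn_smul (-2⁻¹ : ℝ) w, Lp.coeFn_abs w]
      with x h1 h2 h3 h4 h5 h6
    rw [h1, h2, Pi.add_apply, Pi.add_apply, h3, h4, h5, Pi.smul_apply, Pi.smul_apply,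
      Pi.smul_apply, h6]
    simp only [smul_eq_mul]
    constructor <;> ring
  rcases eq_zero_of_disjoint_null H hc hφ hpos ((hwa.smul 2⁻¹).add H (hw.smul 2⁻¹))
    ((hwa.smul 2⁻¹).add H (hw.smul (-2⁻¹)))
    (by filter_upwards [hcoe] with x hx; rw [hx.1]; linarith [neg_abs_le (w x)])
    (by filter_upwards [hcoe] with x hx; rw [hx.2]; linarith [le_abs_self (w x)])
    (by
      filter_upwards [hcoe] with x hx
      rw [hx.1, hx.2]
      nlinarith [abs_mul_abs_self (w x)]) hp with h3 | h3
  · right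
    rw [← smul_add, smul_eq_zero] at h3
    rw [add_comm] at h3
    exact eq_neg_of_add_eq_zero_left (h3.resolve_left (by norm_num))
  · left
    rw [neg_smul, ← sub_eq_add_neg, ← smul_sub, smul_eq_zero] at h3
    exact (sub_eq_zero.1 (h3.resolve_left (by norm_num))).symm

/-- The null space of `L₋` meets the orthogonal complement of `φ` trivially. -/
theorem eq_zero_of_formMinus_null (H : Admissible n s p V) {lam : ℝ} (hlam : 0 < lam)
    {φ w : L2 n} (hφ : IsNormalizedWave s p V lam φ) (hw : MemEnergySpace s V w)
    (horth : ⟪φ, w⟫_ℝ = 0) (hnull : formMinus s p V φ w w = 0) : w = 0 := by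
  have hpos : ∀ v, MemEnergySpace s V v →
      0 ≤ schrodForm s p V φ 1 (multiplier s p V φ) v v := fun v hv =>
    formMinus_nonneg H hlam hφ hv
  have h1 := eq_abs_or_eq_neg_abs_of_null H zero_le_one hφ.mem hpos hw hnull
  have h2 := eq_abs_or_eq_neg_abs_of_null H zero_le_one hφ.mem hpos hφ.mem
    (formMinus_self H hlam hφ)
  have h3 : ⟪|w|, |φ|⟫_ℝ = 0 := by
    rw [real_inner_comm]
    rcases h1 with h1 | h1 <;> rcases h2 with h2 | h2 <;> rw [h1, h2] at horth <;>
      simpa using horth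
  rcases eq_zero_of_disjoint_null H zero_le_one hφ.mem hpos (hw.abs H) (hφ.mem.abs H)
    (abs_nonneg_ae w) (abs_nonneg_ae φ)
    (ae_mul_eq_zero_of_inner_eq_zero (abs_nonneg_ae w) (abs_nonneg_ae φ) h3)
    (schrodForm_abs_null H hpos hw hnull) with h5 | h5
  · exact abs_eq_zero_lp h5
  · exact absurd (abs_eq_zero_lp h5) (hφ.ne_zero hlam)

/-- The spectral gap of `L₋`: its form attains its minimum over the unit sphere of the orthogonal
complement of `φ`, and the minimum is positive because a minimizer with value zero would be a null
vector orthogonal to `φ`. -/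
theorem exists_gap (H : Admissible n s p V) {lam : ℝ} (hlam : 0 < lam)
    {φ : L2 n} (hφ : IsNormalizedWave s p V lam φ) :
    ∃ δ : ℝ, 0 < δ ∧ ∀ h : L2 n, MemEnergySpace s V h → ⟪φ, h⟫_ℝ = 0 →
      δ * ‖h‖ ^ 2 ≤ formMinus s p V φ h h := by
  have hS : ∀ h : L2 n, h ∈ (ℝ ∙ φ)ᗮ ↔ ⟪φ, h⟫_ℝ = 0 := fun h =>
    Submodule.mem_orthogonal_singleton_iff_inner_right
  by_cases hne : ∃ v ∈ (ℝ ∙ φ)ᗮ, MemEnergySpace s V v ∧ v ≠ 0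
  · obtain ⟨u, huS, hu, hu1, hmin⟩ := exists_isMin_schrodForm H zero_le_one (multiplier s p V φ)
      hφ.mem (ℝ ∙ φ)ᗮ (Submodule.isClosed_orthogonal _) hne
    refine ⟨schrodForm s p V φ 1 (multiplier s p V φ) u u, ?_, fun h hh horth =>
      hmin h ((hS h).2 horth) hh⟩
    refine lt_of_le_of_ne (formMinus_nonneg H hlam hφ hu) fun h0 => ?_
    have := eq_zero_of_formMinus_null H hlam hφ hu ((hS u).1 huS) h0.symm
    rw [this] at hu1
    simp at hu1
  · push Not at hne
    refine ⟨1, one_pos, fun h hh horth => ?_⟩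
    have := hne h ((hS h).2 horth) hh
    rw [this, formMinus, linForm_eq, schrodForm_zero_left]
    simp

/-- `⟨L₊ φ, φ⟩ = (1 - p) ∫ |φ|^{p+1} < 0`, since `⟨L₋ φ, φ⟩ = 0`. -/
theorem formPlus_self_neg (H : Admissible n s p V) {lam : ℝ} (hlam : 0 < lam)
    {φ : L2 n} (hφ : IsNormalizedWave s p V lam φ) : formPlus s p V φ φ φ < 0 := by
  have h1 := formMinus_self H hlam hφ
  have h2 : 0 < nonlinForm p φ φ φ := by
    refine lt_of_le_of_ne (nonlinForm_self_nonneg p φ φ) fun h0 => ?_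
    rw [nonlinForm_self_self H.one_lt_p, eq_comm, integral_eq_zero_iff_of_nonneg_ae
      (Eventually.of_forall fun x => by positivity) (hφ.mem.integrable_rpow H)] at h0
    refine hφ.ne_zero hlam ?_
    rw [Lp.eq_zero_iff_ae_eq_zero]
    filter_upwards [h0] with x hx
    have hp : p + 1 ≠ 0 := by have := H.one_lt_p; linarith
    simpa using (Real.rpow_eq_zero (abs_nonneg _) hp).1 hx
  rw [formMinus, linForm_eq, schrodForm] at h1
  rw [formPlus, linForm_eq, schrodForm]
  nlinarith [H.one_lt_p]

/-- If `ψ` in the kernel of `L₊` were not orthogonal to `φ`, subtracting a multiple of `ψ` from `φ`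
would give a vector orthogonal to `φ` with the same, negative, value of the form. -/
theorem inner_eq_zero_of_kernel (H : Admissible n s p V) {lam : ℝ} (hlam : 0 < lam)
    {φ ψ : L2 n} (hφ : IsNormalizedWave s p V lam φ) (hψ : LPlus s p V φ ψ 0) :
    ⟪φ, ψ⟫_ℝ = 0 := by
  by_contra hne
  obtain ⟨hψX, hψ0⟩ := hψ
  simp only [inner_zero_left] at hψ0
  -- the multiple of `ψ` that makes `φ - r ψ` orthogonal to `φ`
  set r := ⟪φ, φ⟫_ℝ / ⟪φ, ψ⟫_ℝ with hr
  have h1 : ⟪φ, (1 : ℝ) • φ + (-r) • ψ⟫_ℝ = 0 := by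
    rw [inner_add_right, real_inner_smul_right, real_inner_smul_right, hr, neg_mul,
      div_mul_cancel₀ _ hne]
    ring
  have h2 := formPlus_nonneg_of_orthogonal H hlam hφ
    ((hφ.mem.smul 1).add H (hψX.smul (-r))) h1
  have h3 := hψ0 ψ hψX
  have h4 := hψ0 φ hφ.mem
  have h5 := formPlus_self_neg H hlam hφ
  rw [formPlus, linForm_eq] at h2 h3 h4 h5
  rw [schrodForm_comm] at h4
  rw [schrodForm_add_smul_self H _ _ _ _ hφ.mem hφ.mem hψX, h3, h4] at h2
  linarith

/-- The negative eigenvalue of `L₊` is the bottom of its spectrum. A second negative eigenvector would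
produce a two-dimensional space on which the form is negative, and this space would contain a vector
orthogonal to `φ`. -/
theorem exists_simple_negative_eigenvalue (H : Admissible n s p V) {lam : ℝ} (hlam : 0 < lam)
    {φ : L2 n} (hφ : IsNormalizedWave s p V lam φ) :
    ∃ μ : ℝ, μ < 0 ∧ ∃ ψ : L2 n, ψ ≠ 0 ∧ LPlus s p V φ ψ (μ • ψ) ∧
      ∀ ν : ℝ, ν < 0 → ∀ χ : L2 n, χ ≠ 0 → LPlus s p V φ χ (ν • χ) →
        ν = μ ∧ χ ∈ Submodule.span ℝ {ψ} := by
  have hp0 : 0 ≤ p := by have := H.one_lt_p; linarith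
  obtain ⟨μ, ψ, hψ, hψ1, hnull, hpos⟩ := exists_bottom H hp0 (multiplier s p V φ) hφ.mem
    (hφ.ne_zero hlam)
  have hψ0 : ψ ≠ 0 := by rw [← norm_ne_zero_iff, hψ1]; exact one_ne_zero
  have hμ : μ < 0 := by
    have h1 := hpos φ hφ.mem
    have h2 := formPlus_self_neg H hlam hφ
    rw [schrodForm_shift, inner_self_eq_mass hφ] at h1
    rw [formPlus, linForm_eq] at h2
    by_contra h3
    nlinarith [mul_nonneg (not_lt.1 h3) hlam.le]
  have heig : ∀ v, MemEnergySpace s V v →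
      schrodForm s p V φ p (multiplier s p V φ) ψ v = μ * ⟪ψ, v⟫_ℝ := by
    intro v hv
    have := schrodForm_eq_zero_of_null H hφ.mem ⊤ (fun v _ hv => hpos v hv) trivial hψ trivial hv
      hnull
    rw [schrodForm_shift] at this
    linarith
  refine ⟨μ, hμ, ψ, hψ0, ⟨hψ, fun v hv => ?_⟩, ?_⟩
  · rw [real_inner_smul_left]
    exact heig v hv
  rintro ν hν χ hχ0 ⟨hχ, hχeig⟩
  have heig' : ∀ v, MemEnergySpace s V v →
      schrodForm s p V φ p (multiplier s p V φ) χ v = ν * ⟪χ, v⟫_ℝ := by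
    intro v hv
    rw [← real_inner_smul_left]
    exact hχeig v hv
  have hψψ : ⟪ψ, ψ⟫_ℝ = 1 := by rw [real_inner_self_eq_norm_sq, hψ1, one_pow]
  have hχχ : 0 < ⟪χ, χ⟫_ℝ := real_inner_self_pos.2 hχ0
  have hφψ : ⟪φ, ψ⟫_ℝ ≠ 0 := by
    intro h0
    have := formPlus_nonneg_of_orthogonal H hlam hφ hψ h0
    rw [formPlus, linForm_eq, heig ψ hψ, hψψ] at this
    linarith
  -- the combination of the two eigenfunctions that is orthogonal to `φ`
  set a := ⟪φ, χ⟫_ℝ with ha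
  set b := -⟪φ, ψ⟫_ℝ with hb
  have hb0 : b ≠ 0 := neg_ne_zero.2 hφψ
  have horth : ⟪φ, a • ψ + b • χ⟫_ℝ = 0 := by
    rw [inner_add_right, real_inner_smul_right, real_inner_smul_right]
    rw [← ha, hb]; ring
  have hQ := formPlus_nonneg_of_orthogonal H hlam hφ ((hψ.smul a).add H (hχ.smul b)) horth
  rw [formPlus, linForm_eq, schrodForm_add_smul_self H _ _ _ _ hφ.mem hψ hχ, heig ψ hψ,
    heig χ hχ, heig' χ hχ, hψψ] at hQ
  have hsymm : μ * ⟪ψ, χ⟫_ℝ = ν * ⟪ψ, χ⟫_ℝ := by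
    rw [← heig χ hχ, schrodForm_comm, heig' ψ hψ, real_inner_comm]
  have hνμ : ν = μ := by
    by_contra hne
    have h0 : ⟪ψ, χ⟫_ℝ = 0 := by
      have : (μ - ν) * ⟪ψ, χ⟫_ℝ = 0 := by linarith
      exact (mul_eq_zero.1 this).resolve_left (sub_ne_zero.2 (Ne.symm hne))
    rw [h0] at hQ
    have h1 : 0 < b ^ 2 * ⟪χ, χ⟫_ℝ := by positivity
    nlinarith [sq_nonneg a]
  refine ⟨hνμ, ?_⟩
  rw [hνμ] at hQ
  have h1 : ⟪a • ψ + b • χ, a • ψ + b • χ⟫_ℝ ≤ 0 := by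
    have e : ⟪a • ψ + b • χ, a • ψ + b • χ⟫_ℝ =
        a ^ 2 * 1 + 2 * a * b * ⟪ψ, χ⟫_ℝ + b ^ 2 * ⟪χ, χ⟫_ℝ := by
      simp only [inner_add_left, inner_add_right, real_inner_smul_left, real_inner_smul_right,
        hψψ, real_inner_comm ψ χ]
      ring
    rw [e]
    nlinarith
  have h2 : a • ψ + b • χ = 0 := by
    by_contra h3
    exact absurd (real_inner_self_pos.2 h3) (not_lt.2 h1)
  rw [Submodule.mem_span_singleton]
  refine ⟨-(a / b), ?_⟩
  have h3 : b • χ = -(a • ψ) := eq_neg_of_add_eq_zero_right h2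
  rw [neg_smul, div_eq_inv_mul, mul_smul, ← smul_neg, ← h3, inv_smul_smul₀ hb0]

theorem LMinus_self (H : Admissible n s p V) {lam : ℝ} (hlam : 0 < lam)
    {φ : L2 n} (hφ : IsNormalizedWave s p V lam φ) : LMinus s p V φ φ 0 :=
  ⟨hφ.mem, fun v hv => by rw [inner_zero_left]; exact formMinus_eq_zero H hlam hφ hv⟩

/-- The component orthogonal to `φ` of a vector in the kernel of `L₋` is a null vector, hence zero. -/
theorem LMinus_zero_iff (H : Admissible n s p V) {lam : ℝ} (hlam : 0 < lam)
    {φ : L2 n} (hφ : IsNormalizedWave s p V lam φ) (u : L2 n) :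
    LMinus s p V φ u 0 ↔ u ∈ Submodule.span ℝ {φ} := by
  rw [Submodule.mem_span_singleton]
  constructor
  · rintro ⟨hu, hu0⟩
    simp only [inner_zero_left] at hu0
    have h0 : ⟪φ, φ⟫_ℝ ≠ 0 := by rw [inner_self_eq_mass hφ]; exact hlam.ne'
    set r := ⟪φ, u⟫_ℝ / ⟪φ, φ⟫_ℝ with hr
    have horth : ⟪φ, u - r • φ⟫_ℝ = 0 := inner_sub_proj_eq_zero h0 u
    have e : u - r • φ = (1 : ℝ) • u + (-r) • φ := by rw [one_smul, neg_smul, sub_eq_add_neg]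
    have h1 := hu0 u hu
    have h2 := hu0 φ hφ.mem
    have h3 := formMinus_self H hlam hφ
    rw [formMinus, linForm_eq] at h1 h2 h3
    have hnull : formMinus s p V φ (u - r • φ) (u - r • φ) = 0 := by
      rw [e, formMinus, linForm_eq, schrodForm_add_smul_self H _ _ _ _ hφ.mem hu hφ.mem, h1, h2,
        h3]
      ring
    have := eq_zero_of_formMinus_null H hlam hφ (hu.sub H (hφ.mem.smul r)) horth hnull
    exact ⟨r, (sub_eq_zero.1 this).symm⟩
  · rintro ⟨r, rfl⟩
    refine ⟨hφ.mem.smul r, fun v hv => ?_⟩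
    rw [inner_zero_left, formMinus, linForm_eq, schrodForm_smul_left]
    have := formMinus_eq_zero H hlam hφ hv
    rw [formMinus, linForm_eq] at this
    rw [this, mul_zero]

end GroundState

end TrappedNLS

theorem proposition3p3 (n : ℕ) (hn : 1 ≤ n) (s : ℝ) (hs0 : 0 < s) (hs1 : s ≤ 1)
    (p : ℝ) (hp1 : 1 < p) (hp2 : p < 1 + 4 * s / n)
    (V : ℝ → ℝ) (hV : IsTrapping V) (lam : ℝ) (hlam : 0 < lam)
    (φ : L2 n) (hφ : IsNormalizedWave s p V lam φ) :
    -- `L₊` has exactly one negative eigenvalue, and it is simple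
    (∃ μ : ℝ, μ < 0 ∧ ∃ ψ : L2 n, ψ ≠ 0 ∧ LPlus s p V φ ψ (μ • ψ) ∧
      ∀ ν : ℝ, ν < 0 → ∀ χ : L2 n, χ ≠ 0 → LPlus s p V φ χ (ν • χ) →
        ν = μ ∧ χ ∈ Submodule.span ℝ {ψ}) ∧
    -- `L₊ ≥ 0` on the orthogonal complement of `φ`
    (∀ h : L2 n, MemEnergySpace s V h → ⟪φ, h⟫_ℝ = 0 → 0 ≤ formPlus s p V φ h h) ∧
    -- `φ` is orthogonal to the kernel of `L₊`
    (∀ ψ : L2 n, LPlus s p V φ ψ 0 → ⟪φ, ψ⟫_ℝ = 0) ∧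
    -- `L₋ ≥ 0`
    (∀ h : L2 n, MemEnergySpace s V h → 0 ≤ formMinus s p V φ h h) ∧
    -- `L₋ φ = 0`
    LMinus s p V φ φ 0 ∧
    -- `L₋ ≥ δ > 0` on the orthogonal complement of `φ`
    (∃ δ : ℝ, 0 < δ ∧ ∀ h : L2 n, MemEnergySpace s V h → ⟪φ, h⟫_ℝ = 0 →
      δ * ‖h‖ ^ 2 ≤ formMinus s p V φ h h) ∧
    -- the kernel of `L₋` is the span of `φ`
    (∀ u : L2 n, LMinus s p V φ u 0 ↔ u ∈ Submodule.span ℝ {φ}) := by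
  have H : Admissible n s p V := ⟨hn, hs0, hs1, hp1, hp2, hV⟩
  exact ⟨exists_simple_negative_eigenvalue H hlam hφ,
    fun h hh horth => formPlus_nonneg_of_orthogonal H hlam hφ hh horth,
    fun ψ hψ => inner_eq_zero_of_kernel H hlam hφ hψ,
    fun h hh => formMinus_nonneg H hlam hφ hh,
    LMinus_self H hlam hφ, exists_gap H hlam hφ, LMinus_zero_iff H hlam hφ⟩
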